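/- All theories are first-order theories with equality. Let $\mathsf{ZF}^+_{-\mathsf{inf}}$ be the theory in the language $\{\in\}$ axiomatized by extensionality, pairing, union, power set, regularity, the schemes of separation and replacement, and the axiom of transitive closure (every set is contained in a transitive set). Work in $\mathsf{ZF}^+_{-\mathsf{inf}}$. An $(S,\in)$-structure is a finite (possibly empty) structure $A=(D,S^A,\in^A)$ with a ternary relation $S^A$ and a binary relation $\in^A$ on $D$ such that $a\in^A b$ implies $S^A(a,b,c)$ for all $a,b,c\in D$. It is $\in$-absolute if $a\in^A b\Leftrightarrow a\in b$ for all $a,b\in D$. Write $A\lessdot_v B$ if $B$ is an $(S,\in)$-structure extending $A$ (as a substructure) by exactly one additional element $v$, and neither $x\in^B v$ nor $v\in^B x$ holds for any $x\in B$. Ordered pairs are Kuratowski pairs $(x,y)=\{\{x\},\{x,y\}\}$, triples are $(x,y,z)=(x,(y,z))$, and $6\alpha$ is the ordinal product with $6(\alpha+1)=6\alpha+6$. Define ternary relations $\mathsf S_\alpha$ on $V_{6\alpha}$ by transfinite recursion: $\mathsf S_0=\emptyset$; $\mathsf S_\lambda=\bigcup_{\alpha<\lambda}\mathsf S_\alpha$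 for limit $\lambda$; and for $a,b,c\in V_{6\alpha+6}$: 1. if $a,b,c\in V_{6\alpha}$, then $(a,b,c)\in\mathsf S_{\alpha+1}$ iff $(a,b,c)\in\mathsf S_\alpha$; 2. if $A\lessdot_v B$ are $(S,\in)$-structures with domains included in $V_{6\alpha}$ such that $A$ is $\in$-absolute and $S^A$ is the restriction of $\mathsf S_\alpha$ to the domain of $A$, if $f$ is the map on $B$ that is the identity on $A$ and sends $v$ to $(6\alpha+3,(A,B))$, and if $(a,b,c)=(f(x),f(y),f(z))$ with $x,y,z\in B$, then $(a,b,c)\in\mathsf S_{\alpha+1}$ iff $S^B(x,y,z)$; 3. in all remaining cases $(a,b,c)\in\mathsf S_{\alpha+1}$. Let $\mathsf S=\bigcup_{\alpha\in\mathsf{Ord}}\mathsf S_\alpha$. Let $T_1$ be the definitional extension of $\mathsf{ZF}^+_{-\mathsf{inf}}$ by a ternary predicate symbol $S$ with the defining axiom $\forall x,y,z\,(S(x,y,z)\leftrightarrow\mathsf S(x,y,z))$, and let $T_0$ be the set of all theorems of $T_1$ in the language with the single predicate symbol $S$. **Theorem.** Every consistent computably enumerable theory $T$ in the language $\{S\}$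 that extends $T_0$ (i.e. proves every sentence of $T_0$) has a computable model: a model whose domain is a computable set of natural numbers and in which the interpretation of $S$ is a computable set of triples. -/

import Mathlib

namespace Tern

open FirstOrder FirstOrder.Language

/-! ### A Hilbert-style calculus for first-order logic with equality

Formulas of the calculus have their free variables in `ℕ`; `⊥`, `→`, `∀` and `=` are the primitive
logical symbols. -/

section Calculus

variable {L : FirstOrder.Language.{0, 0}}

/-- `φ(t)`: the term `t` is substituted for the single in-scope bound variable of `φ`. -/
def inst (φ : L.BoundedFormula ℕ 1) (t : L.Term ℕ) : L.Formula ℕ :=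
  φ.toFormula.subst (Sum.elim Term.var (fun _ => t))

/-- Renames every free variable `k` to `k + 1`, so that the variable `0` becomes fresh. -/
def shift (φ : L.Formula ℕ) : L.Formula ℕ :=
  φ.relabel Nat.succ

/-- `φ(x)` for the fresh variable `x = 0`, the other free variables being shifted by one. -/
def openFresh (φ : L.BoundedFormula ℕ 1) : L.Formula ℕ :=
  φ.toFormula.relabel (Sum.elim Nat.succ (fun _ => 0))

/-- Derivability of a formula from the sentences of `T` in classical first-order logic with
equality. -/
inductive Derives (T : L.Theory) : L.Formula ℕ → Prop
  | ax (σ : L.Sentence) : σ ∈ T → Derives T (Formula.relabel Empty.elim σ)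
  | impK (φ ψ : L.Formula ℕ) : Derives T (φ ⟹ (ψ ⟹ φ))
  | impS (φ ψ χ : L.Formula ℕ) :
      Derives T ((φ ⟹ (ψ ⟹ χ)) ⟹ ((φ ⟹ ψ) ⟹ (φ ⟹ χ)))
  | dne (φ : L.Formula ℕ) : Derives T (((φ ⟹ ⊥) ⟹ ⊥) ⟹ φ)
  | allElim (φ : L.BoundedFormula ℕ 1) (t : L.Term ℕ) : Derives T (φ.all ⟹ inst φ t)
  | eqRefl (t : L.Term ℕ) : Derives T (Term.equal t t)
  | eqSubst (φ : L.BoundedFormula ℕ 1) (t u : L.Term ℕ) :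
      Derives T (Term.equal t u ⟹ (inst φ t ⟹ inst φ u))
  | mp (φ ψ : L.Formula ℕ) : Derives T (φ ⟹ ψ) → Derives T φ → Derives T ψ
  | allIntro (χ : L.Formula ℕ) (φ : L.BoundedFormula ℕ 1) :
      Derives T (shift χ ⟹ openFresh φ) → Derives T (χ ⟹ φ.all)

/-- `T ⊢ σ` for a sentence `σ`. -/
def Proves (T : L.Theory) (σ : L.Sentence) : Prop :=
  Derives T (Formula.relabel Empty.elim σ)

/-- `T` does not prove a contradiction. -/
def Consistent (T : L.Theory) : Prop :=
  ¬ Proves T ⊥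

end Calculus

/-! ### The two signatures -/

/-- The only symbol of the language of set theory: a binary predicate. -/
inductive MemRel : ℕ → Type
  | mem : MemRel 2

/-- The language of set theory. -/
def LMem : FirstOrder.Language.{0, 0} := ⟨fun _ => Empty, MemRel⟩

/-- The membership predicate. -/
def memSym : LMem.Relations 2 := MemRel.mem

/-- The only symbol of the language of `S`: a ternary predicate. -/
inductive SRel : ℕ → Type
  | s : SRel 3

/-- The language with a single ternary predicate `S`. -/
def LS : FirstOrder.Language.{0, 0} := ⟨fun _ => Empty, SRel⟩

/-- The predicate `S`. -/
def sSym : LS.Relations 3 := SRel.s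

/-! ### Writing formulas of set theory

A variable is a natural number. In scope of `d` quantifiers the variables are `0, …, d - 1`,
numbered from the outermost quantifier inwards, as in `BoundedFormula Empty d`. A `Fml` produces
the formula for every depth `d` (its atoms are `⊥` if a variable is not in scope), and a quantifier
at depth `d` hands the new variable `d` to its body. -/

/-- Formulas of set theory, as functions of the number of variables in scope. -/
abbrev Fml : Type := (d : ℕ) → LMem.BoundedFormula Empty d

namespace Fml

def mem (x y : ℕ) : Fml := fun d =>
  if h : x < d ∧ y < d then
    memSym.boundedFormula₂
      (Term.var (Sum.inr ⟨x, h.1⟩)) (Term.var (Sum.inr ⟨y, h.2⟩))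
  else ⊥

def eq (x y : ℕ) : Fml := fun d =>
  if h : x < d ∧ y < d then
    Term.bdEqual (L := LMem) (Term.var (Sum.inr ⟨x, h.1⟩)) (Term.var (Sum.inr ⟨y, h.2⟩))
  else ⊥

/-- `φ(e 0, …, e (k - 1))`, for a formula `φ` with `k` free variables. -/
def app {k : ℕ} (φ : LMem.Formula (Fin k)) (e : Fin k → ℕ) : Fml := fun d =>
  if h : ∀ i, e i < d then
    BoundedFormula.relabel (n := d) (k := 0)
      (fun i => (Sum.inr ⟨e i, h i⟩ : Empty ⊕ Fin d)) φ
  else ⊥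

def not (φ : Fml) : Fml := fun d => (φ d).not
def imp (φ ψ : Fml) : Fml := fun d => (φ d).imp (ψ d)
def and (φ ψ : Fml) : Fml := fun d => φ d ⊓ ψ d
def or (φ ψ : Fml) : Fml := fun d => φ d ⊔ ψ d
def iff (φ ψ : Fml) : Fml := fun d => (φ d).iff (ψ d)
def all (φ : ℕ → Fml) : Fml := fun d => (φ d (d + 1)).all
def ex (φ : ℕ → Fml) : Fml := fun d => (φ d (d + 1)).ex

end Fml

infix:60 " ∈ₛ " => Fml.mem
infix:60 " =ₛ " => Fml.eq
prefix:max "¬ₛ " => Fml.not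
infixr:45 " ∧ₛ " => Fml.and
infixr:40 " ∨ₛ " => Fml.or
infixr:35 " ⇒ₛ " => Fml.imp
infix:30 " ⇔ₛ " => Fml.iff

open Fml (all ex app)

/-! ### The theory `ZF` without infinity, with transitive closures -/

/-- `x ⊆ y` -/
def subset (x y : ℕ) : Fml := all fun z => z ∈ₛ x ⇒ₛ z ∈ₛ y

/-- `x` is a transitive set -/
def isTrans (x : ℕ) : Fml := all fun y => y ∈ₛ x ⇒ₛ subset y x

def extensionality : LMem.Sentence :=
  (all fun x => all fun y => (all fun z => z ∈ₛ x ⇔ₛ z ∈ₛ y) ⇒ₛ x =ₛ y) 0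

def pairing : LMem.Sentence :=
  (all fun x => all fun y => ex fun z => all fun w => w ∈ₛ z ⇔ₛ (w =ₛ x ∨ₛ w =ₛ y)) 0

def union : LMem.Sentence :=
  (all fun x => ex fun u => all fun w => w ∈ₛ u ⇔ₛ ex fun y => y ∈ₛ x ∧ₛ w ∈ₛ y) 0

def powerSet : LMem.Sentence :=
  (all fun x => ex fun p => all fun w => w ∈ₛ p ⇔ₛ subset w x) 0

def regularity : LMem.Sentence :=
  (all fun x => (ex fun y => y ∈ₛ x) ⇒ₛ
    ex fun y => y ∈ₛ x ∧ₛ ¬ₛ (ex fun z => z ∈ₛ x ∧ₛ z ∈ₛ y)) 0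

/-- Every set is contained in a transitive set. -/
def transitiveClosure : LMem.Sentence :=
  (all fun x => ex fun y => subset x y ∧ₛ isTrans y) 0

/-- The instance of separation for `φ(p₀, …, pₙ₋₁, x)`, universally closed over the parameters:
for every `a` the set `{x ∈ a | φ(p, x)}` exists. -/
def separation (n : ℕ) (φ : LMem.Formula (Fin (n + 1))) : LMem.Sentence :=
  ((all fun a => ex fun b => all fun x =>
    x ∈ₛ b ⇔ₛ (x ∈ₛ a ∧ₛ app φ (Fin.snoc (fun i : Fin n => (i : ℕ)) x))) n).alls

/-- The instance of replacement for `φ(p₀, …, pₙ₋₁, x, y)`, universally closed over the parameters: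
for every `a`, if for all `x ∈ a` there is exactly one `y` with `φ(p, x, y)`, then there is a `b`
such that for all `x ∈ a` there is a `y ∈ b` with `φ(p, x, y)`. -/
def replacement (n : ℕ) (φ : LMem.Formula (Fin (n + 2))) : LMem.Sentence :=
  let ψ (x y : ℕ) : Fml :=
    app φ (Fin.snoc (Fin.snoc (fun i : Fin n => (i : ℕ)) x : Fin (n + 1) → ℕ) y)
  ((all fun a =>
    (all fun x => x ∈ₛ a ⇒ₛ ex fun z => all fun y => ψ x y ⇔ₛ y =ₛ z) ⇒ₛ
      ex fun b => all fun x => x ∈ₛ a ⇒ₛ ex fun y => y ∈ₛ b ∧ₛ ψ x y) n).alls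

/-- `ZF` with the axiom of infinity removed and the axiom of transitive closure added. -/
def ZFminusInfPlus : LMem.Theory :=
  {extensionality, pairing, union, powerSet, regularity, transitiveClosure} ∪
    {σ | ∃ n φ, σ = separation n φ} ∪ {σ | ∃ n φ, σ = replacement n φ}

/-! ### Set-theoretic vocabulary -/

/-- `x = ∅` -/
def isEmpty (x : ℕ) : Fml := all fun z => ¬ₛ (z ∈ₛ x)

/-- `y = x ∪ {u}` -/
def isInsert (y u x : ℕ) : Fml := all fun z => z ∈ₛ y ⇔ₛ (z ∈ₛ x ∨ₛ z =ₛ u)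

/-- `y = x + 1 = x ∪ {x}` -/
def isSucc (y x : ℕ) : Fml := isInsert y x x

/-- `y = x + k`, for a fixed natural number `k` -/
def isAdd : ℕ → ℕ → ℕ → Fml
  | 0, y, x => y =ₛ x
  | k + 1, y, x => ex fun z => isAdd k z x ∧ₛ isSucc y z

/-- `y` is the power set of `x` -/
def isPower (y x : ℕ) : Fml := all fun z => z ∈ₛ y ⇔ₛ subset z x

/-- `p = {x, y}` -/
def isUPair (p x y : ℕ) : Fml := all fun z => z ∈ₛ p ⇔ₛ (z =ₛ x ∨ₛ z =ₛ y)

/-- `p = (x, y) = {{x}, {x, y}}` -/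
def isPair (p x y : ℕ) : Fml :=
  ex fun u => ex fun w => isUPair u x x ∧ₛ isUPair w x y ∧ₛ isUPair p u w

/-- `t = (x, y, z) = (x, (y, z))` -/
def isTriple (t x y z : ℕ) : Fml := ex fun u => isPair u y z ∧ₛ isPair t x u

/-- `(x, y) ∈ r` -/
def pairMem (x y r : ℕ) : Fml := ex fun p => isPair p x y ∧ₛ p ∈ₛ r

/-- `(x, y, z) ∈ r` -/
def tripleMem (x y z r : ℕ) : Fml := ex fun t => isTriple t x y z ∧ₛ t ∈ₛ r

/-- `x` is an ordinal: a transitive set of transitive sets -/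
def isOrd (x : ℕ) : Fml := isTrans x ∧ₛ all fun y => y ∈ₛ x ⇒ₛ isTrans y

/-- the ordinal `x` is a limit: it is not `0`, and it is closed under successor -/
def isLimit (x : ℕ) : Fml :=
  (ex fun y => y ∈ₛ x) ∧ₛ all fun y => y ∈ₛ x ⇒ₛ ex fun z => z ∈ₛ x ∧ₛ isSucc z y

/-- `x` is finite (in the sense of Kuratowski): it belongs to every family of sets that
contains `∅` and is closed under `y ↦ y ∪ {u}` for `u ∈ x` -/
def isFinite (x : ℕ) : Fml :=
  all fun f =>
    (all fun e => isEmpty e ⇒ₛ e ∈ₛ f) ∧ₛ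
    (all fun y => all fun u => all fun z =>
      y ∈ₛ f ∧ₛ u ∈ₛ x ∧ₛ isInsert z u y ⇒ₛ z ∈ₛ f) ⇒ₛ
    x ∈ₛ f

/-- `x = F(α)` for the function `F` on the ordinals given by transfinite recursion:
`F(0) = ∅`, `F(γ + 1)` is the `z` with `step γ F(γ) z`, and `F(γ) = ⋃ {F(δ) | δ < γ}` for
limit `γ`. It says that there is a function `h` on `α + 1` obeying these clauses, with
`h(α) = x`. -/
def recursion (step : ℕ → ℕ → ℕ → Fml) (α x : ℕ) : Fml :=
  ex fun h =>
    (all fun p => p ∈ₛ h ⇒ₛ ex fun γ => ex fun y => (γ ∈ₛ α ∨ₛ γ =ₛ α) ∧ₛ isPair p γ y) ∧ₛ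
    (all fun γ => (γ ∈ₛ α ∨ₛ γ =ₛ α) ⇒ₛ ex fun y => all fun z => pairMem γ z h ⇔ₛ z =ₛ y) ∧ₛ
    (all fun γ => all fun y => isEmpty γ ∧ₛ pairMem γ y h ⇒ₛ isEmpty y) ∧ₛ
    (all fun γ => all fun δ => all fun y => all fun z =>
      isSucc δ γ ∧ₛ pairMem γ y h ∧ₛ pairMem δ z h ⇒ₛ step γ y z) ∧ₛ
    (all fun γ => all fun y => isLimit γ ∧ₛ pairMem γ y h ⇒ₛ
      all fun z => z ∈ₛ y ⇔ₛ ex fun δ => ex fun w => δ ∈ₛ γ ∧ₛ pairMem δ w h ∧ₛ z ∈ₛ w) ∧ₛ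
    pairMem α x h

/-- `x = V_α` -/
def isV (α x : ℕ) : Fml := recursion (fun _ y z => isPower z y) α x

/-- `x = 6 · α`, the ordinal product, so that `6 · (α + 1) = 6 · α + 6` -/
def isSixTimes (α x : ℕ) : Fml := recursion (fun _ y z => isAdd 6 z y) α x

/-! ### The relation `S`, defined in set theory -/

/-- `A = (D, R, E)` is an `(S, ∈)`-structure: `D` is a finite set, `R ⊆ D³` interprets `S`,
`E ⊆ D²` interprets `∈`, and `(a, b) ∈ E` implies `(a, b, c) ∈ R` for all `a, b, c ∈ D`. -/
def isStruct (A D R E : ℕ) : Fml :=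
  isTriple A D R E ∧ₛ isFinite D ∧ₛ
  (all fun t => t ∈ₛ R ⇒ₛ ex fun a => ex fun b => ex fun c =>
    a ∈ₛ D ∧ₛ b ∈ₛ D ∧ₛ c ∈ₛ D ∧ₛ isTriple t a b c) ∧ₛ
  (all fun t => t ∈ₛ E ⇒ₛ ex fun a => ex fun b => a ∈ₛ D ∧ₛ b ∈ₛ D ∧ₛ isPair t a b) ∧ₛ
  (all fun a => all fun b => all fun c =>
    a ∈ₛ D ∧ₛ b ∈ₛ D ∧ₛ c ∈ₛ D ∧ₛ pairMem a b E ⇒ₛ tripleMem a b c R)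

/-- `(D', R', E')` extends `(D, R, E)` neutrally by `v`: it is an extension with exactly the one
additional element `v`, and `E'` relates `v` to no element, in either order. -/
def isNeutralExt (D R E D' R' E' v : ℕ) : Fml :=
  ¬ₛ (v ∈ₛ D) ∧ₛ isInsert D' v D ∧ₛ
  (all fun a => all fun b => all fun c => a ∈ₛ D ∧ₛ b ∈ₛ D ∧ₛ c ∈ₛ D ⇒ₛ
    (tripleMem a b c R ⇔ₛ tripleMem a b c R')) ∧ₛ
  (all fun a => all fun b => a ∈ₛ D ∧ₛ b ∈ₛ D ⇒ₛ (pairMem a b E ⇔ₛ pairMem a b E')) ∧ₛ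
  (all fun x => x ∈ₛ D' ⇒ₛ ¬ₛ (pairMem x v E') ∧ₛ ¬ₛ (pairMem v x E'))

/-- `(D, E)` is `∈`-absolute: `E` is the true membership relation on `D`. -/
def isAbsolute (D E : ℕ) : Fml :=
  all fun a => all fun b => a ∈ₛ D ∧ₛ b ∈ₛ D ⇒ₛ (a ∈ₛ b ⇔ₛ pairMem a b E)

/-- `R` is the restriction of the ternary relation `s` to `D`. -/
def isRestr (D R s : ℕ) : Fml :=
  all fun a => all fun b => all fun c => a ∈ₛ D ∧ₛ b ∈ₛ D ∧ₛ c ∈ₛ D ⇒ₛ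
    (tripleMem a b c R ⇔ₛ tripleMem a b c s)

/-- `f(x) = y`, where `f` keeps all elements of `D` in place and maps `v` to `(κ, (A, B))`. -/
def isImage (D A B v κ x y : ℕ) : Fml :=
  (x ∈ₛ D ∧ₛ y =ₛ x) ∨ₛ (x =ₛ v ∧ₛ ex fun u => isPair u A B ∧ₛ isPair y κ u)

/-- `s' = S_{α+1}`, computed from `s = S_α`. Here `W = V_{6α}`, `W' = V_{6α+6}` and `κ = 6α + 3`.
A triple `t = (a, b, c)` of elements of `W'` belongs to `s'` unless a clause excludes it: a triple
of elements of `W` is decided by `s`, a triple `(f(x), f(y), f(z))` with `f = f_{α,A,B}` and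
`x, y, z ∈ B` is decided by the interpretation of `S` in `B`, and the remaining triples all belong
to `s'`. -/
def stepS (α s s' : ℕ) : Fml :=
  ex fun β => ex fun W => ex fun β' => ex fun W' => ex fun κ =>
    isSixTimes α β ∧ₛ isV β W ∧ₛ isAdd 6 β' β ∧ₛ isV β' W' ∧ₛ isAdd 3 κ β ∧ₛ
    all fun t => t ∈ₛ s' ⇔ₛ ex fun a => ex fun b => ex fun c =>
      isTriple t a b c ∧ₛ a ∈ₛ W' ∧ₛ b ∈ₛ W' ∧ₛ c ∈ₛ W' ∧ₛ
      (a ∈ₛ W ∧ₛ b ∈ₛ W ∧ₛ c ∈ₛ W ⇒ₛ t ∈ₛ s) ∧ₛ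
      all fun A => all fun D => all fun R => all fun E =>
      all fun B => all fun D' => all fun R' => all fun E' => all fun v =>
        isStruct A D R E ∧ₛ isStruct B D' R' E' ∧ₛ isNeutralExt D R E D' R' E' v ∧ₛ
        subset D W ∧ₛ subset D' W ∧ₛ isAbsolute D E ∧ₛ isRestr D R s ⇒ₛ
          all fun x => all fun y => all fun z =>
            isImage D A B v κ x a ∧ₛ isImage D A B v κ y b ∧ₛ isImage D A B v κ z c ⇒ₛ
              tripleMem x y z R'

/-- `r = S_α` -/
def isSLevel (α r : ℕ) : Fml := recursion stepS α r

/-- `(x, y, z)` belongs to the union of the `S_α` over all ordinals `α`. -/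
def defS (x y z : ℕ) : Fml :=
  ex fun α => ex fun r => isOrd α ∧ₛ isSLevel α r ∧ₛ tripleMem x y z r

/-! ### The theories `T₁` and `T₀` -/

/-- The defining axiom `∀ x y z, S(x, y, z) ↔ defS(x, y, z)`. -/
def axiomS : (LMem.sum LS).Sentence :=
  (BoundedFormula.iff
    (Relations.boundedFormula
      ((LHom.sumInr : LS →ᴸ LMem.sum LS).onRelation sSym)
      (fun i : Fin 3 => Term.var (Sum.inr i)))
    (LHom.sumInl.onBoundedFormula (defS 0 1 2 3))).alls

/-- The definitional extension of set theory by the predicate `S`. -/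
def T₁ : (LMem.sum LS).Theory :=
  LHom.sumInl.onTheory ZFminusInfPlus ∪ {axiomS}

/-- The theorems of `T₁` in the language with just `S`. -/
def T₀ : LS.Theory :=
  {σ | Proves T₁ (LHom.sumInr.onSentence σ)}

/-! ### Computably enumerable theories and computable models -/

/-- The number of a variable; `LS` has no other terms. -/
def varNum {d : ℕ} : LS.Term (Empty ⊕ Fin d) → ℕ
  | .var (.inl e) => e.elim
  | .var (.inr i) => i
  | .func f _ => Empty.elim f

/-- The Gödel number of a formula. -/
def godelNum : {d : ℕ} → LS.BoundedFormula Empty d → ℕ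
  | _, .falsum => Nat.pair 0 0
  | _, .equal t u => Nat.pair 1 (Nat.pair (varNum t) (varNum u))
  | _, .rel SRel.s ts =>
      Nat.pair 2 (Nat.pair (varNum (ts 0)) (Nat.pair (varNum (ts 1)) (varNum (ts 2))))
  | _, .imp φ ψ => Nat.pair 3 (Nat.pair (godelNum φ) (godelNum ψ))
  | _, .all φ => Nat.pair 4 (godelNum φ)

/-- The set of Gödel numbers of the sentences of `T` is computably enumerable. -/
def IsCE (T : LS.Theory) : Prop :=
  REPred fun m : ℕ => ∃ σ ∈ T, godelNum σ = m

/-- The structure with domain `D` in which `S` is interpreted by the triples in `R`. -/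
@[reducible]
def structOn (D : Set ℕ) (R : Set (ℕ × ℕ × ℕ)) : LS.Structure D where
  funMap f := Empty.elim f
  RelMap
    | SRel.s => fun a => ((a 0 : ℕ), (a 1 : ℕ), (a 2 : ℕ)) ∈ R

/-- `T` has a model whose domain is a (non-empty) computable set of natural numbers and in which
the interpretation of `S` is a computable set of triples. -/
def HasComputableModel (T : LS.Theory) : Prop :=
  ∃ (D : Set ℕ) (R : Set (ℕ × ℕ × ℕ)),
    D.Nonempty ∧ R ⊆ D ×ˢ D ×ˢ D ∧
    ComputablePred (fun n => n ∈ D) ∧ ComputablePred (fun t => t ∈ R) ∧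
    @Theory.Model LS D (structOn D R) T

end Tern

/-! The proof has a set-theoretic half and a computability half, linked by one property of models:
neutral extensions. Take finitely many elements and an `S`-pattern for one further element, subject
only to the constraint that `a ∈ b` forces `S(a, b, new)`. Then some element realizes the pattern
and is unrelated by membership to the given ones and to itself.

In a model of `T₁` this holds because of how `S` is defined (`exists_setS_extension`). The pair
`(6α+3, (A, B))` is reserved for the pattern coded by `(A, B)`. It lies outside `V_{6α}`, so
patterns treated at the same level do not interfere, and later levels never revise earlier decisions
(`sLev_coherent`). Also `a ∈ b` forces `S(a, b, c)` for every `c` (`setS_of_mem`). Conversely, if `a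
∉ b`, a pattern in which `S(a, b, new)` fails is admissible and hence realized. So membership is
definable as `∀ z, S(x, y, z)` (`forall_setS_iff`), and the neutral extension property becomes a set
of sentences in `S` alone, one for each finite pattern. By completeness they belong to `T₀`, so
every model of `T` satisfies them (`hasNeutralExtensions_of_proves`). Nothing else about set theory
is used afterwards.

Next, the requirement on a valuation of all formulas over a countable stock of names to be a
complete Henkin theory containing `T` is a primitive recursive sequence of forbidden finite
assignments. The leftmost valuation avoiding them is a limit of a primitive recursive sequence
(`exists_limit_assignment`). This gives a model of `T` on names in which equality, `S` and the
defined membership are all limit computable. Membership is included, in spite of its universal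
quantifier, because the valuation decides every formula.

Finally, a limit computable structure with neutral extensions has a computable copy
(`IsExtensible.exists_computable_copy`), by a finite-injury back-and-forth. In the copy `S` holds by
default, and a failure can be declared only at the stage whose number is the largest element of the
triple, so `S` is decidable. Each stage keeps a finite list matching elements with names; when the
approximation changes its mind, the list is cut back to its longest prefix that still looks correct.
An element that loses its name keeps its decided `S`-facts, and the extension property supplies a
new name for it. The only obstruction would be a declared failure of `S(x, y, z)` for `x, y` whose
names are related by membership, which the clause on `M` in `Good` rules out. Every position
stabilizes (`IsExtensible.exists_stable_prefix`), the limit correspondence induces an isomorphism,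
and `realize_iff_valuation` transfers the truth of `T` to the copy. -/

namespace Tern
open FirstOrder FirstOrder.Language

/-! ### Simultaneous substitution in bounded formulas -/

section Substitution

variable {L : FirstOrder.Language.{0, 0}} {α β γ : Type}

/-- Lifts a simultaneous substitution under a quantifier. -/
def liftSub {n m : ℕ} (s : α ⊕ Fin n → L.Term (β ⊕ Fin m)) :
    α ⊕ Fin (n + 1) → L.Term (β ⊕ Fin (m + 1)) :=
  Sum.elim (fun a => (s (.inl a)).relabel (Sum.map id Fin.castSucc))
    (Fin.lastCases (.var (.inr (Fin.last m)))
      (fun i => (s (.inr i)).relabel (Sum.map id Fin.castSucc)))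

/-- Simultaneous substitution for free and in-scope bound variables. -/
def opn : {n m : ℕ} → L.BoundedFormula α n → (α ⊕ Fin n → L.Term (β ⊕ Fin m)) →
    L.BoundedFormula β m
  | _, _, .falsum, _ => .falsum
  | _, _, .equal t u, s => .equal (t.subst s) (u.subst s)
  | _, _, .rel R ts, s => .rel R fun i => (ts i).subst s
  | _, _, .imp φ ψ, s => .imp (opn φ s) (opn ψ s)
  | _, _, .all φ, s => .all (opn φ (liftSub s))

theorem term_subst_subst (t : L.Term α) (s : α → L.Term β) (s' : β → L.Term γ) :
    (t.subst s).subst s' = t.subst fun a => (s a).subst s' := by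
  induction t with
  | var => rfl
  | func f ts ih => simp [Term.subst, ih]

theorem term_relabel_eq_subst (t : L.Term α) (f : α → β) :
    t.relabel f = t.subst fun a => .var (f a) := by
  induction t with
  | var => rfl
  | func f ts ih => simp [Term.subst, Term.relabel, ih]

/-- Weakened terms never mention the new last variable, so lifting commutes with composition. This
is the quantifier case of `opn_opn`. -/
theorem liftSub_liftSub {n m k : ℕ} (s : α ⊕ Fin n → L.Term (β ⊕ Fin m))
    (s' : β ⊕ Fin m → L.Term (γ ⊕ Fin k)) :
    (fun x => (liftSub s x).subst (liftSub s')) = liftSub fun x => (s x).subst s' := by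
  have key : ∀ t : L.Term (β ⊕ Fin m),
      (t.relabel (Sum.map id Fin.castSucc)).subst (liftSub s') =
        (t.subst s').relabel (Sum.map id Fin.castSucc) := by
    intro t
    simp only [term_relabel_eq_subst, term_subst_subst]
    congr 1
    funext x
    rcases x with x | x <;> simp [Term.subst, liftSub, term_relabel_eq_subst]
  funext x
  rcases x with x | x
  · exact key _
  · induction x using Fin.lastCases with
    | last => simp [liftSub, Term.subst]
    | cast i => simpa [liftSub] using key _

/-- Once every substitution-like operation is written as an `opn`, this composition law reduces each
identity between them to a comparison of two functions on variables. -/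
theorem opn_opn {n m k : ℕ} (φ : L.BoundedFormula α n) (s : α ⊕ Fin n → L.Term (β ⊕ Fin m))
    (s' : β ⊕ Fin m → L.Term (γ ⊕ Fin k)) :
    opn (opn φ s) s' = opn φ fun x => (s x).subst s' := by
  induction φ generalizing m k with
  | falsum => rfl
  | equal => simp [opn, term_subst_subst]
  | rel => simp [opn, term_subst_subst]
  | imp _ _ ih1 ih2 => simp [opn, ih1, ih2]
  | all _ ih => simp [opn, ih, liftSub_liftSub]

theorem subst_eq_opn {n : ℕ} (φ : L.BoundedFormula α n) (f : α → L.Term β) :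
    φ.subst f = opn φ (Sum.elim (fun a => (f a).relabel .inl) (fun i => .var (.inr i))) := by
  induction φ with
  | falsum => rfl
  | equal => rfl
  | rel => rfl
  | imp _ _ ih1 ih2 => exact congrArg₂ _ ih1 ih2
  | all φ ih =>
    refine congrArg BoundedFormula.all (ih.trans ?_)
    congr 1
    funext x
    rcases x with x | x
    · simp [liftSub, Function.comp_def]
    · induction x using Fin.lastCases <;> simp [liftSub]

theorem relabel_eq_opn {n k : ℕ} (g : α → β ⊕ Fin n) (φ : L.BoundedFormula α k) :
    φ.relabel g = opn φ fun x => .var (BoundedFormula.relabelAux g k x) := by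
  induction φ with
  | falsum => rfl
  | equal =>
    simp [BoundedFormula.relabel, BoundedFormula.mapTermRel, opn, term_relabel_eq_subst]
  | rel =>
    simp [BoundedFormula.relabel, BoundedFormula.mapTermRel, opn, term_relabel_eq_subst]
  | imp _ _ ih1 ih2 => exact congrArg₂ _ ih1 ih2
  | @all k φ ih =>
    rw [BoundedFormula.relabel_all, ih]
    refine congrArg BoundedFormula.all ?_
    congr 1
    funext x
    rcases x with x | x
    · simp only [liftSub, BoundedFormula.relabelAux, Function.comp, Sum.map_inl, Sum.elim_inl]
      rcases g x with y | y
      · simp [Term.relabel]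
      · simp [Term.relabel, Fin.ext_iff]
    · induction x using Fin.lastCases with
      | last => simp [liftSub, BoundedFormula.relabelAux]
      | cast i => simp [liftSub, BoundedFormula.relabelAux]

/-- In the quantifier case `toFormula` first frees all bound variables and then rebinds the last one
through `finSumFinEquiv`; the two relabellings compose to a lifted substitution. -/
theorem toFormula_eq_opn {n : ℕ} (φ : L.BoundedFormula α n) :
    φ.toFormula = opn φ fun x => .var (.inl x) := by
  induction φ with
  | falsum => rfl
  | equal =>
    simp [BoundedFormula.toFormula, opn, Term.equal, Term.bdEqual, term_relabel_eq_subst]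
  | rel =>
    simp [BoundedFormula.toFormula, opn, Relations.formula, Relations.boundedFormula,
      term_relabel_eq_subst]
  | imp _ _ ih1 ih2 => exact congrArg₂ _ ih1 ih2
  | all φ ih =>
    rw [BoundedFormula.toFormula, ih, relabel_eq_opn, opn_opn]
    refine congrArg BoundedFormula.all ?_
    congr 1
    funext x
    rcases x with x | x
    · simp [liftSub, Term.subst, BoundedFormula.relabelAux]
    · induction x using Fin.lastCases with
      | last => simp [liftSub, Term.subst, BoundedFormula.relabelAux]; rfl
      | cast i =>
        have : (finSumFinEquiv.symm i.castSucc : Fin _ ⊕ Fin 1) = .inl i := by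
          rw [Equiv.symm_apply_eq]; rfl
        simp [liftSub, Term.subst, BoundedFormula.relabelAux, this]

/-- Only finitely many free variables occur in a formula. Expressed through `opn`, this is the form
in which a fresh variable is later exploited. -/
theorem opn_congr {n : ℕ} (φ : L.BoundedFormula α n) : ∃ F : Finset α,
    ∀ {m : ℕ} (s s' : α ⊕ Fin n → L.Term (β ⊕ Fin m)), (∀ a ∈ F, s (.inl a) = s' (.inl a)) →
      (∀ i, s (.inr i) = s' (.inr i)) → opn φ s = opn φ s' := by
  classical
  have term : ∀ {n : ℕ} (t : L.Term (α ⊕ Fin n)), ∃ F : Finset α,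
      ∀ {m : ℕ} (s s' : α ⊕ Fin n → L.Term (β ⊕ Fin m)), (∀ a ∈ F, s (.inl a) = s' (.inl a)) →
      (∀ i, s (.inr i) = s' (.inr i)) → t.subst s = t.subst s' := by
    intro n t
    induction t with
    | var x =>
      rcases x with x | x
      · exact ⟨{x}, fun s s' h _ => h x (by simp)⟩
      · exact ⟨∅, fun s s' _ h => h x⟩
    | func f ts ih =>
      choose F hF using ih
      refine ⟨Finset.univ.biUnion F, fun s s' h h' => ?_⟩
      simp only [Term.subst]
      congr 1
      funext i
      exact hF i s s' (fun a ha => h a (Finset.mem_biUnion.2 ⟨i, by simp, ha⟩)) h'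
  induction φ with
  | falsum => exact ⟨∅, fun _ _ _ _ => rfl⟩
  | equal t u =>
    obtain ⟨F, hF⟩ := term t
    obtain ⟨G, hG⟩ := term u
    refine ⟨F ∪ G, fun s s' h h' => ?_⟩
    simp only [opn]
    rw [hF s s' (fun a ha => h a (by simp [ha])) h', hG s s' (fun a ha => h a (by simp [ha])) h']
  | rel R ts =>
    choose F hF using fun i => term (ts i)
    refine ⟨Finset.univ.biUnion F, fun s s' h h' => ?_⟩
    simp only [opn]
    congr 1
    funext i
    exact hF i s s' (fun a ha => h a (Finset.mem_biUnion.2 ⟨i, by simp, ha⟩)) h'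
  | imp φ ψ ih1 ih2 =>
    obtain ⟨F, hF⟩ := ih1
    obtain ⟨G, hG⟩ := ih2
    refine ⟨F ∪ G, fun s s' h h' => ?_⟩
    simp only [opn]
    rw [hF s s' (fun a ha => h a (by simp [ha])) h', hG s s' (fun a ha => h a (by simp [ha])) h']
  | all φ ih =>
    obtain ⟨F, hF⟩ := ih
    refine ⟨F, fun s s' h h' => ?_⟩
    simp only [opn]
    rw [hF (liftSub s) (liftSub s') (fun a ha => by simp [liftSub, h a ha]) fun i => by
      induction i using Fin.lastCases <;> simp [liftSub, h'] ]

end Substitution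

/-! ### Derived rules of the calculus -/

section Provability

variable {L : FirstOrder.Language.{0, 0}} {T : L.Theory}

/-- The substitution that renames the free variables of a formula. -/
def renSub {α β : Type} (f : α → β) : α ⊕ Fin 0 → L.Term (β ⊕ Fin 0) :=
  Sum.elim (fun k => .var (.inl (f k))) Fin.elim0

theorem formula_relabel_eq_opn {α β : Type} (f : α → β) (χ : L.Formula α) :
    Formula.relabel f χ = opn χ (renSub f) := by
  refine (relabel_eq_opn _ _).trans ?_
  congr 1
  funext x
  rcases x with x | x
  · rfl
  · exact x.elim0

theorem inst_eq_opn (φ : L.BoundedFormula ℕ 1) (t : L.Term ℕ) :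
    inst φ t = opn φ (Sum.elim (fun k => .var (.inl k)) (fun _ => t.relabel .inl)) := by
  unfold inst
  rw [toFormula_eq_opn, subst_eq_opn, opn_opn]
  congr 1
  funext x
  rcases x with x | x <;> rfl

theorem openFresh_eq_opn (φ : L.BoundedFormula ℕ 1) :
    openFresh φ = opn φ (Sum.elim (fun k => .var (.inl (k + 1))) (fun _ => .var (.inl 0))) := by
  unfold openFresh
  rw [toFormula_eq_opn, formula_relabel_eq_opn, opn_opn]
  congr 1
  funext x
  rcases x with x | x <;> rfl

theorem opn_inst (φ : L.BoundedFormula ℕ 1) (t : L.Term ℕ) (f : ℕ → ℕ) :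
    opn (inst φ t) (renSub f) = inst (opn φ (liftSub (renSub f))) (t.relabel f) := by
  rw [inst_eq_opn, inst_eq_opn, opn_opn, opn_opn]
  congr 1
  funext x
  rcases x with x | x
  · rfl
  · fin_cases x
    simp only [Sum.elim_inr, liftSub, term_relabel_eq_subst, term_subst_subst]
    rfl

/-- Axioms are closed under arbitrary renamings, injective or not. The renaming has to vary in the
induction, because `allIntro` shifts the variables. -/
theorem Derives.rename {χ : L.Formula ℕ} (h : Derives T χ) (f : ℕ → ℕ) :
    Derives T (opn χ (renSub f)) := by
  induction h generalizing f with
  | ax σ hσ =>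
    have := Derives.ax σ hσ
    rw [formula_relabel_eq_opn] at this ⊢
    rw [opn_opn]
    convert this using 2
    funext x
    rcases x with x | x
    · exact x.elim
    · exact x.elim0
  | impK => exact .impK _ _
  | impS => exact .impS _ _ _
  | dne => exact .dne _
  | allElim φ t =>
    have := Derives.allElim (T := T) (opn φ (liftSub (renSub f))) (t.relabel f)
    rw [← opn_inst] at this
    exact this
  | eqRefl t =>
    have := Derives.eqRefl (T := T) (t.relabel f)
    convert this using 1
    simp only [Term.equal, Term.bdEqual, opn, term_relabel_eq_subst, term_subst_subst]
    rfl
  | eqSubst φ t u =>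
    have := Derives.eqSubst (T := T) (opn φ (liftSub (renSub f))) (t.relabel f) (u.relabel f)
    rw [← opn_inst, ← opn_inst] at this
    convert this using 1
    simp only [Term.equal, Term.bdEqual, opn, term_relabel_eq_subst, term_subst_subst]
    rfl
  | mp φ ψ _ _ ih1 ih2 => exact .mp _ _ (ih1 f) (ih2 f)
  | allIntro χ φ _ ih =>
    refine Derives.allIntro _ (opn φ (liftSub (renSub f))) ?_
    -- The lifted renaming fixes the eigenvariable `0` and acts as `f` on the shifted variables.
    have := ih (fun k => k.casesOn 0 fun j => f j + 1)
    convert this using 1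
    simp only [opn]
    congr 1
    · simp only [shift, formula_relabel_eq_opn, opn_opn]
      congr 1
      funext x
      rcases x with x | x
      · rfl
      · exact x.elim0
    · simp only [openFresh_eq_opn, opn_opn]
      congr 1
      funext x
      rcases x with x | x
      · rfl
      · fin_cases x; rfl

/-- If all variable instances of `φ` follow from `χ`, then so does `∀ x, φ`. -/
theorem Derives.all_of_forall_inst {χ : L.Formula ℕ} {φ : L.BoundedFormula ℕ 1}
    (h : ∀ j, Derives T (χ ⟹ inst φ (.var j))) : Derives T (χ ⟹ φ.all) := by
  obtain ⟨F, hF⟩ := opn_congr (β := ℕ) χ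
  obtain ⟨G, hG⟩ := opn_congr (β := ℕ) φ
  obtain ⟨j, hj⟩ := Infinite.exists_notMem_finset (F ∪ G)
  simp only [Finset.mem_union, not_or] at hj
  refine .allIntro _ _ ?_
  -- As `j` occurs in neither formula, moving it to `0` and shifting all other variables turns the
  -- instance at `j` into exactly the premise of `allIntro`.
  have := (h j).rename fun k => if k = j then 0 else k + 1
  convert this using 1
  simp only [opn]
  congr 1
  · rw [shift, formula_relabel_eq_opn]
    refine hF _ _ (fun a ha => ?_) fun i => i.elim0
    have : a ≠ j := fun h => hj.1 (h ▸ ha)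
    simp [renSub, this]
  · rw [openFresh_eq_opn, inst_eq_opn, opn_opn]
    refine hG _ _ (fun a ha => ?_) fun i => ?_
    · have : a ≠ j := fun h => hj.2 (h ▸ ha)
      simp [renSub, this, Term.subst]
    · simp [renSub, Term.subst]

theorem Derives.imp_intro (χ : L.Formula ℕ) {ψ : L.Formula ℕ} (h : Derives T ψ) :
    Derives T (χ ⟹ ψ) :=
  .mp _ _ (.impK _ _) h

theorem Derives.imp_mp {χ φ ψ : L.Formula ℕ} (h : Derives T (χ ⟹ (φ ⟹ ψ)))
    (h' : Derives T (χ ⟹ φ)) : Derives T (χ ⟹ ψ) :=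
  .mp _ _ (.mp _ _ (.impS _ _ _) h) h'

theorem Derives.imp_refl (χ : L.Formula ℕ) : Derives T (χ ⟹ χ) :=
  .imp_mp (.impK χ (χ ⟹ χ)) (.impK χ χ)

theorem Derives.imp_trans {χ φ ψ : L.Formula ℕ} (h : Derives T (χ ⟹ φ))
    (h' : Derives T (φ ⟹ ψ)) : Derives T (χ ⟹ ψ) :=
  .imp_mp (.imp_intro _ h') h

theorem Derives.imp_swap {χ φ ψ : L.Formula ℕ} (h : Derives T (χ ⟹ (φ ⟹ ψ))) :
    Derives T (φ ⟹ (χ ⟹ ψ)) :=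
  .imp_trans (.impK φ χ) (.mp _ _ (.impS _ _ _) h)

theorem Derives.exfalso (ψ : L.Formula ℕ) : Derives T (⊥ ⟹ ψ) :=
  .imp_trans (.impK _ _) (.dne ψ)

/-- The conjunction of two formulas. -/
abbrev conj (χ ψ : L.Formula ℕ) : L.Formula ℕ := (χ ⟹ (ψ ⟹ ⊥)) ⟹ ⊥

theorem Derives.conj_left (χ ψ : L.Formula ℕ) : Derives T (conj χ ψ ⟹ χ) := by
  refine .imp_trans ?_ (.dne χ)
  refine .imp_swap ?_
  have h1 : Derives T ((χ ⟹ ⊥) ⟹ (χ ⟹ (ψ ⟹ ⊥))) :=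
    .mp _ _ (.impS _ _ _) (.imp_intro _ (.exfalso _))
  exact .imp_trans h1 (.imp_swap (.imp_refl _))

theorem Derives.conj_right (χ ψ : L.Formula ℕ) : Derives T (conj χ ψ ⟹ ψ) := by
  refine .imp_trans ?_ (.dne ψ)
  refine .imp_swap ?_
  exact .imp_trans (.impK _ χ) (.imp_swap (.imp_refl _))

/-- With this encoding of conjunction the hypothesis is literally the double negation of the
conclusion. -/
theorem Derives.of_conj_bot {χ ψ : L.Formula ℕ} (h : Derives T (conj χ ψ ⟹ ⊥)) :
    Derives T (χ ⟹ (ψ ⟹ ⊥)) :=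
  .mp _ _ (.dne _) h

end Provability

end Tern

namespace Tern
open FirstOrder FirstOrder.Language

/-! ### Soundness and completeness of the calculus -/

section Completeness

variable {L : FirstOrder.Language.{0, 0}} {T : L.Theory}

theorem Derives.soundness {M : Type} [L.Structure M] [Nonempty M] (hM : M ⊨ T)
    {χ : L.Formula ℕ} (h : Derives T χ) (v : ℕ → M) : χ.Realize v := by
  have hinst : ∀ (φ : L.BoundedFormula ℕ 1) (t : L.Term ℕ) (v : ℕ → M),
      (inst φ t).Realize v ↔ φ.Realize v (fun _ => t.realize v) := by
    intro φ t v
    unfold inst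
    rw [Formula.Realize, BoundedFormula.realize_subst, ← Formula.Realize,
      BoundedFormula.realize_toFormula]
    rfl
  have hopen : ∀ (φ : L.BoundedFormula ℕ 1) (v : ℕ → M),
      (openFresh φ).Realize v ↔ φ.Realize (fun k => v (k + 1)) (fun _ => v 0) := by
    intro φ v
    unfold openFresh
    rw [Formula.realize_relabel, BoundedFormula.realize_toFormula]
    rfl
  induction h generalizing v with
  | ax σ hσ =>
    rw [Formula.realize_relabel]
    have := hM.realize_of_mem σ hσ
    rw [Sentence.Realize] at this
    convert this
  | impK => exact fun h _ => h
  | impS => exact fun h h' h'' => h h'' (h' h'')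
  | dne φ => exact fun h => by_contra h
  | allElim φ t =>
    intro h
    have h : φ.all.Realize v default := h
    refine (hinst _ _ _).2 ?_
    convert BoundedFormula.realize_all.1 h (t.realize v) using 1
    funext i
    fin_cases i
    rfl
  | eqRefl t =>
    rw [Formula.realize_equal]
  | eqSubst φ t u =>
    intro h h'
    have h : (t.equal u).Realize v := h
    have h' : (inst φ t).Realize v := h'
    rw [Formula.realize_equal] at h
    rw [hinst] at h'
    exact (hinst _ _ _).2 (h ▸ h')
  | mp φ ψ _ _ ih1 ih2 => exact ih1 v (ih2 v)
  | allIntro χ φ _ ih =>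
    intro h
    have h : χ.Realize v := h
    refine BoundedFormula.realize_all.2 fun a => ?_
    -- The premise is used at the valuation that sends the eigenvariable `0` to an arbitrary `a` and
    -- shifts `v`.
    have hs : (shift χ).Realize fun k => (k.casesOn a v : M) := by
      unfold shift
      rw [Formula.realize_relabel]
      exact h
    have := (hopen _ _).1 (ih _ hs)
    convert this using 1
    funext i
    fin_cases i
    rfl

theorem Proves.soundness {M : Type} [L.Structure M] [Nonempty M] (hM : M ⊨ T)
    {σ : L.Sentence} (h : Proves T σ) : M ⊨ σ := by
  have := Derives.soundness hM h fun _ => Classical.arbitrary M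
  rw [Formula.realize_relabel] at this
  rw [Sentence.Realize]
  convert this

/-- A complete theory in the free variables, with a witness for every failing `∀`. -/
structure IsHenkin (T : L.Theory) (Γ : Set (L.Formula ℕ)) : Prop where
  of_derives : ∀ {ψ}, Derives T ψ → ψ ∈ Γ
  mp : ∀ {φ ψ}, φ.imp ψ ∈ Γ → φ ∈ Γ → ψ ∈ Γ
  bot_notMem : ⊥ ∉ Γ
  mem_or_neg_mem : ∀ ψ, ψ ∈ Γ ∨ ψ.imp ⊥ ∈ Γ
  exists_inst_notMem : ∀ φ : L.BoundedFormula ℕ 1, φ.all ∉ Γ → ∃ j, inst φ (.var j) ∉ Γ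

/-- One Henkin step. A stage is a single consistent formula rather than a set, so it mentions
finitely many variables and the variables themselves can serve as Henkin constants. If `χ` refutes
`∀ x, φ`, then some negated variable instance is consistent with `χ`: otherwise `χ` would derive all
of them and hence, by generalizing over a fresh one, `∀ x, φ`. -/
theorem exists_decide {χ : L.Formula ℕ} (hχ : ¬ Derives T (χ ⟹ ⊥)) (ψ : L.Formula ℕ) :
    ∃ χ' : L.Formula ℕ, ¬ Derives T (χ' ⟹ ⊥) ∧ Derives T (χ' ⟹ χ) ∧
      (Derives T (χ' ⟹ ψ) ∨ (Derives T (χ' ⟹ (ψ ⟹ ⊥)) ∧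
        ∀ φ : L.BoundedFormula ℕ 1, ψ = φ.all →
          ∃ j, Derives T (χ' ⟹ (inst φ (.var j) ⟹ ⊥)))) := by
  by_cases h : Derives T (conj χ ψ ⟹ ⊥)
  · have hneg := h.of_conj_bot
    by_cases hall : ∃ φ : L.BoundedFormula ℕ 1, ψ = φ.all
    · obtain ⟨φ, rfl⟩ := hall
      have : ∃ j, ¬ Derives T (conj χ (inst φ (.var j) ⟹ ⊥) ⟹ ⊥) := by
        by_contra hcon
        push Not at hcon
        have : Derives T (χ ⟹ φ.all) :=
          .all_of_forall_inst fun j => .imp_trans (hcon j).of_conj_bot (.dne _)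
        exact hχ (hneg.imp_mp this)
      obtain ⟨j, hj⟩ := this
      refine ⟨_, hj, .conj_left _ _, .inr ⟨.imp_trans (.conj_left _ _) hneg, ?_⟩⟩
      rintro φ' h'
      cases h'
      exact ⟨j, .conj_right _ _⟩
    · exact ⟨χ, hχ, .imp_refl _, .inr ⟨hneg, fun φ hφ => (hall ⟨φ, hφ⟩).elim⟩⟩
  · exact ⟨_, h, .conj_left _ _, .inl (.conj_right _ _)⟩

/-- Deciding all formulas in turn gives an increasingly strong sequence of consistent formulas; the
formulas derivable from some member of it form the Henkin theory. -/
theorem exists_isHenkin [Countable (L.Formula ℕ)] {χ : L.Formula ℕ}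
    (hχ : ¬ Derives T (χ ⟹ ⊥)) : ∃ Γ, IsHenkin T Γ ∧ χ ∈ Γ := by
  obtain ⟨enum, henum⟩ := exists_surjective_nat (L.Formula ℕ)
  choose next hcons hle hdec using
    fun (x : {χ : L.Formula ℕ // ¬ Derives T (χ ⟹ ⊥)}) ψ => exists_decide x.2 ψ
  let c : ℕ → {χ : L.Formula ℕ // ¬ Derives T (χ ⟹ ⊥)} :=
    fun n => n.rec ⟨χ, hχ⟩ fun n x => ⟨next x (enum n), hcons x (enum n)⟩
  have hc : ∀ {m n}, m ≤ n → Derives T ((c n).1 ⟹ (c m).1) := by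
    intro m n hmn
    induction hmn with
    | refl => exact .imp_refl _
    | step _ ih => exact .imp_trans (hle _ _) ih
  have hdisj : ∀ {ψ m n}, Derives T ((c m).1 ⟹ ψ) → Derives T ((c n).1 ⟹ (ψ ⟹ ⊥)) → False := by
    intro ψ m n h h'
    refine (c (max m n)).2 ?_
    exact .imp_mp (.imp_trans (hc (le_max_right m n)) h') (.imp_trans (hc (le_max_left m n)) h)
  refine ⟨{ψ | ∃ n, Derives T ((c n).1 ⟹ ψ)}, ⟨?_, ?_, ?_, ?_, ?_⟩, 0, .imp_refl _⟩
  · exact fun h => ⟨0, .imp_intro _ h⟩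
  · rintro φ ψ ⟨m, hm⟩ ⟨n, hn⟩
    exact ⟨max m n, .imp_mp (.imp_trans (hc (le_max_left m n)) hm)
      (.imp_trans (hc (le_max_right m n)) hn)⟩
  · rintro ⟨n, hn⟩
    exact (c n).2 hn
  · intro ψ
    obtain ⟨n, rfl⟩ := henum ψ
    exact (hdec (c n) (enum n)).imp (fun h => ⟨n + 1, h⟩) fun h => ⟨n + 1, h.1⟩
  · intro φ hφ
    obtain ⟨n, hn⟩ := henum φ.all
    rcases hdec (c n) (enum n) with h | h
    · exact (hφ ⟨n + 1, hn ▸ h⟩).elim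
    · obtain ⟨j, hj⟩ := h.2 φ hn
      exact ⟨j, fun ⟨m, hm⟩ => hdisj (n := n + 1) hm hj⟩

/-- The number of connectives and quantifiers. -/
def size {α : Type} : {n : ℕ} → L.BoundedFormula α n → ℕ
  | _, .falsum => 0
  | _, .equal _ _ => 0
  | _, .rel _ _ => 0
  | _, .imp φ ψ => size φ + size ψ + 1
  | _, .all φ => size φ + 1

/-- Instances of `φ` are not subformulas of `φ.all`, but they are smaller; hence the truth lemma can
proceed by induction on size. -/
theorem size_opn {α β : Type} {n m : ℕ} (φ : L.BoundedFormula α n)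
    (s : α ⊕ Fin n → L.Term (β ⊕ Fin m)) : size (opn φ s) = size φ := by
  induction φ generalizing m with
  | falsum => rfl
  | equal => rfl
  | rel => rfl
  | imp _ _ ih1 ih2 => simp [opn, size, ih1, ih2]
  | all _ ih => simp [opn, size, ih]

namespace IsHenkin

variable {Γ : Set (L.Formula ℕ)}

theorem imp_mem_iff (h : IsHenkin T Γ) {φ ψ : L.Formula ℕ} :
    φ.imp ψ ∈ Γ ↔ (φ ∈ Γ → ψ ∈ Γ) := by
  refine ⟨fun h1 h2 => h.mp h1 h2, fun h1 => ?_⟩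
  rcases h.mem_or_neg_mem φ with h2 | h2
  · exact h.mp (h.of_derives (.impK _ _)) (h1 h2)
  · exact h.mp (h.mp (h.of_derives (.impS φ ⊥ ψ))
      (h.of_derives (.imp_intro _ (.exfalso _)))) h2

theorem all_mem_iff (h : IsHenkin T Γ) {φ : L.BoundedFormula ℕ 1} :
    φ.all ∈ Γ ↔ ∀ j, inst φ (.var j) ∈ Γ := by
  refine ⟨fun h1 j => h.mp (h.of_derives (.allElim _ _)) h1, fun h1 => ?_⟩
  by_contra h2
  obtain ⟨j, hj⟩ := h.exists_inst_notMem φ h2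
  exact hj (h1 j)

theorem eq_subst (h : IsHenkin T Γ) (φ : L.BoundedFormula ℕ 1) {t u : L.Term ℕ}
    (h1 : t.equal u ∈ Γ) (h2 : inst φ t ∈ Γ) : inst φ u ∈ Γ :=
  h.mp (h.mp (h.of_derives (.eqSubst φ t u)) h1) h2

theorem eq_symm (h : IsHenkin T Γ) {i j : ℕ} (h1 : (Term.var i).equal (.var j) ∈ Γ) :
    (Term.var j).equal (.var i) ∈ Γ := by
  have := h.eq_subst (.equal (.var (.inr 0)) (.var (.inl i))) h1
  rw [inst_eq_opn, inst_eq_opn] at this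
  exact this (h.of_derives (.eqRefl _))

theorem eq_trans (h : IsHenkin T Γ) {i j k : ℕ} (h1 : (Term.var i).equal (.var j) ∈ Γ)
    (h2 : (Term.var j).equal (.var k) ∈ Γ) : (Term.var i).equal (.var k) ∈ Γ := by
  have := h.eq_subst (.equal (.var (.inl i)) (.var (.inr 0))) h2
  rw [inst_eq_opn, inst_eq_opn] at this
  exact this h1

theorem rel_congr (h : IsHenkin T Γ) {n : ℕ} (R : L.Relations n) {a b : Fin n → ℕ}
    (hab : ∀ i, (Term.var (a i)).equal (.var (b i)) ∈ Γ)
    (ha : R.formula (fun i => .var (a i)) ∈ Γ) : R.formula (fun i => .var (b i)) ∈ Γ := by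
  -- `eqSubst` replaces one argument at a time: after `k` steps the first `k` arguments have been
  -- changed from `a` to `b`.
  have key : ∀ k, R.formula (fun i => .var (if (i : ℕ) < k then b i else a i)) ∈ Γ := by
    intro k
    induction k with
    | zero => simpa using ha
    | succ k ih =>
      by_cases hk : k < n
      · have := h.eq_subst (.rel R fun i => if (i : ℕ) = k then .var (.inr 0) else
          .var (.inl (if (i : ℕ) < k then b i else a i))) (hab ⟨k, hk⟩)
        rw [inst_eq_opn, inst_eq_opn] at this
        convert this ?_ using 1
        · simp only [opn, Relations.formula, Relations.boundedFormula]
          congr 1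
          funext i
          by_cases hi : (i : ℕ) = k
          · subst hi; simp [Term.subst]
          · have : (i : ℕ) < k + 1 ↔ (i : ℕ) < k := by omega
            simp [Term.subst, hi, this]
        · convert ih using 1
          simp only [opn, Relations.formula, Relations.boundedFormula]
          congr 1
          funext i
          by_cases hi : (i : ℕ) = k
          · subst hi; simp [Term.subst]
          · simp [Term.subst, hi]
      · convert ih using 4 with i
        have := i.2
        simp [show (i : ℕ) < k + 1 by omega, show (i : ℕ) < k by omega]
  simpa using key n

/-- Equality of variables in a Henkin theory. -/
def setoid (h : IsHenkin T Γ) : Setoid ℕ where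
  r i j := (Term.var i).equal (.var j) ∈ Γ
  iseqv := ⟨fun _ => h.of_derives (.eqRefl _), fun h1 => h.eq_symm h1,
    fun h1 h2 => h.eq_trans h1 h2⟩

/-- The term model of a Henkin theory in a relational language. -/
@[reducible]
noncomputable def termModel [L.IsRelational] (h : IsHenkin T Γ) :
    L.Structure (Quotient h.setoid) where
  funMap f := isEmptyElim f
  RelMap R xs := R.formula (fun i => .var (xs i).out) ∈ Γ

/-- The truth lemma. In a relational language each term is a variable, so every element of the
quotient is named and the witnesses in `Γ` account for the quantifier. -/
theorem mem_iff_realize [L.IsRelational] (h : IsHenkin T Γ) (ψ : L.Formula ℕ) :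
    ψ ∈ Γ ↔ @Formula.Realize L _ h.termModel ℕ ψ fun k => (Quotient.mk h.setoid k) := by
  let _ := h.termModel
  have hvar : ∀ t : L.Term (ℕ ⊕ Fin 0), ∃ k, t = .var (.inl k) := by
    rintro ((k | k) | ⟨f, _⟩)
    · exact ⟨k, rfl⟩
    · exact k.elim0
    · exact isEmptyElim f
  induction hn : size ψ using Nat.strong_induction_on generalizing ψ with
  | _ n ih =>
    subst hn
    cases ψ with
    | falsum => exact iff_of_false h.bot_notMem id
    | equal t u =>
      obtain ⟨i, rfl⟩ := hvar t
      obtain ⟨j, rfl⟩ := hvar u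
      exact (Quotient.eq (r := h.setoid)).symm
    | rel R ts =>
      choose k hk using fun i => hvar (ts i)
      obtain rfl : ts = fun i => .var (.inl (k i)) := funext hk
      have hout : ∀ i, (Term.var (k i)).equal (.var (Quotient.mk h.setoid (k i)).out) ∈ Γ :=
        fun i => Quotient.exact (s := h.setoid) (Quotient.out_eq _).symm
      exact ⟨fun h1 => h.rel_congr R hout h1,
        fun h1 => h.rel_congr R (fun i => h.eq_symm (hout i)) h1⟩
    | imp φ ψ =>
      exact h.imp_mem_iff.trans (imp_congr (ih (size φ) (by simp only [size]; omega) φ rfl)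
        (ih (size ψ) (by simp only [size]; omega) ψ rfl))
    | all φ =>
      rw [h.all_mem_iff]
      refine Iff.trans ?_ BoundedFormula.realize_all.symm
      have : ∀ j, inst φ (.var j) ∈ Γ ↔
          φ.Realize (fun k => (Quotient.mk h.setoid k)) fun _ => Quotient.mk h.setoid j := by
        intro j
        refine (ih (size (inst φ (.var j))) (by simp [inst_eq_opn, size_opn, size]) _ rfl).trans ?_
        unfold inst
        rw [Formula.Realize, BoundedFormula.realize_subst, ← Formula.Realize,
          BoundedFormula.realize_toFormula]
        rfl
      have hs : ∀ a : Quotient h.setoid, (Fin.snoc default a : Fin 1 → _) = fun _ => a := by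
        intro a
        funext i
        fin_cases i
        rfl
      refine (forall_congr' this).trans ⟨fun h1 a => ?_, fun h1 j => ?_⟩
      · exact (hs a).symm ▸ Quotient.inductionOn a h1
      · exact hs _ ▸ h1 (Quotient.mk h.setoid j)

end IsHenkin

/-- A formula that is consistent with `T` is satisfied in a model of `T`. -/
theorem exists_model [L.IsRelational] [Countable (L.Formula ℕ)] {χ : L.Formula ℕ}
    (hχ : ¬ Derives T (χ ⟹ ⊥)) :
    ∃ (M : Type) (_ : L.Structure M) (_ : Nonempty M) (v : ℕ → M), M ⊨ T ∧ χ.Realize v := by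
  obtain ⟨Γ, h, hmem⟩ := exists_isHenkin hχ
  let _ := h.termModel
  refine ⟨Quotient h.setoid, h.termModel, ⟨Quotient.mk _ 0⟩, fun k => Quotient.mk _ k, ?_,
    (h.mem_iff_realize χ).1 hmem⟩
  refine ⟨fun σ hσ => ?_⟩
  have := (h.mem_iff_realize _).1 (h.of_derives (.ax σ hσ))
  rw [Formula.realize_relabel] at this
  rw [Sentence.Realize]
  convert this

theorem Consistent.exists_model [L.IsRelational] [Countable (L.Formula ℕ)]
    (h : Consistent T) : ∃ (M : Type) (_ : L.Structure M) (_ : Nonempty M), M ⊨ T := by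
  have : ¬ Derives T ((⊥ ⟹ ⊥ : L.Formula ℕ) ⟹ ⊥) := fun h' => h (h'.mp _ _ (.imp_refl _))
  obtain ⟨M, _, hM, _, h, _⟩ := Tern.exists_model this
  exact ⟨M, _, hM, h⟩

/-- Completeness, in the form that puts sentences into `T₀`. Models in `Type` suffice because the
term model is a quotient of `ℕ`. -/
theorem proves_of_forall_model [L.IsRelational] [Countable (L.Formula ℕ)] {σ : L.Sentence}
    (h : ∀ (M : Type) [L.Structure M] [Nonempty M], M ⊨ T → M ⊨ σ) : Proves T σ := by
  by_contra hcon
  have : ¬ Derives T ((Formula.relabel Empty.elim σ ⟹ ⊥ : L.Formula ℕ) ⟹ ⊥) :=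
    fun h' => hcon (.mp _ _ (.dne _) h')
  obtain ⟨M, _, _, v, hM, hv⟩ := Tern.exists_model this
  refine hv ?_
  have := h M hM
  rw [Sentence.Realize] at this
  refine (Formula.realize_relabel (φ := σ) (g := (Empty.elim : Empty → ℕ)) (v := v)).2 ?_
  convert this

end Completeness

end Tern

namespace Tern

/-! ### Primitive recursive predicates with bounded quantifiers -/

section PrimrecQuantifiers

variable {α β : Type*} [Primcodable α] [Primcodable β]

theorem primrecPred_ball {f : α → List β} (hf : Primrec f) {P : α → β → Prop}
    (hP : PrimrecPred fun p : α × β => P p.1 p.2) : PrimrecPred fun a => ∀ b ∈ f a, P a b :=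
  ((PrimrecRel.forall_mem_list (R := fun b a => P a b)
    (hP.comp (Primrec.snd.pair Primrec.fst))).comp hf .id)

theorem primrecPred_bex {f : α → List β} (hf : Primrec f) {P : α → β → Prop}
    (hP : PrimrecPred fun p : α × β => P p.1 p.2) : PrimrecPred fun a => ∃ b ∈ f a, P a b :=
  ((PrimrecRel.exists_mem_list (R := fun b a => P a b)
    (hP.comp (Primrec.snd.pair Primrec.fst))).comp hf .id)

theorem primrecPred_imp {p q : α → Prop} (hp : PrimrecPred p) (hq : PrimrecPred q) :
    PrimrecPred fun a => p a → q a :=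
  (hp.not.or hq).of_eq fun _ => imp_iff_not_or.symm

theorem primrecPred_iff {p q : α → Prop} (hp : PrimrecPred p) (hq : PrimrecPred q) :
    PrimrecPred fun a => p a ↔ q a :=
  ((primrecPred_imp hp hq).and (primrecPred_imp hq hp)).of_eq fun _ => iff_def.symm

end PrimrecQuantifiers

/-! ### Limit approximations of members of effectively closed classes -/

section Limit

variable (F : ℕ → List (List (ℕ × Bool)))

/-- The finite assignment `G` is part of one of the first `s` excluded assignments seen in `τ`. -/
def Excluded (s : ℕ) (τ : List Bool) : Prop :=
  ∃ k ∈ List.range s, ∃ G ∈ F k, ∀ l ∈ G, τ[l.1]? = some l.2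

/-- All bit strings of length `s`. -/
def bitStrings : ℕ → List (List Bool)
  | 0 => [[]]
  | s + 1 => (bitStrings s).map (List.cons false) ++ (bitStrings s).map (List.cons true)

/-- All extensions of `σ` by `s` bits are excluded. -/
def Dead (s : ℕ) (σ : List Bool) : Prop :=
  ∀ τ ∈ bitStrings s, Excluded F s (σ ++ τ)

open Classical in
/-- The approximation at stage `s` to the leftmost path, up to length `k`. -/
noncomputable def path (s : ℕ) : ℕ → List Bool
  | 0 => []
  | k + 1 => path s k ++ [decide (Dead F s (path s k ++ [false]))]

open Classical in
/-- The leftmost path, up to length `k`. -/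
noncomputable def limitPath : ℕ → List Bool
  | 0 => []
  | k + 1 => limitPath k ++ [decide (∃ s, Dead F s (limitPath k ++ [false]))]

variable {F}

theorem mem_bitStrings {s : ℕ} {τ : List Bool} : τ ∈ bitStrings s ↔ τ.length = s := by
  induction s generalizing τ with
  | zero => simp [bitStrings]
  | succ s ih =>
    simp only [bitStrings, List.mem_append, List.mem_map, ih]
    rcases τ with _ | ⟨b, τ⟩
    · simp
    · cases b <;> simp

theorem Excluded.mono {s t : ℕ} {σ τ : List Bool} (hst : s ≤ t) (h : Excluded F s σ)
    (hστ : σ <+: τ) : Excluded F t τ := by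
  obtain ⟨k, hk, G, hG, hl⟩ := h
  refine ⟨k, List.mem_range.2 ((List.mem_range.1 hk).trans_le hst), G, hG, fun l hlG => ?_⟩
  have := hl l hlG
  obtain ⟨h1, h2⟩ := List.getElem?_eq_some_iff.1 this
  obtain ⟨ρ, rfl⟩ := hστ
  rw [List.getElem?_append_left h1, this]

theorem Dead.mono {s t : ℕ} {σ : List Bool} (hst : s ≤ t) (h : Dead F s σ) : Dead F t σ := by
  intro τ hτ
  have hlen := mem_bitStrings.1 hτ
  refine (h (τ.take s) (mem_bitStrings.2 (by simp; omega))).mono hst ?_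
  exact List.prefix_append_right_inj _ |>.2 (List.take_prefix _ _)

theorem Excluded.dead {s : ℕ} {σ : List Bool} (h : Excluded F s σ) : Dead F s σ :=
  fun τ _ => h.mono le_rfl (List.prefix_append σ τ)

/-- Any `s + 1` further bits pass through one of the two children. So a node that never dies has a
child that never dies. -/
theorem dead_of_both {s : ℕ} {σ : List Bool} (h0 : Dead F s (σ ++ [false]))
    (h1 : Dead F s (σ ++ [true])) : Dead F (s + 1) σ := by
  intro τ hτ
  have hlen := mem_bitStrings.1 hτ
  rcases τ with _ | ⟨b, τ⟩
  · simp at hlen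
  · have hτ' : τ ∈ bitStrings s := mem_bitStrings.2 (by simpa using hlen)
    have : σ ++ b :: τ = σ ++ [b] ++ τ := by simp
    rw [this]
    cases b
    · exact (h0 τ hτ').mono (Nat.le_succ s) List.prefix_rfl
    · exact (h1 τ hτ').mono (Nat.le_succ s) List.prefix_rfl

theorem length_limitPath (k : ℕ) : (limitPath F k).length = k := by
  induction k with
  | zero => rfl
  | succ k ih => simp [limitPath, ih]

open Classical in
-- Death is monotone in the stage. Once the prefix of length `k` is stable, the next bit can only
-- switch from `false` to `true`, when the left child dies, and never back.
theorem eventually_path_eq (k : ℕ) : ∃ s₀, ∀ s ≥ s₀, path F s k = limitPath F k := by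
  induction k with
  | zero => exact ⟨0, fun _ _ => rfl⟩
  | succ k ih =>
    obtain ⟨s₀, hs₀⟩ := ih
    by_cases h : ∃ s, Dead F s (limitPath F k ++ [false])
    · obtain ⟨s₁, hs₁⟩ := h
      refine ⟨max s₀ s₁, fun s hs => ?_⟩
      have h1 := hs₁.mono (le_of_max_le_right hs)
      rw [path, limitPath, hs₀ s (le_of_max_le_left hs), decide_eq_true h1,
        decide_eq_true ⟨s₁, hs₁⟩]
    · refine ⟨s₀, fun s hs => ?_⟩
      rw [path, limitPath, hs₀ s hs, decide_eq_false h, decide_eq_false fun h' => h ⟨s, h'⟩]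

open Classical in
-- The assignment `v` keeps the root alive. Whenever the path turns right its left child is dead, so
-- death of the right child would kill the parent by `dead_of_both`.
theorem limitPath_not_dead (h : ∃ v : ℕ → Bool, ∀ k, ∀ G ∈ F k, ∃ l ∈ G, v l.1 ≠ l.2) (k : ℕ) :
    ∀ s, ¬ Dead F s (limitPath F k) := by
  induction k with
  | zero =>
    intro s hs
    obtain ⟨v, hv⟩ := h
    obtain ⟨k, -, G, hG, hl⟩ := hs ((List.range s).map v) (mem_bitStrings.2 (by simp))
    obtain ⟨l, hlG, hne⟩ := hv k G hG
    have := hl l hlG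
    simp only [limitPath, List.nil_append, List.getElem?_map, Option.map_eq_some_iff,
      List.getElem?_eq_some_iff, List.getElem_range] at this
    obtain ⟨_, ⟨_, rfl⟩, h'⟩ := this
    exact hne h'
  | succ k ih =>
    intro s hs
    rw [limitPath] at hs
    by_cases h : ∃ s, Dead F s (limitPath F k ++ [false])
    · rw [decide_eq_true h] at hs
      obtain ⟨t, ht⟩ := h
      exact ih _ (dead_of_both (ht.mono (le_max_left t s)) (hs.mono (le_max_right t s)))
    · rw [decide_eq_false h] at hs
      exact h ⟨s, hs⟩

theorem limitPath_prefix {j k : ℕ} (h : j ≤ k) : limitPath F j <+: limitPath F k := by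
  induction h with
  | refl => exact List.prefix_rfl
  | step _ ih => exact ih.trans (List.prefix_append _ _)

theorem primrec_bitStrings : Primrec bitStrings := by
  have : Primrec fun s : ℕ => (s.rec [[]] fun _ L => L.map (List.cons false) ++
      L.map (List.cons true) : List (List Bool)) := by
    refine Primrec.nat_rec₁ _ ?_
    refine Primrec.list_append.comp ?_ ?_
    · exact Primrec.list_map Primrec.snd (Primrec.list_cons.comp (.const _) Primrec.snd)
    · exact Primrec.list_map Primrec.snd (Primrec.list_cons.comp (.const _) Primrec.snd)
  refine this.of_eq fun s => ?_
  induction s with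
  | zero => rfl
  | succ s ih => simp [bitStrings, ← ih]

theorem primrecPred_dead (hF : Primrec F) :
    PrimrecPred fun p : ℕ × List Bool => Dead F p.1 p.2 := by
  refine primrecPred_ball (primrec_bitStrings.comp Primrec.fst) ?_
  refine primrecPred_bex (Primrec.list_range.comp (Primrec.fst.comp Primrec.fst)) ?_
  refine primrecPred_bex (hF.comp Primrec.snd) ?_
  refine primrecPred_ball Primrec.snd ?_
  refine Primrec.eq.comp ?_ ?_
  · refine Primrec.list_getElem?.comp ?_ (Primrec.fst.comp Primrec.snd)
    have : Primrec fun p : (ℕ × List Bool) × List Bool => p.1.2 ++ p.2 :=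
      Primrec.list_append.comp (Primrec.snd.comp Primrec.fst) Primrec.snd
    exact this.comp (Primrec.fst.comp (Primrec.fst.comp Primrec.fst))
  · exact Primrec.option_some.comp (Primrec.snd.comp Primrec.snd)

open Classical in
theorem primrec_path (hF : Primrec F) : Primrec₂ (path F) := by
  have : Primrec₂ fun s k : ℕ => (k.rec [] fun _ σ => σ ++ [decide (Dead F s (σ ++ [false]))] :
      List Bool) := by
    refine Primrec.nat_rec (f := fun _ : ℕ => ([] : List Bool))
      (g := fun s p => p.2 ++ [decide (Dead F s (p.2 ++ [false]))]) (.const _) ?_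
    refine Primrec.list_concat.comp (g := fun p : ℕ × ℕ × List Bool => p.2.2)
      (Primrec.snd.comp Primrec.snd) ?_
    have h1 : Primrec fun p : ℕ × ℕ × List Bool => (p.1, p.2.2 ++ [false]) :=
      Primrec.fst.pair (Primrec.list_concat.comp (Primrec.snd.comp Primrec.snd) (.const _))
    exact (primrecPred_dead hF).decide.comp h1
  refine this.of_eq fun s k => ?_
  induction k with
  | zero => rfl
  | succ k ih => simp [path, ← ih]

/-- If some assignment of bits avoids all members of a primitive recursive sequence of finite
assignments, then one that is a pointwise limit of a primitive recursive sequence does. -/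
theorem exists_limit_assignment (hF : Primrec F)
    (h : ∃ v : ℕ → Bool, ∀ k, ∀ G ∈ F k, ∃ l ∈ G, v l.1 ≠ l.2) :
    ∃ (g : ℕ → ℕ → Bool) (v : ℕ → Bool), Primrec₂ g ∧ (∀ n, ∃ s₀, ∀ s ≥ s₀, g s n = v n) ∧
      ∀ k, ∀ G ∈ F k, ∃ l ∈ G, v l.1 ≠ l.2 := by
  refine ⟨fun s n => (path F s (n + 1)).getD n false,
    fun n => (limitPath F (n + 1)).getD n false, ?_, fun n => ?_, ?_⟩
  · exact (Primrec.list_getD _).comp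
      ((primrec_path hF).comp Primrec.fst (Primrec.succ.comp Primrec.snd)) Primrec.snd
  · obtain ⟨s₀, hs₀⟩ := eventually_path_eq (F := F) (n + 1)
    exact ⟨s₀, fun s hs => by simp only [hs₀ s hs]⟩
  · intro k G hG
    by_contra hcon
    push Not at hcon
    obtain ⟨N, hN⟩ : ∃ N, ∀ l ∈ G, l.1 < N := by
      refine ⟨(G.map Prod.fst).sum + 1, fun l hl => Nat.lt_succ_of_le ?_⟩
      exact List.single_le_sum (by simp) _ (List.mem_map_of_mem hl)
    -- If the limit agreed with all of `G`, its prefix of length `N` would contain every bit that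
    -- `G` mentions and be excluded at stage `k + 1`, the first one to consult `F k`.
    refine limitPath_not_dead h N (k + 1) (Excluded.dead ⟨k, by simp, G, hG, fun l hl => ?_⟩)
    have h1 := hcon l hl
    have h2 : l.1 < (limitPath F (l.1 + 1)).length := by simp [length_limitPath]
    obtain ⟨ρ, hρ⟩ := limitPath_prefix (F := F) (show l.1 + 1 ≤ N from hN l hl)
    rw [← hρ, List.getElem?_append_left h2, List.getElem?_eq_getElem h2]
    simp only [List.getD_eq_getElem?_getD, List.getElem?_eq_getElem h2] at h1
    simpa using h1

end Limit
end Tern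

namespace Tern

/-! ### Computable copies of limit-computable structures -/

section Copy

/-- The finite correspondence `L` between elements of the copy and names of elements of the
structure respects equality and `S`, and it maps no pair for which a failure of `S` has been
declared to a pair related by `M`. The list `Fs` contains the triples at which `S` fails in the
copy. -/
def Good (E : ℕ × ℕ → Bool) (S : ℕ × ℕ × ℕ → Bool) (M : ℕ × ℕ → Bool) (L : List (ℕ × ℕ))
    (Fs : List (ℕ × ℕ × ℕ)) : Prop :=
  ∀ p ∈ L, ∀ q ∈ L, (p.1 = q.1 ↔ E (p.2, q.2) = true) ∧
    (∀ t ∈ Fs, t.1 = p.1 → t.2.1 = q.1 → M (p.2, q.2) = false) ∧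
    ∀ u ∈ L, ((p.1, q.1, u.1) ∈ Fs ↔ S (p.2, q.2, u.2) = false)

section Good

variable {E E' : ℕ × ℕ → Bool} {S S' : ℕ × ℕ × ℕ → Bool} {M M' : ℕ × ℕ → Bool}
  {L L' : List (ℕ × ℕ)} {Fs : List (ℕ × ℕ × ℕ)}

theorem Good.subset (h : Good E S M L' Fs) (hL : L ⊆ L') : Good E S M L Fs :=
  fun p hp q hq => ⟨(h p (hL hp) q (hL hq)).1, (h p (hL hp) q (hL hq)).2.1,
    fun u hu => (h p (hL hp) q (hL hq)).2.2 u (hL hu)⟩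

theorem Good.nil : Good E S M [] Fs := fun p hp => by simp at hp

/-- Goodness inspects the structure only at the names in `L`; agreement of two structures on these
is enough, whatever the failures are. -/
theorem good_congr {N : ℕ} (hE : ∀ a < N, ∀ b < N, E (a, b) = E' (a, b))
    (hS : ∀ a < N, ∀ b < N, ∀ c < N, S (a, b, c) = S' (a, b, c))
    (hM : ∀ a < N, ∀ b < N, M (a, b) = M' (a, b)) (hL : ∀ p ∈ L, p.2 < N) :
    Good E S M L Fs ↔ Good E' S' M' L Fs := by
  unfold Good
  refine forall₂_congr fun p hp => forall₂_congr fun q hq => ?_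
  rw [hE _ (hL p hp) _ (hL q hq), hM _ (hL p hp) _ (hL q hq)]
  refine and_congr_right' (and_congr_right' (forall₂_congr fun u hu => ?_))
  rw [hS _ (hL p hp) _ (hL q hq) _ (hL u hu)]

end Good

variable (e : ℕ → ℕ × ℕ → Bool) (r : ℕ → ℕ × ℕ × ℕ → Bool) (m : ℕ → ℕ × ℕ → Bool)

open Classical in
/-- The longest prefix of `L` that is good according to the approximation at stage `s`. -/
noncomputable def trim (s : ℕ) (L : List (ℕ × ℕ)) (Fs : List (ℕ × ℕ × ℕ)) : List (ℕ × ℕ) :=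
  L.take (Nat.findGreatest (fun i => Good (e s) (r s) (m s) (L.take i) Fs) L.length)

/-- The `k`-th candidate for prolonging a correspondence of length `i`: at even positions `i` the
name `i / 2` is handled, at odd positions the element `i / 2` of the copy. -/
def candidate (i k : ℕ) : ℕ × ℕ := if i % 2 = 0 then (k, i / 2) else (i / 2, k)

/-- The triples of elements of the copy at which `S` has to fail, according to `L`. -/
def failures (s : ℕ) (L : List (ℕ × ℕ)) : List (ℕ × ℕ × ℕ) :=
  L.flatMap fun p => L.flatMap fun q => L.flatMap fun u =>
    if r s (p.2, q.2, u.2) = false then [(p.1, q.1, u.1)] else []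

open Classical in
/-- Prolongs the good correspondence `L`, if possible. -/
noncomputable def prolong (s : ℕ) (L : List (ℕ × ℕ)) (Fs : List (ℕ × ℕ × ℕ)) :
    List (ℕ × ℕ) × List (ℕ × ℕ × ℕ) :=
  let k := (List.range s).findIdx fun k =>
    decide (Good (e s) (r s) (m s) (L ++ [candidate L.length k]) Fs)
  let L' := L ++ [candidate L.length k]
  let Fs' := Fs ++ failures r s L'
  if k < s then (L', Fs) else
    if L.length % 2 = 0 ∧ Good (e s) (r s) (m s) L' Fs' then (L', Fs') else (L, Fs)

/-- The correspondence and the failures of `S` before stage `s`. -/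
noncomputable def stage : ℕ → List (ℕ × ℕ) × List (ℕ × ℕ × ℕ)
  | 0 => ([], [])
  | s + 1 => prolong e r m s (trim e r m s (stage s).1 (stage s).2) (stage s).2

/-! ### Primitive recursiveness of the stages -/

section Computability

variable {e r m}

theorem primrecPred_good (he : Primrec₂ e) (hr : Primrec₂ r) (hm : Primrec₂ m) :
    PrimrecPred fun x : ℕ × List (ℕ × ℕ) × List (ℕ × ℕ × ℕ) =>
      Good (e x.1) (r x.1) (m x.1) x.2.1 x.2.2 := by
  refine primrecPred_ball (Primrec.fst.comp Primrec.snd) ?_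
  refine primrecPred_ball (Primrec.fst.comp (Primrec.snd.comp Primrec.fst)) ?_
  have hs : Primrec fun y : ((ℕ × List (ℕ × ℕ) × List (ℕ × ℕ × ℕ)) × (ℕ × ℕ)) × (ℕ × ℕ) =>
      y.1.1.1 := Primrec.fst.comp (Primrec.fst.comp Primrec.fst)
  have hF : Primrec fun y : ((ℕ × List (ℕ × ℕ) × List (ℕ × ℕ × ℕ)) × (ℕ × ℕ)) × (ℕ × ℕ) =>
      y.1.1.2.2 := Primrec.snd.comp (Primrec.snd.comp (Primrec.fst.comp Primrec.fst))
  have hL : Primrec fun y : ((ℕ × List (ℕ × ℕ) × List (ℕ × ℕ × ℕ)) × (ℕ × ℕ)) × (ℕ × ℕ) =>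
      y.1.1.2.1 := Primrec.fst.comp (Primrec.snd.comp (Primrec.fst.comp Primrec.fst))
  have hp : Primrec fun y : ((ℕ × List (ℕ × ℕ) × List (ℕ × ℕ × ℕ)) × (ℕ × ℕ)) × (ℕ × ℕ) =>
      y.1.2 := Primrec.snd.comp Primrec.fst
  have hq : Primrec fun y : ((ℕ × List (ℕ × ℕ) × List (ℕ × ℕ × ℕ)) × (ℕ × ℕ)) × (ℕ × ℕ) =>
      y.2 := Primrec.snd
  have hpq := (Primrec.snd.comp hp).pair (Primrec.snd.comp hq)
  refine .and ?_ (.and ?_ ?_)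
  · exact primrecPred_iff (Primrec.eq.comp (Primrec.fst.comp hp) (Primrec.fst.comp hq))
      (Primrec.eq.comp (he.comp hs hpq) (.const _))
  · refine primrecPred_ball hF (primrecPred_imp ?_ (primrecPred_imp ?_ ?_))
    · exact Primrec.eq.comp (Primrec.fst.comp Primrec.snd)
        (Primrec.fst.comp (hp.comp Primrec.fst))
    · exact Primrec.eq.comp (Primrec.fst.comp (Primrec.snd.comp Primrec.snd))
        (Primrec.fst.comp (hq.comp Primrec.fst))
    · exact Primrec.eq.comp ((hm.comp hs hpq).comp Primrec.fst) (.const _)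
  · refine primrecPred_ball hL (primrecPred_iff ?_ ?_)
    · refine (primrecPred_bex (hF.comp Primrec.fst) (P := fun y t =>
        t = (y.1.1.2.1, y.1.2.1, y.2.1)) ?_).of_eq fun y => by simp
      refine Primrec.eq.comp Primrec.snd ?_
      exact ((Primrec.fst.comp (hp.comp Primrec.fst)).pair ((Primrec.fst.comp
        (hq.comp Primrec.fst)).pair (Primrec.fst.comp Primrec.snd))).comp Primrec.fst
    · refine Primrec.eq.comp (hr.comp (hs.comp Primrec.fst) ?_) (.const _)
      exact (Primrec.snd.comp (hp.comp Primrec.fst)).pair ((Primrec.snd.comp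
        (hq.comp Primrec.fst)).pair (Primrec.snd.comp Primrec.snd))

theorem primrec_candidate : Primrec₂ candidate := by
  refine Primrec.ite (Primrec.eq.comp (Primrec.nat_mod.comp Primrec.fst (.const 2)) (.const 0))
    ?_ ?_
  · exact Primrec.snd.pair (Primrec.nat_div.comp Primrec.fst (.const 2))
  · exact (Primrec.nat_div.comp Primrec.fst (.const 2)).pair Primrec.snd

theorem primrec_failures (hr : Primrec₂ r) : Primrec₂ (failures r) := by
  refine Primrec.list_flatMap Primrec.snd ?_
  refine Primrec.list_flatMap (Primrec.snd.comp Primrec.fst) ?_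
  refine Primrec.list_flatMap (Primrec.snd.comp (Primrec.fst.comp Primrec.fst)) ?_
  have hp : Primrec fun y : (((ℕ × List (ℕ × ℕ)) × (ℕ × ℕ)) × (ℕ × ℕ)) × (ℕ × ℕ) =>
    y.1.1.2 := Primrec.snd.comp (Primrec.fst.comp Primrec.fst)
  have hq : Primrec fun y : (((ℕ × List (ℕ × ℕ)) × (ℕ × ℕ)) × (ℕ × ℕ)) × (ℕ × ℕ) =>
    y.1.2 := Primrec.snd.comp Primrec.fst
  have hu : Primrec fun y : (((ℕ × List (ℕ × ℕ)) × (ℕ × ℕ)) × (ℕ × ℕ)) × (ℕ × ℕ) =>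
    y.2 := Primrec.snd
  refine Primrec.ite (Primrec.eq.comp (hr.comp ?_ ?_) (.const _)) ?_ (.const _)
  · exact Primrec.fst.comp (Primrec.fst.comp (Primrec.fst.comp Primrec.fst))
  · exact (Primrec.snd.comp hp).pair ((Primrec.snd.comp hq).pair (Primrec.snd.comp hu))
  · exact Primrec.list_cons.comp ((Primrec.fst.comp hp).pair
      ((Primrec.fst.comp hq).pair (Primrec.fst.comp hu))) (.const [])

theorem primrec_trim (he : Primrec₂ e) (hr : Primrec₂ r) (hm : Primrec₂ m) :
    Primrec fun x : ℕ × List (ℕ × ℕ) × List (ℕ × ℕ × ℕ) => trim e r m x.1 x.2.1 x.2.2 := by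
  classical
  have hL : Primrec fun x : ℕ × List (ℕ × ℕ) × List (ℕ × ℕ × ℕ) => x.2.1 :=
    Primrec.fst.comp Primrec.snd
  refine Primrec.list_take.comp (Primrec.nat_findGreatest (Primrec.list_length.comp hL) ?_) hL
  refine (primrecPred_good he hr hm).comp (f := fun y : (ℕ × List (ℕ × ℕ) × List (ℕ × ℕ × ℕ)) × ℕ
    => (y.1.1, y.1.2.1.take y.2, y.1.2.2)) ?_
  exact (Primrec.fst.comp Primrec.fst).pair ((Primrec.list_take.comp Primrec.snd
    (hL.comp Primrec.fst)).pair (Primrec.snd.comp (Primrec.snd.comp Primrec.fst)))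

theorem primrec_prolong (he : Primrec₂ e) (hr : Primrec₂ r) (hm : Primrec₂ m) :
    Primrec fun x : ℕ × List (ℕ × ℕ) × List (ℕ × ℕ × ℕ) => prolong e r m x.1 x.2.1 x.2.2 := by
  classical
  have hL : Primrec fun x : ℕ × List (ℕ × ℕ) × List (ℕ × ℕ × ℕ) => x.2.1 :=
    Primrec.fst.comp Primrec.snd
  have hF : Primrec fun x : ℕ × List (ℕ × ℕ) × List (ℕ × ℕ × ℕ) => x.2.2 :=
    Primrec.snd.comp Primrec.snd
  have happ : Primrec fun y : (ℕ × List (ℕ × ℕ) × List (ℕ × ℕ × ℕ)) × ℕ =>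
      y.1.2.1 ++ [candidate y.1.2.1.length y.2] :=
    Primrec.list_concat.comp (hL.comp Primrec.fst)
      (primrec_candidate.comp (Primrec.list_length.comp (hL.comp Primrec.fst)) Primrec.snd)
  have hk : Primrec fun x : ℕ × List (ℕ × ℕ) × List (ℕ × ℕ × ℕ) =>
      (List.range x.1).findIdx fun k =>
        decide (Good (e x.1) (r x.1) (m x.1) (x.2.1 ++ [candidate x.2.1.length k]) x.2.2) := by
    refine Primrec.list_findIdx (Primrec.list_range.comp Primrec.fst) ?_
    refine (primrecPred_good he hr hm).decide.comp
      (g := fun y : (ℕ × List (ℕ × ℕ) × List (ℕ × ℕ × ℕ)) × ℕ =>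
        (y.1.1, y.1.2.1 ++ [candidate y.1.2.1.length y.2], y.1.2.2)) ?_
    exact (Primrec.fst.comp Primrec.fst).pair (happ.pair (hF.comp Primrec.fst))
  have hL' := happ.comp (Primrec.id.pair hk)
  have hF' := Primrec.list_append.comp hF ((primrec_failures hr).comp Primrec.fst hL')
  refine Primrec.ite (Primrec.nat_lt.comp hk Primrec.fst) (hL'.pair hF) (Primrec.ite (.and ?_ ?_)
    (hL'.pair hF') (hL.pair hF))
  · exact Primrec.eq.comp (Primrec.nat_mod.comp (Primrec.list_length.comp hL) (.const 2))
      (.const 0)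
  · exact (primrecPred_good he hr hm).comp (Primrec.fst.pair (hL'.pair hF'))

theorem primrec_stage (he : Primrec₂ e) (hr : Primrec₂ r) (hm : Primrec₂ m) :
    Primrec (stage e r m) := by
  have : Primrec fun s : ℕ => (s.rec ([], []) fun s x =>
      prolong e r m s (trim e r m s x.1 x.2) x.2 : List (ℕ × ℕ) × List (ℕ × ℕ × ℕ)) := by
    refine Primrec.nat_rec₁ _ ?_
    have := (primrec_trim he hr hm).pair (Primrec.snd.comp Primrec.snd)
    exact (primrec_prolong he hr hm).comp (Primrec.fst.pair this)
  refine this.of_eq fun s => ?_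
  induction s with
  | zero => rfl
  | succ s ih => simp only [stage, ← ih]

end Computability

end Copy
end Tern

namespace Tern

/-! ### Invariants of the construction -/

section Verification

variable {e : ℕ → ℕ × ℕ → Bool} {r : ℕ → ℕ × ℕ × ℕ → Bool} {m : ℕ → ℕ × ℕ → Bool}

theorem trim_prefix (s : ℕ) (L : List (ℕ × ℕ)) (Fs : List (ℕ × ℕ × ℕ)) :
    trim e r m s L Fs <+: L :=
  List.take_prefix _ _

theorem good_trim (s : ℕ) (L : List (ℕ × ℕ)) (Fs : List (ℕ × ℕ × ℕ)) :
    Good (e s) (r s) (m s) (trim e r m s L Fs) Fs := by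
  classical
  exact Nat.findGreatest_spec (P := fun i => Good (e s) (r s) (m s) (L.take i) Fs)
    (Nat.zero_le _) Good.nil

/-- Trimming cuts only down to the longest good prefix, so it leaves every good prefix untouched. -/
theorem prefix_trim {s : ℕ} {P L : List (ℕ × ℕ)} {Fs : List (ℕ × ℕ × ℕ)} (hP : P <+: L)
    (hg : Good (e s) (r s) (m s) P Fs) : P <+: trim e r m s L Fs := by
  classical
  have hPe : P = L.take P.length := List.prefix_iff_eq_take.1 hP
  have := Nat.le_findGreatest (P := fun i => Good (e s) (r s) (m s) (L.take i) Fs) hP.length_le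
    (by rwa [← hPe])
  rw [hPe]
  exact List.take_prefix_take_left this

theorem mem_failures {s : ℕ} {L : List (ℕ × ℕ)} {t : ℕ × ℕ × ℕ} :
    t ∈ failures r s L ↔ ∃ p ∈ L, ∃ q ∈ L, ∃ u ∈ L, r s (p.2, q.2, u.2) = false ∧
      t = (p.1, q.1, u.1) := by
  simp only [failures, List.mem_flatMap]
  refine exists_congr fun p => and_congr_right fun _ => exists_congr fun q =>
    and_congr_right fun _ => exists_congr fun u => and_congr_right fun _ => ?_
  split_ifs with h <;> simp [h]

/-- The possible outcomes of prolonging a good correspondence. -/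
theorem prolong_cases {s : ℕ} {L : List (ℕ × ℕ)} {Fs : List (ℕ × ℕ × ℕ)} :
    (∃ k < s, Good (e s) (r s) (m s) (L ++ [candidate L.length k]) Fs ∧
      (∀ j < k, ¬ Good (e s) (r s) (m s) (L ++ [candidate L.length j]) Fs) ∧
      prolong e r m s L Fs = (L ++ [candidate L.length k], Fs)) ∨
    ((∀ j < s, ¬ Good (e s) (r s) (m s) (L ++ [candidate L.length j]) Fs) ∧
      ((L.length % 2 = 0 ∧ Good (e s) (r s) (m s) (L ++ [(s, L.length / 2)])
          (Fs ++ failures r s (L ++ [(s, L.length / 2)])) ∧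
        prolong e r m s L Fs = (L ++ [(s, L.length / 2)],
          Fs ++ failures r s (L ++ [(s, L.length / 2)]))) ∨
      (¬ (L.length % 2 = 0 ∧ Good (e s) (r s) (m s) (L ++ [(s, L.length / 2)])
          (Fs ++ failures r s (L ++ [(s, L.length / 2)]))) ∧
        prolong e r m s L Fs = (L, Fs)))) := by
  classical
  let P : ℕ → Bool := fun k =>
    decide (Good (e s) (r s) (m s) (L ++ [candidate L.length k]) Fs)
  let k := (List.range s).findIdx P
  have hdef : prolong e r m s L Fs = if k < s then (L ++ [candidate L.length k], Fs) else
    if L.length % 2 = 0 ∧ Good (e s) (r s) (m s) (L ++ [candidate L.length k])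
      (Fs ++ failures r s (L ++ [candidate L.length k])) then
      (L ++ [candidate L.length k], Fs ++ failures r s (L ++ [candidate L.length k])) else
      (L, Fs) := rfl
  have hk : k ≤ s := by simpa using List.findIdx_le_length (p := P) (xs := List.range s)
  have hlt : ∀ j < k, ¬ Good (e s) (r s) (m s) (L ++ [candidate L.length j]) Fs := by
    intro j hj
    have := List.not_of_lt_findIdx hj
    simpa [P] using this
  rcases hk.lt_or_eq with hks | hks
  · left
    have hg := List.findIdx_getElem (p := P) (xs := List.range s) (w := by simpa using hks)
    rw [List.getElem_range] at hg
    refine ⟨k, hks, by simpa [P] using hg, hlt, by rw [hdef, if_pos hks]⟩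
  · right
    rw [hks] at hlt
    refine ⟨hlt, ?_⟩
    rw [hdef, if_neg (by omega), hks]
    by_cases hpar : L.length % 2 = 0
    · have hc : candidate L.length s = (s, L.length / 2) := by simp [candidate, hpar]
      rw [hc]
      by_cases hg : Good (e s) (r s) (m s) (L ++ [(s, L.length / 2)])
          (Fs ++ failures r s (L ++ [(s, L.length / 2)]))
      · exact .inl ⟨hpar, hg, by rw [if_pos ⟨hpar, hg⟩]⟩
      · exact .inr ⟨fun h => hg h.2, by rw [if_neg fun h => hg h.2]⟩
    · exact .inr ⟨fun h => hpar h.1, by rw [if_neg fun h => hpar h.1]⟩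

theorem prefix_prolong (s : ℕ) (L : List (ℕ × ℕ)) (Fs : List (ℕ × ℕ × ℕ)) :
    L <+: (prolong e r m s L Fs).1 := by
  rcases prolong_cases (e := e) (r := r) (m := m) (s := s) (L := L) (Fs := Fs) with
    ⟨k, -, -, -, h⟩ | ⟨-, ⟨-, -, h⟩ | ⟨-, h⟩⟩ <;> simp [h]

theorem trim_prefix_stage_succ (s : ℕ) :
    trim e r m s (stage e r m s).1 (stage e r m s).2 <+: (stage e r m (s + 1)).1 :=
  prefix_prolong _ _ _

/-- Trimming restores goodness for the approximation at stage `s`, and prolonging happens only after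
a check against that same approximation. -/
theorem good_stage_succ (s : ℕ) :
    Good (e s) (r s) (m s) (stage e r m (s + 1)).1 (stage e r m (s + 1)).2 := by
  rw [stage]
  have hg := good_trim (e := e) (r := r) (m := m) s (stage e r m s).1 (stage e r m s).2
  rcases prolong_cases (e := e) (r := r) (m := m) (s := s)
    (L := trim e r m s (stage e r m s).1 (stage e r m s).2) (Fs := (stage e r m s).2) with
    ⟨k, -, h1, -, h⟩ | ⟨-, ⟨-, h1, h⟩ | ⟨-, h⟩⟩ <;> rw [h]
  · exact h1
  · exact h1
  · exact hg

/-- A stage adds at most one pair. In particular, a position in use at stage `s` concerns an element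
and a name whose index is about half of something below `s`. -/
theorem stage_length_le (s : ℕ) : (stage e r m s).1.length ≤ s := by
  induction s with
  | zero => simp [stage]
  | succ s ih =>
    rw [stage]
    have := (trim_prefix (e := e) (r := r) (m := m) s (stage e r m s).1
      (stage e r m s).2).length_le
    rcases prolong_cases (e := e) (r := r) (m := m) (s := s)
      (L := trim e r m s (stage e r m s).1 (stage e r m s).2) (Fs := (stage e r m s).2) with
      ⟨k, -, h1, -, h⟩ | ⟨-, ⟨-, h1, h⟩ | ⟨-, h⟩⟩ <;> rw [h] <;> simp <;> omega

/-- This makes the element `s` fresh at stage `s`: nothing has been declared about it, so its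
failures can be chosen to fit the name that it receives. -/
theorem stage_bounds (s : ℕ) : (∀ p ∈ (stage e r m s).1, p.1 < s) ∧
    ∀ t ∈ (stage e r m s).2, t.1 < s ∧ t.2.1 < s ∧ t.2.2 < s := by
  induction s with
  | zero => simp [stage]
  | succ s ih =>
    have hlen := stage_length_le (e := e) (r := r) (m := m) s
    have htr := trim_prefix (e := e) (r := r) (m := m) s (stage e r m s).1 (stage e r m s).2
    have hlen' := htr.length_le
    have hL : ∀ p ∈ trim e r m s (stage e r m s).1 (stage e r m s).2, p.1 < s + 1 :=
      fun p hp => (ih.1 p (htr.subset hp)).trans (Nat.lt_succ_self s)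
    have hF : ∀ t ∈ (stage e r m s).2, t.1 < s + 1 ∧ t.2.1 < s + 1 ∧ t.2.2 < s + 1 :=
      fun t ht => by have := ih.2 t ht; omega
    have happ : ∀ c : ℕ × ℕ, c.1 < s + 1 →
        ∀ p ∈ trim e r m s (stage e r m s).1 (stage e r m s).2 ++ [c], p.1 < s + 1 := by
      intro c hc p hp
      rcases List.mem_append.1 hp with hp | hp
      · exact hL p hp
      · rwa [List.mem_singleton.1 hp]
    rw [stage]
    rcases prolong_cases (e := e) (r := r) (m := m) (s := s)
      (L := trim e r m s (stage e r m s).1 (stage e r m s).2) (Fs := (stage e r m s).2) with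
      ⟨k, hk, h1, -, h⟩ | ⟨-, ⟨-, h1, h⟩ | ⟨-, h⟩⟩ <;> rw [h]
    · refine ⟨happ _ ?_, hF⟩
      unfold candidate
      split_ifs <;> simp only <;> omega
    · refine ⟨happ _ (Nat.lt_succ_self s), fun t ht => ?_⟩
      rcases List.mem_append.1 ht with ht | ht
      · exact hF t ht
      · obtain ⟨p, hp, q, hq, u, hu, -, rfl⟩ := mem_failures.1 ht
        exact ⟨happ _ (Nat.lt_succ_self s) p hp, happ _ (Nat.lt_succ_self s) q hq,
          happ _ (Nat.lt_succ_self s) u hu⟩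
    · exact ⟨hL, hF⟩

/-- Failures of `S` are declared when the last of the three elements is created. -/
theorem failures_stage_succ {s : ℕ} {t : ℕ × ℕ × ℕ} (h1 : t.1 < s) (h2 : t.2.1 < s)
    (h3 : t.2.2 < s) : t ∈ (stage e r m (s + 1)).2 ↔ t ∈ (stage e r m s).2 := by
  have hg := good_trim (e := e) (r := r) (m := m) s (stage e r m s).1 (stage e r m s).2
  rw [stage]
  rcases prolong_cases (e := e) (r := r) (m := m) (s := s)
    (L := trim e r m s (stage e r m s).1 (stage e r m s).2) (Fs := (stage e r m s).2) with
    ⟨k, hk, -, -, h⟩ | ⟨-, ⟨-, -, h⟩ | ⟨-, h⟩⟩ <;> rw [h]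
  refine ⟨fun ht => ?_, fun ht => List.mem_append_left _ ht⟩
  rcases List.mem_append.1 ht with ht | ht
  · exact ht
  · obtain ⟨p, hp, q, hq, u, hu, hf, rfl⟩ := mem_failures.1 ht
    -- A pair whose element lies below `s` differs from the new pair and so belongs to the trimmed
    -- list. That list is good, hence a required failure among old elements has been declared
    -- before.
    have key : ∀ p ∈ trim e r m s (stage e r m s).1 (stage e r m s).2 ++
        [(s, (trim e r m s (stage e r m s).1 (stage e r m s).2).length / 2)], p.1 < s →
        p ∈ trim e r m s (stage e r m s).1 (stage e r m s).2 := by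
      intro p hp hps
      rcases List.mem_append.1 hp with hp | hp
      · exact hp
      · rw [List.mem_singleton.1 hp] at hps
        exact (lt_irrefl _ hps).elim
    exact ((hg p (key p hp h1) q (key q hq h2)).2.2 u (key u hu h3)).2 hf

/-- Past `s₀` the status of triples of elements below `s₀` is frozen, however often the names are
revised. This is the source of the decidability of the copy. -/
theorem failures_stage {s₀ s : ℕ} {t : ℕ × ℕ × ℕ} (h1 : t.1 < s₀) (h2 : t.2.1 < s₀)
    (h3 : t.2.2 < s₀) (hs : s₀ ≤ s) : t ∈ (stage e r m s).2 ↔ t ∈ (stage e r m s₀).2 := by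
  induction hs with
  | refl => rfl
  | step hs ih =>
    have hs : s₀ ≤ _ := hs
    exact (failures_stage_succ (h1.trans_le hs) (h2.trans_le hs) (h3.trans_le hs)).trans ih

/-- Position `2a` always deals with the name `a` and position `2x + 1` with the element `x`.
Stability of all positions therefore makes the limit correspondence total in both directions. -/
theorem stage_getElem (s : ℕ) : ∀ i p, (stage e r m s).1[i]? = some p →
    (i % 2 = 0 → p.2 = i / 2) ∧ (i % 2 = 1 → p.1 = i / 2) := by
  induction s with
  | zero => simp [stage]
  | succ s ih =>
    have htr : ∀ i p, (trim e r m s (stage e r m s).1 (stage e r m s).2)[i]? = some p →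
        (i % 2 = 0 → p.2 = i / 2) ∧ (i % 2 = 1 → p.1 = i / 2) := by
      intro i p hi
      obtain ⟨ρ, hρ⟩ := trim_prefix (e := e) (r := r) (m := m) s (stage e r m s).1
        (stage e r m s).2
      refine ih i p ?_
      obtain ⟨h1, h2⟩ := List.getElem?_eq_some_iff.1 hi
      rw [← hρ, List.getElem?_append_left h1, hi]
    have happ : ∀ c : ℕ × ℕ,
        ((trim e r m s (stage e r m s).1 (stage e r m s).2).length % 2 = 0 →
          c.2 = (trim e r m s (stage e r m s).1 (stage e r m s).2).length / 2) →
        ((trim e r m s (stage e r m s).1 (stage e r m s).2).length % 2 = 1 →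
          c.1 = (trim e r m s (stage e r m s).1 (stage e r m s).2).length / 2) →
        ∀ i p, (trim e r m s (stage e r m s).1 (stage e r m s).2 ++ [c])[i]? = some p →
        (i % 2 = 0 → p.2 = i / 2) ∧ (i % 2 = 1 → p.1 = i / 2) := by
      intro c hc1 hc2 i p hi
      rw [List.getElem?_append] at hi
      split_ifs at hi with hlt
      · exact htr i p hi
      · obtain ⟨h1, h2⟩ := List.getElem?_eq_some_iff.1 hi
        simp only [List.length_singleton, Nat.lt_one_iff] at h1
        simp only [List.getElem_singleton] at h2
        obtain rfl : i = (trim e r m s (stage e r m s).1 (stage e r m s).2).length := by omega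
        subst h2
        exact ⟨hc1, hc2⟩
    rw [stage]
    rcases prolong_cases (e := e) (r := r) (m := m) (s := s)
      (L := trim e r m s (stage e r m s).1 (stage e r m s).2) (Fs := (stage e r m s).2) with
      ⟨k, hk, h1, -, h⟩ | ⟨-, ⟨hpar, h1, h⟩ | ⟨-, h⟩⟩ <;> rw [h]
    · refine happ _ (fun h => by simp [candidate, h]) fun h => ?_
      simp [candidate, h]
    · exact happ _ (fun _ => rfl) fun h => by omega
    · exact htr

end Verification

/-- A structure on names: `E` is an equivalence relation, a congruence for the ternary relation `S`
and the binary relation `M`, where `M a b` implies `S a b c`, and every consistent pattern of `S`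
for one new element that is unrelated by `M` to the given elements is realized. -/
structure IsExtensible (E : ℕ × ℕ → Bool) (S : ℕ × ℕ × ℕ → Bool) (M : ℕ × ℕ → Bool) : Prop where
  refl : ∀ a, E (a, a) = true
  symm : ∀ {a b}, E (a, b) = true → E (b, a) = true
  trans : ∀ {a b c}, E (a, b) = true → E (b, c) = true → E (a, c) = true
  congr_S : ∀ {a a' b b' c c'}, E (a, a') = true → E (b, b') = true → E (c, c') = true →
    S (a, b, c) = S (a', b', c')
  congr_M : ∀ {a a' b b'}, E (a, a') = true → E (b, b') = true → M (a, b) = M (a', b')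
  S_of_M : ∀ {a b}, M (a, b) = true → ∀ c, S (a, b, c) = true
  extend : ∀ (L : List (ℕ × ℕ)) (x : ℕ) (P : ℕ × ℕ × ℕ → Bool),
    (∀ p ∈ L, ∀ q ∈ L, p.1 = q.1 ↔ E (p.2, q.2) = true) → (∀ p ∈ L, p.1 ≠ x) →
    (∀ p ∈ L, ∀ q ∈ L, ∀ u ∈ L, P (p.1, q.1, u.1) = S (p.2, q.2, u.2)) →
    (∀ p ∈ L, ∀ q ∈ L, M (p.2, q.2) = true → P (p.1, q.1, x) = true) →
    ∃ b, (∀ p ∈ L, E (p.2, b) = false ∧ M (p.2, b) = false ∧ M (b, p.2) = false) ∧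
      M (b, b) = false ∧ ∀ p ∈ L ++ [(x, b)], ∀ q ∈ L ++ [(x, b)], ∀ u ∈ L ++ [(x, b)],
        P (p.1, q.1, u.1) = S (p.2, q.2, u.2)

/-! ### Convergence of the correspondence -/

section Limit

variable {e : ℕ → ℕ × ℕ → Bool} {r : ℕ → ℕ × ℕ × ℕ → Bool} {m : ℕ → ℕ × ℕ → Bool}
  {E : ℕ × ℕ → Bool} {S : ℕ × ℕ × ℕ → Bool} {M : ℕ × ℕ → Bool}

/-- Only finitely many values concern names below `N`. One stage thus serves all lists over these
names and all lists of failures at once, including failures declared later. -/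
theorem exists_stable (he : ∀ a, ∃ s₀, ∀ s ≥ s₀, e s a = E a)
    (hr : ∀ a, ∃ s₀, ∀ s ≥ s₀, r s a = S a) (hm : ∀ a, ∃ s₀, ∀ s ≥ s₀, m s a = M a) (N : ℕ) :
    ∃ s₀, ∀ s ≥ s₀, (∀ (L : List (ℕ × ℕ)) (Fs : List (ℕ × ℕ × ℕ)), (∀ p ∈ L, p.2 < N) →
      (Good (e s) (r s) (m s) L Fs ↔ Good E S M L Fs)) ∧
      ∀ a < N, ∀ b < N, ∀ c < N, r s (a, b, c) = S (a, b, c) := by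
  simp only [← Filter.eventually_atTop] at he hr hm ⊢
  have hfin : (Set.Iio N).Finite := Set.finite_Iio N
  have h1 : ∀ᶠ s in Filter.atTop, ∀ a ∈ Set.Iio N, ∀ b ∈ Set.Iio N, e s (a, b) = E (a, b) :=
    (Filter.eventually_all_finite hfin).2 fun a _ =>
      (Filter.eventually_all_finite hfin).2 fun b _ => he _
  have h2 : ∀ᶠ s in Filter.atTop, ∀ a ∈ Set.Iio N, ∀ b ∈ Set.Iio N, ∀ c ∈ Set.Iio N,
      r s (a, b, c) = S (a, b, c) :=
    (Filter.eventually_all_finite hfin).2 fun a _ =>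
      (Filter.eventually_all_finite hfin).2 fun b _ =>
        (Filter.eventually_all_finite hfin).2 fun c _ => hr _
  have h3 : ∀ᶠ s in Filter.atTop, ∀ a ∈ Set.Iio N, ∀ b ∈ Set.Iio N, m s (a, b) = M (a, b) :=
    (Filter.eventually_all_finite hfin).2 fun a _ =>
      (Filter.eventually_all_finite hfin).2 fun b _ => hm _
  filter_upwards [h1, h2, h3] with s h1 h2 h3
  exact ⟨fun L Fs hL => good_congr h1 h2 h3 hL, h2⟩

theorem exists_name_bound (L : List (ℕ × ℕ)) : ∃ N, ∀ p ∈ L, p.2 < N := by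
  refine ⟨(L.map Prod.snd).sum + 1, fun p hp => Nat.lt_succ_of_le ?_⟩
  exact List.single_le_sum (by simp) _ (List.mem_map_of_mem hp)

/-- An existing or a fresh element of the copy can be matched with any given name. -/
theorem IsExtensible.good_back (h : IsExtensible E S M) {L : List (ℕ × ℕ)}
    {Fs N : List (ℕ × ℕ × ℕ)} (hL : Good E S M L Fs) {s : ℕ} (a : ℕ) (hLs : ∀ p ∈ L, p.1 < s)
    (hFs : ∀ t ∈ Fs, t.1 < s ∧ t.2.1 < s ∧ t.2.2 < s)
    (hN : ∀ t, t ∈ N ↔ ∃ p ∈ L ++ [(s, a)], ∃ q ∈ L ++ [(s, a)], ∃ u ∈ L ++ [(s, a)],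
      S (p.2, q.2, u.2) = false ∧ t = (p.1, q.1, u.1)) :
    (∃ x < s, Good E S M (L ++ [(x, a)]) Fs) ∨ Good E S M (L ++ [(s, a)]) (Fs ++ N) := by
  -- If `a` names an element that already has a match, that match is reused; otherwise the fresh
  -- element `s` takes `a`, and its failures are copied from `S`.
  by_cases ha : ∃ p ∈ L, E (p.2, a) = true
  · left
    obtain ⟨p₀, hp₀, hpa⟩ := ha
    refine ⟨p₀.1, hLs _ hp₀, ?_⟩
    -- Up to `E` on names, the longer list contains no new pair, so the congruence laws transfer
    -- goodness.
    have key : ∀ p ∈ L ++ [(p₀.1, a)], ∃ p' ∈ L, p'.1 = p.1 ∧ E (p'.2, p.2) = true := by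
      intro p hp
      rcases List.mem_append.1 hp with hp | hp
      · exact ⟨p, hp, rfl, h.refl _⟩
      · rw [List.mem_singleton.1 hp]
        exact ⟨p₀, hp₀, rfl, hpa⟩
    intro p hp q hq
    obtain ⟨p', hp', hp1, hp2⟩ := key p hp
    obtain ⟨q', hq', hq1, hq2⟩ := key q hq
    obtain ⟨g1, g2, g3⟩ := hL p' hp' q' hq'
    refine ⟨?_, ?_, ?_⟩
    · rw [← hp1, ← hq1, g1]
      exact ⟨fun h' => h.trans (h.symm hp2) (h.trans h' hq2),
        fun h' => h.trans hp2 (h.trans h' (h.symm hq2))⟩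
    · rw [← hp1, ← hq1, ← h.congr_M hp2 hq2]
      exact g2
    · intro u hu
      obtain ⟨u', hu', hu1, hu2⟩ := key u hu
      rw [← hp1, ← hq1, ← hu1, ← h.congr_S hp2 hq2 hu2]
      exact g3 u' hu'
  · right
    push Not at ha
    have hne : ∀ p ∈ L, p.1 ≠ s := fun p hp => (hLs p hp).ne
    have hcases : ∀ p ∈ L ++ [(s, a)], p ∈ L ∨ p = (s, a) := by
      intro p hp
      simpa using hp
    have hsub : ∀ p ∈ L, p ∈ L ++ [(s, a)] := fun p hp => List.mem_append_left _ hp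
    have hinj : ∀ p ∈ L ++ [(s, a)], ∀ q ∈ L ++ [(s, a)], p.1 = q.1 ↔ E (p.2, q.2) = true := by
      intro p hp q hq
      rcases hcases p hp with hp | rfl <;> rcases hcases q hq with hq | rfl
      · exact (hL p hp q hq).1
      · exact iff_of_false (hne p hp) (ha p hp)
      · exact iff_of_false (hne q hq).symm fun h' => ha q hq (h.symm h')
      · exact iff_of_true rfl (h.refl _)
    have hS : ∀ p ∈ L ++ [(s, a)], ∀ q ∈ L ++ [(s, a)], ∀ u ∈ L ++ [(s, a)],
        (p.1, q.1, u.1) ∈ Fs ++ N ↔ S (p.2, q.2, u.2) = false := by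
      intro p hp q hq u hu
      refine ⟨fun h' => ?_, fun h' => List.mem_append_right _ ((hN _).2 ⟨p, hp, q, hq, u, hu, h',
        rfl⟩)⟩
      rcases List.mem_append.1 h' with h' | h'
      · have hb := hFs _ h'
        have hin : ∀ p ∈ L ++ [(s, a)], p.1 < s → p ∈ L := by
          intro p hp hps
          rcases hcases p hp with hp | rfl
          · exact hp
          · exact (lt_irrefl _ hps).elim
        exact ((hL p (hin p hp hb.1) q (hin q hq hb.2.1)).2.2 u (hin u hu hb.2.2)).1 h'
      · obtain ⟨p', hp', q', hq', u', hu', hf, heq⟩ := (hN _).1 h'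
        simp only [Prod.mk.injEq] at heq
        rw [h.congr_S ((hinj p hp p' hp').1 heq.1) ((hinj q hq q' hq').1 heq.2.1)
          ((hinj u hu u' hu').1 heq.2.2), hf]
    refine fun p hp q hq => ⟨hinj p hp q hq, ?_, hS p hp q hq⟩
    rintro ⟨t1, t2, t3⟩ ht rfl rfl
    by_contra hM
    rw [Bool.not_eq_false] at hM
    rcases List.mem_append.1 ht with ht | ht
    · have hb := hFs _ ht
      rcases hcases p hp with hp | rfl
      · rcases hcases q hq with hq | rfl
        · have := (hL p hp q hq).2.1 _ ht rfl rfl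
          rw [hM] at this
          cases this
        · exact (lt_irrefl _ hb.2.1).elim
      · exact (lt_irrefl _ hb.1).elim
    · obtain ⟨p', hp', q', hq', u', hu', hf, heq⟩ := (hN _).1 ht
      simp only [Prod.mk.injEq] at heq
      have hM' := h.congr_M ((hinj p hp p' hp').1 heq.1) ((hinj q hq q' hq').1 heq.2.1)
      rw [hM] at hM'
      -- New failures copy actual failures of `S`, and `M` rules those out for every third argument,
      -- so a pair related by `M` acquires none.
      rw [h.S_of_M hM'.symm] at hf
      cases hf

/-- Every element of the copy can be matched with a name, which stays valid when more failures of
`S` involving later elements are declared. -/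
theorem IsExtensible.good_forth (h : IsExtensible E S M) {L : List (ℕ × ℕ)}
    {Fs : List (ℕ × ℕ × ℕ)} (hL : Good E S M L Fs) {x s : ℕ} (hx : x < s)
    (hLs : ∀ p ∈ L, p.1 < s) :
    ∃ b, ∀ Fs' : List (ℕ × ℕ × ℕ), Good E S M L Fs' →
      (∀ i < s, ∀ j < s, ∀ k < s, (i, j, k) ∈ Fs' ↔ (i, j, k) ∈ Fs) →
      Good E S M (L ++ [(x, b)]) Fs' := by
  by_cases hxL : ∃ p ∈ L, p.1 = x
  · obtain ⟨p₀, hp₀, rfl⟩ := hxL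
    refine ⟨p₀.2, fun Fs' hF' _ => hF'.subset ?_⟩
    intro p hp
    rcases List.mem_append.1 hp with hp | hp
    · exact hp
    · rwa [List.mem_singleton.1 hp]
  · push Not at hxL
    -- The pattern to be realized is what has been decided about `x`: `S` holds exactly where no
    -- failure is declared. The clause on `M` in `Good` is precisely the admissibility condition of
    -- `extend`.
    obtain ⟨b, hb1, hb2, hb3⟩ := h.extend L x (fun t => decide (t ∉ Fs))
      (fun p hp q hq => (hL p hp q hq).1) hxL
      (fun p hp q hq u hu => by
        have := (hL p hp q hq).2.2 u hu
        by_cases h' : (p.1, q.1, u.1) ∈ Fs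
        · simp [h', this.1 h']
        · simp only [h', not_false_eq_true, decide_true]
          by_contra hne
          exact h' (this.2 (by simpa using Ne.symm hne)))
      (fun p hp q hq hM => by
        simp only [decide_eq_true_eq]
        intro hmem
        rw [(hL p hp q hq).2.1 _ hmem rfl rfl] at hM
        cases hM)
    refine ⟨b, fun Fs' hF' hFF p hp q hq => ?_⟩
    have hcases : ∀ p ∈ L ++ [(x, b)], p ∈ L ∨ p = (x, b) := fun p hp => by simpa using hp
    have hlt : ∀ p ∈ L ++ [(x, b)], p.1 < s := by
      intro p hp
      rcases hcases p hp with hp | rfl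
      · exact hLs p hp
      · exact hx
    refine ⟨?_, ?_, ?_⟩
    · rcases hcases p hp with hp | rfl <;> rcases hcases q hq with hq | rfl
      · exact (hF' p hp q hq).1
      · exact iff_of_false (hxL p hp) (by simp [hb1 p hp])
      · exact iff_of_false (hxL q hq).symm fun h' => by
          have := h.symm h'
          simp [hb1 q hq] at this
      · exact iff_of_true rfl (h.refl _)
    -- Later failures may well involve `x` and a later element. They are harmless, since `b` is
    -- unrelated by `M` to the names in `L` and to itself.
    · intro t ht ht1 ht2
      rcases hcases p hp with hp | rfl <;> rcases hcases q hq with hq | rfl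
      · exact (hF' p hp q hq).2.1 t ht ht1 ht2
      · exact (hb1 p hp).2.1
      · exact (hb1 q hq).2.2
      · exact hb2
    · intro u hu
      rw [hFF _ (hlt p hp) _ (hlt q hq) _ (hlt u hu), ← hb3 p hp q hq u hu]
      simp

/-- A truly good prefix whose names are judged correctly from now on is never trimmed; being good at
the end of each stage, it is also truly good with respect to the new failures. -/
theorem good_persists {N s₀ s : ℕ} {Q : List (ℕ × ℕ)} (hQ : ∀ p ∈ Q, p.2 < N)
    (hst : ∀ s ≥ s₀, ∀ (L : List (ℕ × ℕ)) (Fs : List (ℕ × ℕ × ℕ)), (∀ p ∈ L, p.2 < N) →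
      (Good (e s) (r s) (m s) L Fs ↔ Good E S M L Fs))
    (hs : s₀ ≤ s) (hpre : Q <+: (stage e r m s).1) (hgood : Good E S M Q (stage e r m s).2)
    {s' : ℕ} (hs' : s ≤ s') :
    Q <+: (stage e r m s').1 ∧ Good E S M Q (stage e r m s').2 := by
  induction hs' with
  | refl => exact ⟨hpre, hgood⟩
  | @step t ht ih =>
    have ht : s ≤ t := ht
    have h1 : Q <+: (stage e r m (t + 1)).1 :=
      (prefix_trim ih.1 ((hst t (by omega) Q _ hQ).2 ih.2)).trans (trim_prefix_stage_succ t)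
    exact ⟨h1, (hst t (by omega) Q _ hQ).1 ((good_stage_succ t).subset h1.subset)⟩

theorem exists_prefix_of_lt {P L : List (ℕ × ℕ)} (h : P <+: L) (hlt : P.length < L.length) :
    ∃ q, P ++ [q] <+: L := by
  obtain ⟨ρ, rfl⟩ := h
  rcases ρ with _ | ⟨q, ρ⟩
  · simp at hlt
  · exact ⟨q, ρ, by simp⟩

/-- Every position of the correspondence eventually stabilizes. -/
theorem IsExtensible.exists_stable_prefix (h : IsExtensible E S M)
    (he : ∀ a, ∃ s₀, ∀ s ≥ s₀, e s a = E a)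
    (hr : ∀ a, ∃ s₀, ∀ s ≥ s₀, r s a = S a) (hm : ∀ a, ∃ s₀, ∀ s ≥ s₀, m s a = M a) (i : ℕ) :
    ∃ P : List (ℕ × ℕ), P.length = i ∧ ∃ s₀, ∀ s ≥ s₀, P <+: (stage e r m s).1 := by
  induction i with
  | zero => exact ⟨[], rfl, 0, fun s _ => List.nil_prefix⟩
  | succ i ih =>
    obtain ⟨P, hlen, s₀, hP⟩ := ih
    obtain ⟨N₁, hN₁⟩ := exists_name_bound P
    have hPs : ∀ s ≥ s₀, ∀ p ∈ P, p.1 < s :=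
      fun s hs p hp => (stage_bounds s).1 p ((hP s hs).subset hp)
    obtain ⟨t₁, ht₁⟩ := exists_stable he hr hm N₁
    -- `P` survives every late stage, and the approximation used there is right about its names, so
    -- `P` is good in the limit structure as well.
    have hPgood : ∀ s ≥ max s₀ t₁ + 1, Good E S M P (stage e r m s).2 := by
      intro s hs
      obtain ⟨t, rfl⟩ : ∃ t, s = t + 1 := ⟨s - 1, by omega⟩
      exact ((ht₁ t (by omega)).1 P _ hN₁).1
        ((good_stage_succ t).subset (hP (t + 1) (by omega)).subset)
    -- A single late extension of `P` suffices, provided that its name is below a bound on which the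
    -- approximation is already correct.
    have hfin : ∀ (N s₂ : ℕ), (∀ s ≥ s₂, ∀ (L : List (ℕ × ℕ)) (Fs : List (ℕ × ℕ × ℕ)),
        (∀ p ∈ L, p.2 < N) → (Good (e s) (r s) (m s) L Fs ↔ Good E S M L Fs)) → N₁ ≤ N →
        (∃ s ≥ s₂, ∃ q : ℕ × ℕ, q.2 < N ∧ P ++ [q] <+: (stage e r m (s + 1)).1) →
        ∃ P : List (ℕ × ℕ), P.length = i + 1 ∧ ∃ s₀, ∀ s ≥ s₀, P <+: (stage e r m s).1 := by
      rintro N s₂ hst hN ⟨s, hs, q, hq, hpre⟩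
      have hQ : ∀ p ∈ P ++ [q], p.2 < N := by
        intro p hp
        rcases List.mem_append.1 hp with hp | hp
        · exact (hN₁ p hp).trans_le hN
        · rwa [List.mem_singleton.1 hp]
      refine ⟨P ++ [q], by simp [hlen], s + 1, fun s' hs' => ?_⟩
      exact (good_persists hQ hst (by omega) hpre
        ((hst s hs _ _ hQ).1 ((good_stage_succ s).subset hpre.subset)) hs').1
    have htrim : ∀ s ≥ max s₀ t₁ + 1, P <+: trim e r m s (stage e r m s).1 (stage e r m s).2 :=
      fun s hs => prefix_trim (hP s (by omega))
        (((ht₁ s (by omega)).1 P _ hN₁).2 (hPgood s hs))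
    have htrim_eq : ∀ s ≥ max s₀ t₁ + 1,
        ¬ P.length < (trim e r m s (stage e r m s).1 (stage e r m s).2).length →
        trim e r m s (stage e r m s).1 (stage e r m s).2 = P := by
      intro s hs hle
      exact ((htrim s hs).eq_of_length_le (not_lt.1 hle)).symm
    rcases Nat.mod_two_eq_zero_or_one i with hpar | hpar
    · obtain ⟨t₂, ht₂⟩ := exists_stable he hr hm (max N₁ (i / 2 + 1))
      have hgoal : ∃ q, P ++ [q] <+: (stage e r m (max (max s₀ t₁ + 1) t₂ + 1)).1 := by
        set s := max (max s₀ t₁ + 1) t₂ with hs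
        by_cases hlt : P.length < (trim e r m s (stage e r m s).1 (stage e r m s).2).length
        · obtain ⟨q, hq⟩ := exists_prefix_of_lt (htrim s (by omega)) hlt
          exact ⟨q, hq.trans (trim_prefix_stage_succ s)⟩
        · have htr := htrim_eq s (by omega) hlt
          have hnames : ∀ x, ∀ p ∈ P ++ [(x, i / 2)], p.2 < max N₁ (i / 2 + 1) := by
            intro x p hp
            rcases List.mem_append.1 hp with hp | hp
            · exact (hN₁ p hp).trans_le (le_max_left _ _)
            · rw [List.mem_singleton.1 hp]
              exact lt_of_lt_of_le (Nat.lt_succ_self _) (le_max_right _ _)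
          obtain ⟨hst, hrS⟩ := ht₂ s (by omega)
          rw [stage, htr]
          rcases prolong_cases (e := e) (r := r) (m := m) (s := s) (L := P)
            (Fs := (stage e r m s).2) with
            ⟨k, hk, h1, -, h'⟩ | ⟨hno, ⟨-, h1, h'⟩ | ⟨hno', h'⟩⟩ <;> rw [h']
          · exact ⟨_, List.prefix_rfl⟩
          · exact ⟨_, List.prefix_rfl⟩
          · exfalso
            rw [hlen] at hno hno'
            rcases h.good_back (hPgood s (by omega)) (i / 2) (hPs s (by omega))
              (stage_bounds s).2 (N := failures r s (P ++ [(s, i / 2)])) (fun t => by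
                rw [mem_failures]
                refine exists_congr fun p => and_congr_right fun hp => exists_congr fun q =>
                  and_congr_right fun hq => exists_congr fun u => and_congr_right fun hu => ?_
                rw [hrS _ (hnames s p hp) _ (hnames s q hq) _ (hnames s u hu)]) with
              ⟨x, hx, hg⟩ | hg
            · refine hno x hx ?_
              simpa [candidate, hpar] using (hst _ _ (hnames x)).2 hg
            · exact hno' ⟨hpar, (hst _ _ (hnames s)).2 hg⟩
      obtain ⟨q, hq⟩ := hgoal
      refine hfin _ t₂ (fun s hs => (ht₂ s hs).1) (le_max_left _ _)
        ⟨_, le_max_right _ _, q, ?_, hq⟩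
      obtain ⟨ρ, hρ⟩ := hq
      have := (stage_getElem (e := e) (r := r) (m := m) (max (max s₀ t₁ + 1) t₂ + 1) i q
        (by rw [← hρ]; simp [← hlen])).1 hpar
      rw [this]
      exact lt_of_lt_of_le (Nat.lt_succ_self _) (le_max_right _ _)
    -- At an odd position the element `i / 2` is prescribed. It lies below the stage at which
    -- `good_forth` is applied, where the failures among the elements concerned are frozen.
    · have his : i ≤ s₀ := by
        rw [← hlen]
        exact (hP s₀ le_rfl).length_le.trans (stage_length_le s₀)
      obtain ⟨b, hb⟩ := h.good_forth (hPgood _ le_rfl) (x := i / 2) (s := max s₀ t₁ + 1)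
        (by omega) (hPs _ (by omega))
      obtain ⟨t₂, ht₂⟩ := exists_stable he hr hm (max N₁ (b + 1))
      -- The name is not known in advance. Either some late stage has a name bounded in terms of `b`
      -- after `P`, which is then permanent, or this never happens.
      by_cases hA : ∃ s ≥ t₂, ∃ q : ℕ × ℕ, q.2 < max N₁ (b + 1) ∧
          P ++ [q] <+: (stage e r m (s + 1)).1
      · exact hfin _ t₂ (fun s hs => (ht₂ s hs).1) (le_max_left _ _) hA
      -- In the second case a late list cannot be trimmed down to `P`: the least good candidate
      -- would be at most `b`, since `b` is good, and choosing it would contradict the case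
      -- assumption. So the pair after `P`, whatever its name, is never removed.
      · have hlong : ∀ s ≥ max (max s₀ t₁ + 1) (max t₂ (b + 1)),
            P.length < (trim e r m s (stage e r m s).1 (stage e r m s).2).length := by
          intro s hs
          by_contra hlt
          have htr := htrim_eq s (by omega) hlt
          have hcand : ∀ k, candidate P.length k = (i / 2, k) := by
            intro k
            simp [candidate, hlen, hpar]
          have hgb : Good (e s) (r s) (m s) (P ++ [candidate P.length b]) (stage e r m s).2 := by
            rw [hcand]
            refine ((ht₂ s (by omega)).1 _ _ ?_).2 (hb _ (hPgood s (by omega)) ?_)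
            · intro p hp
              rcases List.mem_append.1 hp with hp | hp
              · exact (hN₁ p hp).trans_le (le_max_left _ _)
              · rw [List.mem_singleton.1 hp]
                exact lt_of_lt_of_le (Nat.lt_succ_self _) (le_max_right _ _)
            · intro j hj k hk l hl
              exact failures_stage hj hk hl (by omega)
          rcases prolong_cases (e := e) (r := r) (m := m) (s := s) (L := P)
            (Fs := (stage e r m s).2) with ⟨k, hk, h1, hmin, h'⟩ | ⟨hno, -⟩
          · refine hA ⟨s, by omega, candidate P.length k, ?_, ?_⟩
            · rw [hcand]
              have : k ≤ b := not_lt.1 fun hlt => hmin b hlt hgb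
              exact lt_of_lt_of_le (Nat.lt_succ_of_le this) (le_max_right _ _)
            · rw [stage, htr, h']
          · exact hno b (by omega) hgb
        obtain ⟨q, hq⟩ := exists_prefix_of_lt (htrim _ (le_max_left _ _)) (hlong _ le_rfl)
        refine ⟨P ++ [q], by simp [hlen], max (max s₀ t₁ + 1) (max t₂ (b + 1)), fun s hs => ?_⟩
        induction hs with
        | refl => exact hq.trans (trim_prefix _ _ _)
        | @step t ht ih =>
          refine List.IsPrefix.trans ?_ (trim_prefix_stage_succ t)
          refine List.prefix_of_prefix_length_le ih (trim_prefix _ _ _) ?_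
          simpa using hlong t ht

/-- An extensible structure with a primitive recursive approximation has a computable copy. -/
theorem IsExtensible.exists_computable_copy (h : IsExtensible E S M)
    (pe : Primrec₂ e) (pr : Primrec₂ r) (pm : Primrec₂ m)
    (he : ∀ a, ∃ s₀, ∀ s ≥ s₀, e s a = E a)
    (hr : ∀ a, ∃ s₀, ∀ s ≥ s₀, r s a = S a) (hm : ∀ a, ∃ s₀, ∀ s ≥ s₀, m s a = M a) :
    ∃ (R : Set (ℕ × ℕ × ℕ)) (G : ℕ → ℕ → Prop), ComputablePred (fun t => t ∈ R) ∧
      (∀ x, ∃ a, G x a) ∧ (∀ a, ∃ x, G x a) ∧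
      (∀ {x y a b}, G x a → G y b → (x = y ↔ E (a, b) = true)) ∧
      ∀ {x y z a b c}, G x a → G y b → G z c → ((x, y, z) ∈ R ↔ S (a, b, c) = true) := by
  -- The limit correspondence consists of the pairs that are eventually permanent.
  let G : ℕ → ℕ → Prop := fun x a => ∃ s₀, ∀ s ≥ s₀, (x, a) ∈ (stage e r m s).1
  have hget : ∀ i, ∃ q, (∃ s₀, ∀ s ≥ s₀, q ∈ (stage e r m s).1) ∧
      (i % 2 = 0 → q.2 = i / 2) ∧ (i % 2 = 1 → q.1 = i / 2) := by
    intro i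
    obtain ⟨P, hlen, s₀, hP⟩ := h.exists_stable_prefix he hr hm (i + 1)
    have hi : i < P.length := by omega
    refine ⟨P[i], ⟨s₀, fun s hs => (hP s hs).subset (List.getElem_mem hi)⟩, ?_⟩
    refine stage_getElem (e := e) (r := r) (m := m) s₀ i P[i] ?_
    obtain ⟨ρ, hρ⟩ := hP s₀ le_rfl
    rw [← hρ, List.getElem?_append_left hi, List.getElem?_eq_getElem hi]
  -- Three permanent pairs occur together in a late list. Goodness of that list contains both the
  -- comparison of equality and the comparison of `S`.
  have hgood : ∀ {x y z a b c}, G x a → G y b → G z c →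
      ∃ s₀, ∀ s ≥ s₀, Good E S M [(x, a), (y, b), (z, c)] (stage e r m s).2 := by
    rintro x y z a b c ⟨s₁, h₁⟩ ⟨s₂, h₂⟩ ⟨s₃, h₃⟩
    obtain ⟨N, hN⟩ := exists_name_bound [(x, a), (y, b), (z, c)]
    obtain ⟨t, ht⟩ := exists_stable he hr hm N
    refine ⟨max (max s₁ s₂) (max s₃ t) + 1, fun s hs => ?_⟩
    obtain ⟨s, rfl⟩ : ∃ s', s = s' + 1 := ⟨s - 1, by omega⟩
    refine ((ht s (by omega)).1 _ _ hN).1 ((good_stage_succ s).subset ?_)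
    intro p hp
    simp only [List.mem_cons, List.not_mem_nil, or_false] at hp
    rcases hp with rfl | rfl | rfl
    · exact h₁ _ (by omega)
    · exact h₂ _ (by omega)
    · exact h₃ _ (by omega)
  -- The stage index exceeds all three elements, so the decision read off there is final by
  -- `failures_stage`.
  refine ⟨{t | t ∉ (stage e r m (t.1 + t.2.1 + t.2.2 + 1)).2}, G, ?_, ?_, ?_, ?_, ?_⟩
  · refine PrimrecPred.computablePred (.not ?_)
    have : Primrec fun t : ℕ × ℕ × ℕ => (stage e r m (t.1 + t.2.1 + t.2.2 + 1)).2 := by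
      refine Primrec.snd.comp ((primrec_stage pe pr pm).comp (Primrec.succ.comp ?_))
      exact Primrec.nat_add.comp (Primrec.nat_add.comp Primrec.fst
        (Primrec.fst.comp Primrec.snd)) (Primrec.snd.comp Primrec.snd)
    refine (primrecPred_bex this (P := fun t t' => t' = t)
      (Primrec.eq.comp Primrec.snd Primrec.fst)).of_eq fun t => by simp
  · intro x
    obtain ⟨q, hq, -, h2⟩ := hget (2 * x + 1)
    exact ⟨q.2, by rwa [show x = q.1 by rw [h2 (by omega)]; omega]⟩
  · intro a
    obtain ⟨q, hq, h1, -⟩ := hget (2 * a)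
    exact ⟨q.1, by rwa [show a = q.2 by rw [h1 (by omega)]; omega]⟩
  · intro x y a b hx hy
    obtain ⟨s, hs⟩ := hgood hx hy hy
    exact (hs s le_rfl (x, a) (by simp) (y, b) (by simp)).1
  · intro x y z a b c hx hy hz
    obtain ⟨s, hs⟩ := hgood hx hy hz
    have := (hs (max s (x + y + z + 1)) (le_max_left _ _) (x, a) (by simp) (y, b)
      (by simp)).2.2 (z, c) (by simp)
    rw [failures_stage (s₀ := x + y + z + 1) (by dsimp; omega) (by dsimp; omega) (by dsimp; omega)
      (le_max_right _ _)] at this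
    simp only [Set.mem_ofPred_eq, this, Bool.not_eq_false]

end Limit
end Tern

namespace Tern

/-! ### Codes of formulas and valuations -/

section Codes

/-- Pairing with a nonzero tag strictly increases the code; this gives termination of the recursion
on codes in `Sat`. -/
theorem unpair_snd_lt {m : ℕ} (h : m.unpair.1 ≠ 0) : m.unpair.2 < m := by
  have h1 := Nat.pair_lt_pair_left m.unpair.2 (Nat.pos_of_ne_zero h)
  have h2 := Nat.right_le_pair 0 m.unpair.2
  rw [Nat.pair_unpair] at h1
  omega

/-- Satisfaction of the formula with code `m` under the assignment `l`, with default value `d`. -/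
def Sat {M : Type} (S : M → M → M → Prop) (d : M) (m : ℕ) (l : List M) : Prop :=
  if _h0 : m.unpair.1 = 0 then False
  else if m.unpair.1 = 1 then
    l.getD m.unpair.2.unpair.1 d = l.getD m.unpair.2.unpair.2 d
  else if m.unpair.1 = 2 then
    S (l.getD m.unpair.2.unpair.1 d) (l.getD m.unpair.2.unpair.2.unpair.1 d)
      (l.getD m.unpair.2.unpair.2.unpair.2 d)
  else if m.unpair.1 = 3 then
    Sat S d m.unpair.2.unpair.1 l → Sat S d m.unpair.2.unpair.2 l
  else ∀ c, Sat S d m.unpair.2 (l ++ [c])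
termination_by m
decreasing_by
  · exact (Nat.unpair_left_le _).trans_lt (unpair_snd_lt _h0)
  · exact (Nat.unpair_right_le _).trans_lt (unpair_snd_lt _h0)
  · exact unpair_snd_lt _h0

/-- The index of the formula with code `m` under the assignment `l` of names. -/
def idx (m : ℕ) (l : List ℕ) : ℕ := Nat.pair m (Encodable.encode l)

/-- The assignment in an index. -/
def envOf (n : ℕ) : List ℕ := (Encodable.decode n.unpair.2).getD []

/-- The name of a counterexample to the universal formula with code `m`. -/
def witness (m : ℕ) (l : List ℕ) : ℕ := idx m l + 1

theorem unpair_idx (m : ℕ) (l : List ℕ) : (idx m l).unpair.1 = m := by simp [idx]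

theorem envOf_idx (m : ℕ) (l : List ℕ) : envOf (idx m l) = l := by simp [envOf, idx]

/-- A witness is numbered after all names in its formula, so that names can be interpreted by
well-founded recursion. -/
theorem lt_witness {m a : ℕ} {l : List ℕ} (h : a ∈ l) : a < witness m l := by
  have h1 : a ≤ Encodable.encode l := by
    induction l with
    | nil => simp at h
    | cons b l ih =>
      rw [Encodable.encode_list_cons]
      rcases List.mem_cons.1 h with rfl | h
      · exact (Nat.left_le_pair _ _).trans (Nat.le_succ _)
      · exact (ih h).trans ((Nat.right_le_pair _ _).trans (Nat.le_succ _))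
  exact Nat.lt_succ_of_le (h1.trans (Nat.right_le_pair _ _))

/-- The code of `x₀ = x₁`. -/
def eqCode : ℕ := Nat.pair 1 (Nat.pair 0 1)

/-- The code of `S(x₀, x₁, x₂)`. -/
def sCode : ℕ := Nat.pair 2 (Nat.pair 0 (Nat.pair 1 2))

/-- The code of `∀ x₂, S(x₀, x₁, x₂)`. -/
def memCode : ℕ := Nat.pair 4 sCode

/-- The conditions that a valuation respects the logical symbols. -/
def logicNogoods (m : ℕ) (l : List ℕ) (c : ℕ) : List (List (ℕ × Bool)) :=
  if m.unpair.1 = 0 then [[(idx m l, true)]]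
  else if m.unpair.1 = 1 then
    [[(idx m l, true),
      (idx eqCode [l.getD m.unpair.2.unpair.1 0, l.getD m.unpair.2.unpair.2 0], false)],
     [(idx m l, false),
      (idx eqCode [l.getD m.unpair.2.unpair.1 0, l.getD m.unpair.2.unpair.2 0], true)]]
  else if m.unpair.1 = 2 then
    [[(idx m l, true), (idx sCode [l.getD m.unpair.2.unpair.1 0,
      l.getD m.unpair.2.unpair.2.unpair.1 0, l.getD m.unpair.2.unpair.2.unpair.2 0], false)],
     [(idx m l, false), (idx sCode [l.getD m.unpair.2.unpair.1 0,
      l.getD m.unpair.2.unpair.2.unpair.1 0, l.getD m.unpair.2.unpair.2.unpair.2 0], true)]]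
  else if m.unpair.1 = 3 then
    [[(idx m l, true), (idx m.unpair.2.unpair.1 l, true), (idx m.unpair.2.unpair.2 l, false)],
     [(idx m l, false), (idx m.unpair.2.unpair.1 l, false)],
     [(idx m l, false), (idx m.unpair.2.unpair.2 l, true)]]
  else
    [[(idx m l, true), (idx m.unpair.2 (l ++ [c]), false)],
     [(idx m l, false), (idx m.unpair.2 (l ++ [witness m l]), true)]]

/-- The conditions that equality is a congruence. -/
def eqNogoods (l : List ℕ) : List (List (ℕ × Bool)) :=
  [[(idx eqCode [l.getD 0 0, l.getD 0 0], false)],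
   [(idx eqCode [l.getD 0 0, l.getD 1 0], true), (idx eqCode [l.getD 1 0, l.getD 0 0], false)],
   [(idx eqCode [l.getD 0 0, l.getD 1 0], true), (idx eqCode [l.getD 1 0, l.getD 2 0], true),
    (idx eqCode [l.getD 0 0, l.getD 2 0], false)],
   [(idx eqCode [l.getD 0 0, l.getD 1 0], true), (idx eqCode [l.getD 2 0, l.getD 3 0], true),
    (idx eqCode [l.getD 4 0, l.getD 5 0], true),
    (idx sCode [l.getD 0 0, l.getD 2 0, l.getD 4 0], true),
    (idx sCode [l.getD 1 0, l.getD 3 0, l.getD 5 0], false)]]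

/-- The conditions that the sentences with the codes enumerated by `C` are true. -/
def theoryNogoods (C : Nat.Partrec.Code) (m c : ℕ) : List (List (ℕ × Bool)) :=
  if (C.evaln c m).isSome then [[(idx m [], false)]] else []

/-- All conditions on a valuation. -/
def nogoods (C : Nat.Partrec.Code) (k : ℕ) : List (List (ℕ × Bool)) :=
  logicNogoods k.unpair.1.unpair.1 (envOf k.unpair.1) k.unpair.2 ++
    (eqNogoods (envOf k.unpair.1) ++ theoryNogoods C k.unpair.1.unpair.1 k.unpair.2)

theorem primrec_idx : Primrec₂ idx :=
  Primrec₂.natPair.comp Primrec.fst (Primrec.encode.comp Primrec.snd)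

theorem primrec_envOf : Primrec envOf :=
  Primrec.option_getD.comp (Primrec.decode.comp (Primrec.snd.comp Primrec.unpair)) (.const [])

section PrimrecLists

variable {α β : Type*} [Primcodable α] [Primcodable β] {f g h i j : α → β}

theorem primrec_list₁ (hf : Primrec f) : Primrec fun a => [f a] :=
  Primrec.list_cons.comp hf (.const [])

theorem primrec_list₂ (hf : Primrec f) (hg : Primrec g) : Primrec fun a => [f a, g a] :=
  Primrec.list_cons.comp hf (primrec_list₁ hg)

theorem primrec_list₃ (hf : Primrec f) (hg : Primrec g) (hh : Primrec h) :
    Primrec fun a => [f a, g a, h a] :=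
  Primrec.list_cons.comp hf (primrec_list₂ hg hh)

theorem primrec_list₄ (hf : Primrec f) (hg : Primrec g) (hh : Primrec h) (hi : Primrec i) :
    Primrec fun a => [f a, g a, h a, i a] :=
  Primrec.list_cons.comp hf (primrec_list₃ hg hh hi)

theorem primrec_list₅ (hf : Primrec f) (hg : Primrec g) (hh : Primrec h) (hi : Primrec i)
    (hj : Primrec j) : Primrec fun a => [f a, g a, h a, i a, j a] :=
  Primrec.list_cons.comp hf (primrec_list₄ hg hh hi hj)

end PrimrecLists

theorem primrec_logicNogoods :
    Primrec fun x : (ℕ × List ℕ) × ℕ => logicNogoods x.1.1 x.1.2 x.2 := by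
  have u1 : Primrec fun n : ℕ => n.unpair.1 := Primrec.fst.comp Primrec.unpair
  have u2 : Primrec fun n : ℕ => n.unpair.2 := Primrec.snd.comp Primrec.unpair
  have hm : Primrec fun x : (ℕ × List ℕ) × ℕ => x.1.1 := Primrec.fst.comp Primrec.fst
  have hl : Primrec fun x : (ℕ × List ℕ) × ℕ => x.1.2 := Primrec.snd.comp Primrec.fst
  have hc : Primrec fun x : (ℕ × List ℕ) × ℕ => x.2 := Primrec.snd
  have ht := u1.comp hm
  have hr := u2.comp hm
  have hn := primrec_idx.comp hm hl
  have hget : ∀ {f : (ℕ × List ℕ) × ℕ → ℕ}, Primrec f →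
      Primrec fun x : (ℕ × List ℕ) × ℕ => x.1.2.getD (f x) 0 :=
    fun hf => (Primrec.list_getD 0).comp hl hf
  have heq := primrec_idx.comp (.const eqCode) (primrec_list₂ (hget (u1.comp hr))
    (hget (u2.comp hr)))
  have hs := primrec_idx.comp (.const sCode) (primrec_list₃ (hget (u1.comp hr))
    (hget (u1.comp (u2.comp hr))) (hget (u2.comp (u2.comp hr))))
  have htag : ∀ k, PrimrecPred fun x : (ℕ × List ℕ) × ℕ => x.1.1.unpair.1 = k :=
    fun k => Primrec.eq.comp ht (.const k)
  refine Primrec.ite (htag 0) ?_ (Primrec.ite (htag 1) ?_ (Primrec.ite (htag 2) ?_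
    (Primrec.ite (htag 3) ?_ ?_)))
  · exact primrec_list₁ (primrec_list₁ (hn.pair (.const _)))
  · exact primrec_list₂ (primrec_list₂ (hn.pair (.const _)) (heq.pair (.const _)))
      (primrec_list₂ (hn.pair (.const _)) (heq.pair (.const _)))
  · exact primrec_list₂ (primrec_list₂ (hn.pair (.const _)) (hs.pair (.const _)))
      (primrec_list₂ (hn.pair (.const _)) (hs.pair (.const _)))
  · have h1 := primrec_idx.comp (u1.comp hr) hl
    have h2 := primrec_idx.comp (u2.comp hr) hl
    exact primrec_list₃ (primrec_list₃ (hn.pair (.const _)) (h1.pair (.const _))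
      (h2.pair (.const _))) (primrec_list₂ (hn.pair (.const _)) (h1.pair (.const _)))
      (primrec_list₂ (hn.pair (.const _)) (h2.pair (.const _)))
  · have h1 := primrec_idx.comp hr (Primrec.list_concat.comp hl hc)
    have h2 := primrec_idx.comp hr (Primrec.list_concat.comp hl (Primrec.succ.comp hn))
    exact primrec_list₂ (primrec_list₂ (hn.pair (.const _)) (h1.pair (.const _)))
      (primrec_list₂ (hn.pair (.const _)) (h2.pair (.const _)))

theorem primrec_eqNogoods : Primrec eqNogoods := by
  have hget : ∀ i, Primrec fun l : List ℕ => l.getD i 0 :=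
    fun i => (Primrec.list_getD 0).comp .id (.const i)
  have heq : ∀ (i j : ℕ) (b : Bool),
      Primrec fun l : List ℕ => (idx eqCode [l.getD i 0, l.getD j 0], b) :=
    fun i j b =>
      (primrec_idx.comp (.const eqCode) (primrec_list₂ (hget i) (hget j))).pair (.const b)
  have hs : ∀ (i j k : ℕ) (b : Bool),
      Primrec fun l : List ℕ => (idx sCode [l.getD i 0, l.getD j 0, l.getD k 0], b) :=
    fun i j k b =>
      (primrec_idx.comp (.const sCode) (primrec_list₃ (hget i) (hget j) (hget k))).pair (.const b)
  exact primrec_list₄ (primrec_list₁ (heq _ _ _)) (primrec_list₂ (heq _ _ _) (heq _ _ _))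
    (primrec_list₃ (heq _ _ _) (heq _ _ _) (heq _ _ _))
    (primrec_list₅ (heq _ _ _) (heq _ _ _) (heq _ _ _) (hs _ _ _ _) (hs _ _ _ _))

theorem primrec_theoryNogoods (C : Nat.Partrec.Code) : Primrec₂ (theoryNogoods C) := by
  refine Primrec.ite (Primrec.eq.comp (Primrec.option_isSome.comp ?_) (.const true)) ?_ (.const _)
  · exact Nat.Partrec.Code.primrec_evaln.comp ((Primrec.snd.pair (.const C)).pair Primrec.fst)
  · exact primrec_list₁ (primrec_list₁ ((primrec_idx.comp Primrec.fst (.const [])).pair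
      (.const _)))

theorem primrec_nogoods (C : Nat.Partrec.Code) : Primrec (nogoods C) := by
  have u1 : Primrec fun n : ℕ => n.unpair.1 := Primrec.fst.comp Primrec.unpair
  have u2 : Primrec fun n : ℕ => n.unpair.2 := Primrec.snd.comp Primrec.unpair
  have h1 := primrec_logicNogoods.comp (((u1.comp u1).pair (primrec_envOf.comp u1)).pair u2)
  have h2 := primrec_eqNogoods.comp (primrec_envOf.comp u1)
  have h3 := (primrec_theoryNogoods C).comp (u1.comp u1) u2
  exact (Primrec.list_append.comp h1 (Primrec.list_append.comp h2 h3)).of_eq fun _ => rfl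

/-- A valuation that respects the logical symbols. -/
structure IsValuation (v : ℕ → Bool) : Prop where
  bot : ∀ {m l}, m.unpair.1 = 0 → v (idx m l) = false
  eq : ∀ {m l}, m.unpair.1 = 1 → v (idx m l) =
    v (idx eqCode [l.getD m.unpair.2.unpair.1 0, l.getD m.unpair.2.unpair.2 0])
  rel : ∀ {m l}, m.unpair.1 = 2 → v (idx m l) = v (idx sCode [l.getD m.unpair.2.unpair.1 0,
    l.getD m.unpair.2.unpair.2.unpair.1 0, l.getD m.unpair.2.unpair.2.unpair.2 0])
  imp : ∀ {m l}, m.unpair.1 = 3 → (v (idx m l) = true ↔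
    (v (idx m.unpair.2.unpair.1 l) = true → v (idx m.unpair.2.unpair.2 l) = true))
  all : ∀ {m l}, m.unpair.1 = 4 → (v (idx m l) = true ↔
    ∀ c, v (idx m.unpair.2 (l ++ [c])) = true)
  eq_refl : ∀ a, v (idx eqCode [a, a]) = true
  eq_symm : ∀ {a b}, v (idx eqCode [a, b]) = true → v (idx eqCode [b, a]) = true
  eq_trans : ∀ {a b c}, v (idx eqCode [a, b]) = true → v (idx eqCode [b, c]) = true →
    v (idx eqCode [a, c]) = true
  congr : ∀ {a a' b b' c c'}, v (idx eqCode [a, a']) = true → v (idx eqCode [b, b']) = true →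
    v (idx eqCode [c, c']) = true → v (idx sCode [a, b, c]) = true →
    v (idx sCode [a', b', c']) = true

/-- Avoiding a forbidden assignment amounts to satisfying a clause, and every clause occurs at the
index pairing `idx m l` with `c`. The clauses are then regrouped into the laws of a valuation. -/
theorem isValuation_of_nogoods {C : Nat.Partrec.Code} {v : ℕ → Bool}
    (hv : ∀ k, ∀ G ∈ nogoods C k, ∃ l ∈ G, v l.1 ≠ l.2) :
    IsValuation v ∧ ∀ m c, (C.evaln c m).isSome → v (idx m []) = true := by
  have h1 : ∀ m l c, ∀ G ∈ logicNogoods m l c, ∃ l ∈ G, v l.1 ≠ l.2 := by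
    intro m l c G hG
    refine hv (Nat.pair (idx m l) c) G (List.mem_append_left _ ?_)
    simpa [unpair_idx, envOf_idx] using hG
  have h2 : ∀ l, ∀ G ∈ eqNogoods l, ∃ l ∈ G, v l.1 ≠ l.2 := by
    intro l G hG
    refine hv (Nat.pair (idx 0 l) 0) G (List.mem_append_right _ (List.mem_append_left _ ?_))
    simpa [unpair_idx, envOf_idx] using hG
  have h3 : ∀ m c, ∀ G ∈ theoryNogoods C m c, ∃ l ∈ G, v l.1 ≠ l.2 := by
    intro m c G hG
    refine hv (Nat.pair (idx m []) c) G (List.mem_append_right _ (List.mem_append_right _ ?_))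
    simpa [unpair_idx, envOf_idx] using hG
  refine ⟨⟨?_, ?_, ?_, ?_, ?_, ?_, ?_, ?_, ?_⟩, ?_⟩
  · intro m l hm
    have := h1 m l 0
    simpa [logicNogoods, hm] using this
  · intro m l hm
    have := h1 m l 0
    simp only [logicNogoods, hm, one_ne_zero, if_false, if_true, List.forall_mem_cons] at this
    obtain ⟨h1, h2, -⟩ := this
    simp only [List.exists_mem_cons_iff, List.not_mem_nil, false_and, exists_false, or_false]
      at h1 h2
    revert h1 h2
    cases v (idx m l) <;> simp +contextual
  · intro m l hm
    have := h1 m l 0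
    simp only [logicNogoods, hm, OfNat.ofNat_ne_zero, OfNat.ofNat_ne_one, if_false, if_true,
      List.forall_mem_cons] at this
    obtain ⟨h1, h2, -⟩ := this
    simp only [List.exists_mem_cons_iff, List.not_mem_nil, false_and, exists_false, or_false]
      at h1 h2
    revert h1 h2
    cases v (idx m l) <;> simp +contextual
  · intro m l hm
    have := h1 m l 0
    simp only [logicNogoods, hm, OfNat.ofNat_ne_zero, OfNat.ofNat_ne_one, Nat.reduceEqDiff,
      if_false, if_true, List.forall_mem_cons] at this
    obtain ⟨h1, h2, h3, -⟩ := this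
    simp only [List.exists_mem_cons_iff, List.not_mem_nil, false_and, exists_false, or_false]
      at h1 h2 h3
    revert h1 h2 h3
    cases v (idx m l) <;> cases v (idx m.unpair.2.unpair.1 l) <;> simp
  · intro m l hm
    have hnot : ∀ c, v (idx m l) = false ∨ v (idx m.unpair.2 (l ++ [c])) = true := by
      intro c
      have := (h1 m l c _ (by simp only [logicNogoods, hm]; exact List.mem_cons_self))
      simpa using this
    -- The designated witness replaces the infinitary direction of the quantifier law by a clause
    -- with two literals.
    have hwit : v (idx m l) = true ∨ v (idx m.unpair.2 (l ++ [witness m l])) = false := by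
      have := (h1 m l 0 _ (by
        simp only [logicNogoods, hm]; exact List.mem_cons_of_mem _ List.mem_cons_self))
      simpa using this
    constructor
    · intro h c
      simpa [h] using hnot c
    · intro h
      simpa [h] using hwit
  · intro a
    have := h2 [a]
    simp only [eqNogoods, List.forall_mem_cons] at this
    simpa using this.1
  · intro a b hab
    have := h2 [a, b]
    simp only [eqNogoods, List.forall_mem_cons] at this
    simpa [hab] using this.2.1
  · intro a b c hab hbc
    have := h2 [a, b, c]
    simp only [eqNogoods, List.forall_mem_cons] at this
    simpa [hab, hbc] using this.2.2.1
  · intro a a' b b' c c' ha hb hc hs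
    have := h2 [a, a', b, b', c, c']
    simp only [eqNogoods, List.forall_mem_cons] at this
    simpa [ha, hb, hc, hs] using this.2.2.2.1
  · intro m c h
    have := h3 m c
    simpa [theoryNogoods, h] using this

/-! ### Satisfiability of the conditions -/

section Names

variable {M : Type} (S : M → M → M → Prop) (d : M)

open Classical in
/-- A counterexample to the universal formula with code `m`, if there is one. -/
noncomputable def counterexample (m : ℕ) (l : List M) : M :=
  if h : ∃ c, ¬ Sat S d m.unpair.2 (l ++ [c]) then h.choose else d

/-- An interpretation of names under which `witness` names counterexamples. -/
noncomputable def nameVal : ℕ → M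
  | 0 => d
  | n + 1 => counterexample S d n.unpair.1
      ((envOf n).map fun a => if _h : a < n + 1 then nameVal a else d)

/-- The guard in the recursion only ensures termination; by `lt_witness` it is always met. -/
theorem nameVal_witness (m : ℕ) (l : List ℕ) :
    nameVal S d (witness m l) = counterexample S d m (l.map (nameVal S d)) := by
  rw [witness, nameVal, unpair_idx, envOf_idx]
  congr 1
  refine List.map_congr_left fun a ha => ?_
  exact dif_pos (lt_witness (m := m) ha)

/-- Truth in the given structure, with names read through `nameVal`, violates no condition. Only the
witness clause depends on the choice of the interpretation. -/
theorem exists_avoids_nogoods (C : Nat.Partrec.Code)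
    (hC : ∀ m c, (C.evaln c m).isSome → Sat S d m []) :
    ∃ v : ℕ → Bool, ∀ k, ∀ G ∈ nogoods C k, ∃ l ∈ G, v l.1 ≠ l.2 := by
  classical
  let ρ := nameVal S d
  -- The default name `0` denotes the default element, so lookups beyond the end of an assignment
  -- agree on both sides.
  have hρ0 : ρ 0 = d := by simp [ρ, nameVal]
  let v : ℕ → Bool := fun n => decide (Sat S d n.unpair.1 ((envOf n).map ρ))
  have hv : ∀ m l, v (idx m l) = decide (Sat S d m (l.map ρ)) := by
    intro m l
    simp only [v, unpair_idx, envOf_idx]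
  have hget : ∀ (l : List ℕ) i, (l.map ρ).getD i d = ρ (l.getD i 0) := by
    intro l i
    rw [← hρ0, List.getD_map]
  have heq : ∀ a b, v (idx eqCode [a, b]) = decide (ρ a = ρ b) := by
    intro a b
    rw [hv, Sat]
    simp [eqCode]
  have hs : ∀ a b c, v (idx sCode [a, b, c]) = decide (S (ρ a) (ρ b) (ρ c)) := by
    intro a b c
    rw [hv, Sat]
    simp [sCode]
  refine ⟨v, fun k G hG => ?_⟩
  simp only [nogoods, List.mem_append] at hG
  generalize k.unpair.1.unpair.1 = m at hG
  generalize envOf k.unpair.1 = l at hG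
  generalize k.unpair.2 = c at hG
  rcases hG with hG | hG | hG
  · have hm := hv m l
    rw [Sat] at hm
    unfold logicNogoods at hG
    split_ifs at hG with h0 h1 h2 h3
    · rw [dif_pos h0] at hm
      simp only [List.mem_singleton] at hG
      subst hG
      simp [hm]
    · rw [dif_neg h0, if_pos h1, hget, hget, ← heq] at hm
      simp only [List.mem_cons, List.not_mem_nil, or_false] at hG
      rcases hG with rfl | rfl
      · simp [hm]
      · simp [hm]
    · rw [dif_neg h0, if_neg h1, if_pos h2, hget, hget, hget, ← hs] at hm
      simp only [List.mem_cons, List.not_mem_nil, or_false] at hG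
      rcases hG with rfl | rfl
      · simp [hm]
      · simp [hm]
    · rw [dif_neg h0, if_neg h1, if_neg h2, if_pos h3] at hm
      have g1 := hv m.unpair.2.unpair.1 l
      have g2 := hv m.unpair.2.unpair.2 l
      simp only [List.mem_cons, List.not_mem_nil, or_false] at hG
      rcases hG with rfl | rfl | rfl
      · simp only [List.exists_mem_cons_iff, hm, g1, g2]
        simp
        tauto
      · simp only [List.exists_mem_cons_iff, hm, g1]
        simp
        tauto
      · simp only [List.exists_mem_cons_iff, hm, g2]
        simp
        tauto
    · rw [dif_neg h0, if_neg h1, if_neg h2, if_neg h3] at hm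
      simp only [List.mem_cons, List.not_mem_nil, or_false] at hG
      rcases hG with rfl | rfl
      · have g1 := hv m.unpair.2 (l ++ [c])
        simp only [List.exists_mem_cons_iff, hm, g1]
        by_cases h : ∀ c, Sat S d m.unpair.2 (l.map ρ ++ [c])
        · simp [h]
        · simp [h]
      · have g1 := hv m.unpair.2 (l ++ [witness m l])
        simp only [List.exists_mem_cons_iff, hm, g1]
        by_cases h : ∀ c, Sat S d m.unpair.2 (l.map ρ ++ [c])
        · simp [h]
        · push Not at h
          have : ¬ Sat S d m.unpair.2 (l.map ρ ++ [ρ (witness m l)]) := by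
            have h' : ρ (witness m l) = h.choose := by
              simp only [ρ]
              rw [nameVal_witness, counterexample, dif_pos h]
            rw [h']
            exact h.choose_spec
          simp [this]
  · simp only [eqNogoods, List.mem_cons, List.not_mem_nil, or_false] at hG
    rcases hG with rfl | rfl | rfl | rfl
    · simp [heq]
    · simp only [List.exists_mem_cons_iff, heq]
      simp
      tauto
    · simp only [List.exists_mem_cons_iff, heq]
      simp
      by_cases h1 : ρ (l[0]?.getD 0) = ρ (l[1]?.getD 0)
      · rw [h1]; tauto
      · exact .inl h1
    · simp only [List.exists_mem_cons_iff, heq, hs]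
      simp
      by_cases h1 : ρ (l[0]?.getD 0) = ρ (l[1]?.getD 0)
      · by_cases h2 : ρ (l[2]?.getD 0) = ρ (l[3]?.getD 0)
        · by_cases h3 : ρ (l[4]?.getD 0) = ρ (l[5]?.getD 0)
          · rw [h1, h2, h3]; tauto
          · exact .inr (.inr (.inl h3))
        · exact .inr (.inl h2)
      · exact .inl h1
  · unfold theoryNogoods at hG
    split_ifs at hG with h
    · simp only [List.mem_singleton] at hG
      subst hG
      simp [hv, hC m c h]
    · simp at hG

end Names

end Codes
end Tern

namespace Tern
open FirstOrder FirstOrder.Language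

/-! ### Structures from valuations -/

section Models

/-- The relation `S` in a structure. -/
def RelS {N : Type} [LS.Structure N] (a b c : N) : Prop := Structure.RelMap sSym ![a, b, c]

/-- The membership relation defined from `S`. -/
def MemS {N : Type} [LS.Structure N] (a b : N) : Prop := ∀ c, RelS a b c

/-- Every pattern of `S` for one new element that does not contradict membership between the given
finitely many elements is realized by an element that is unrelated to them by membership. -/
def HasNeutralExtensions (N : Type) [LS.Structure N] : Prop :=
  ∀ (ι : Type) [Finite ι] (a : ι → N) (P : Option ι → Option ι → Option ι → Prop),
    Function.Injective a → (∀ i j k, P (some i) (some j) (some k) ↔ RelS (a i) (a j) (a k)) →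
    (∀ i j, MemS (a i) (a j) → P (some i) (some j) none) →
    ∃ b, (∀ i, a i ≠ b ∧ ¬ MemS (a i) b ∧ ¬ MemS b (a i)) ∧ ¬ MemS b b ∧
      ∀ i j k, P i j k ↔ RelS (i.elim b a) (j.elim b a) (k.elim b a)

theorem rel_eq_relS {N : Type} [LS.Structure N] (x : Fin 3 → N) :
    Structure.RelMap sSym x ↔ RelS (x 0) (x 1) (x 2) := by
  unfold RelS
  congr! 1
  funext i
  fin_cases i <;> rfl

theorem realize_varNum {N : Type} [LS.Structure N] {d : ℕ} (t : LS.Term (Empty ⊕ Fin d)) :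
    ∃ i : Fin d, varNum t = i ∧
      ∀ xs : Fin d → N, t.realize (Sum.elim (default : Empty → N) xs) = xs i := by
  rcases t with (x | i) | ⟨f, _⟩
  · exact x.elim
  · exact ⟨i, rfl, fun _ => rfl⟩
  · exact Empty.elim f

theorem snoc_eq_getD {N : Type} {P : N → N → Prop} {d : ℕ} {xs : Fin d → N} {a b c : N}
    {l : List N} (hlen : l.length = d) (h : ∀ i, P (xs i) (l.getD i c)) (hab : P a b)
    (i : Fin (d + 1)) : P (Fin.snoc (α := fun _ => N) xs a i) ((l ++ [b]).getD i c) := by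
  subst hlen
  induction i using Fin.lastCases with
  | last => simpa using hab
  | cast i => simpa using h i

theorem realize_iff_sat {N : Type} [LS.Structure N] (z : N) {d : ℕ}
    (φ : LS.BoundedFormula Empty d) (xs : Fin d → N) (l : List N) (hlen : l.length = d)
    (hl : ∀ i, xs i = l.getD i z) :
    φ.Realize default xs ↔ Sat RelS z (godelNum φ) l := by
  induction φ generalizing l with
  | falsum =>
    rw [godelNum, Sat]
    simp [BoundedFormula.Realize]
  | equal t u =>
    obtain ⟨i, hi, hi'⟩ := realize_varNum (N := N) t
    obtain ⟨j, hj, hj'⟩ := realize_varNum (N := N) u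
    rw [godelNum, Sat]
    simp only [BoundedFormula.Realize, hi, hj, hi', hj', Nat.unpair_pair, hl]
    simp
  | rel R ts =>
    cases R
    choose i hi hi' using fun k => realize_varNum (N := N) (ts k)
    rw [godelNum, Sat]
    have := rel_eq_relS fun k => (ts k).realize (Sum.elim (default : Empty → N) xs)
    refine Iff.trans this ?_
    simp only [hi, hi', Nat.unpair_pair, hl]
    simp
  | imp φ ψ ih1 ih2 =>
    rw [godelNum, Sat]
    simp only [BoundedFormula.realize_imp, ih1 xs l hlen hl, ih2 xs l hlen hl, Nat.unpair_pair]
    simp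
  | all φ ih =>
    rw [godelNum, Sat]
    simp only [BoundedFormula.realize_all, Nat.unpair_pair]
    simp only [OfNat.ofNat_ne_zero, OfNat.ofNat_ne_one, Nat.reduceEqDiff, dite_false, if_false]
    exact forall_congr' fun c => ih _ (l ++ [c]) (by simp [hlen])
      (snoc_eq_getD (P := Eq) hlen hl rfl)

/-- A relation that is total on both sides takes the place of a naming function. The lemma is
applied to the quotient of the names and again to the computable copy, where the correspondence
exists only as a limit. -/
theorem realize_iff_valuation {N : Type} [LS.Structure N] {v : ℕ → Bool} (hv : IsValuation v)
    {G : N → ℕ → Prop} (hG₁ : ∀ x, ∃ a, G x a) (hG₂ : ∀ a, ∃ x, G x a)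
    (hE : ∀ {x y a b}, G x a → G y b → (x = y ↔ v (idx eqCode [a, b]) = true))
    (hS : ∀ {x y z a b c}, G x a → G y b → G z c →
      (RelS x y z ↔ v (idx sCode [a, b, c]) = true)) {d : ℕ}
    (φ : LS.BoundedFormula Empty d) (xs : Fin d → N) (l : List ℕ) (hlen : l.length = d)
    (hl : ∀ i, G (xs i) (l.getD i 0)) :
    φ.Realize default xs ↔ v (idx (godelNum φ) l) = true := by
  induction φ generalizing l with
  | falsum =>
    rw [godelNum, hv.bot (by simp)]
    simp [BoundedFormula.Realize]
  | equal t u =>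
    obtain ⟨i, hi, hi'⟩ := realize_varNum (N := N) t
    obtain ⟨j, hj, hj'⟩ := realize_varNum (N := N) u
    rw [godelNum, hv.eq (by simp)]
    simp only [BoundedFormula.Realize, hi, hj, hi', hj', Nat.unpair_pair]
    exact hE (hl i) (hl j)
  | rel R ts =>
    cases R
    choose i hi hi' using fun k => realize_varNum (N := N) (ts k)
    rw [godelNum, hv.rel (by simp)]
    have := rel_eq_relS fun k => (ts k).realize (Sum.elim (default : Empty → N) xs)
    refine Iff.trans this ?_
    simp only [hi, hi', Nat.unpair_pair]
    exact hS (hl _) (hl _) (hl _)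
  | imp φ ψ ih1 ih2 =>
    rw [godelNum, hv.imp (by simp)]
    simp only [BoundedFormula.realize_imp, ih1 xs l hlen hl, ih2 xs l hlen hl, Nat.unpair_pair]
  | @all d φ ih =>
    rw [godelNum, hv.all (by simp)]
    simp only [BoundedFormula.realize_all, Nat.unpair_pair]
    have key : ∀ {x a}, G x a → (φ.Realize default (Fin.snoc xs x) ↔
        v (idx (godelNum φ) (l ++ [a])) = true) := by
      intro x a hxa
      refine ih _ (l ++ [a]) (by simp [hlen]) fun i => ?_
      subst hlen
      induction i using Fin.lastCases with
      | last => simpa using hxa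
      | cast i => simpa using hl i
    constructor
    · intro h a
      obtain ⟨x, hx⟩ := hG₂ a
      exact (key hx).1 (h x)
    · intro h x
      obtain ⟨a, ha⟩ := hG₁ x
      exact (key ha).2 (h a)

/-! ### The model whose elements are the names -/

section Quotient

variable {v : ℕ → Bool}

namespace IsValuation

/-- Equality of names. -/
def setoid (hv : IsValuation v) : Setoid ℕ where
  r a b := v (idx eqCode [a, b]) = true
  iseqv := ⟨hv.eq_refl, hv.eq_symm, hv.eq_trans⟩

/-- The structure whose elements are the names. -/
@[reducible]
noncomputable def nameModel (hv : IsValuation v) : LS.Structure (Quotient hv.setoid) where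
  funMap f := Empty.elim f
  RelMap
    | SRel.s => fun a => v (idx sCode [(a 0).out, (a 1).out, (a 2).out]) = true

theorem relS_mk (hv : IsValuation v) (a b c : ℕ) :
    @RelS _ hv.nameModel (Quotient.mk hv.setoid a) (Quotient.mk hv.setoid b)
      (Quotient.mk hv.setoid c) ↔ v (idx sCode [a, b, c]) = true := by
  have hout : ∀ a, v (idx eqCode [(Quotient.mk hv.setoid a).out, a]) = true :=
    fun a => Quotient.exact (s := hv.setoid) (Quotient.out_eq _)
  exact ⟨fun h => hv.congr (hout a) (hout b) (hout c) h, fun h => hv.congr (hv.eq_symm (hout a))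
    (hv.eq_symm (hout b)) (hv.eq_symm (hout c)) h⟩

theorem nameModel_realize (hv : IsValuation v) (σ : LS.Sentence) :
    @Sentence.Realize LS _ hv.nameModel σ ↔ v (idx (godelNum σ) []) = true := by
  let _ := hv.nameModel
  have := realize_iff_valuation hv (G := fun x a => x = Quotient.mk hv.setoid a)
    (fun x => ⟨x.out, (Quotient.out_eq x).symm⟩) (fun a => ⟨_, rfl⟩)
    (by rintro x y a b rfl rfl; exact Quotient.eq (r := hv.setoid))
    (by rintro x y z a b c rfl rfl rfl; exact relS_mk hv a b c) σ default []
    rfl (fun i => i.elim0)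
  rw [Sentence.Realize, Formula.Realize]
  convert this

theorem mem_iff (hv : IsValuation v) (a b : ℕ) : v (idx memCode [a, b]) = true ↔
    ∀ c, v (idx sCode [a, b, c]) = true := by
  rw [hv.all (by simp [memCode])]
  simp [memCode]

theorem memS_mk (hv : IsValuation v) (a b : ℕ) :
    @MemS _ hv.nameModel (Quotient.mk hv.setoid a) (Quotient.mk hv.setoid b) ↔
      v (idx memCode [a, b]) = true := by
  let _ := hv.nameModel
  rw [mem_iff hv]
  constructor
  · intro h c
    exact (relS_mk hv a b c).1 (h _)
  · intro h c
    induction c using Quotient.inductionOn with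
    | h c => exact (relS_mk hv a b c).2 (h c)

/-- Except for `extend`, the clauses are laws of the valuation; `extend` is the neutral extension
property of the quotient, read on representatives. -/
theorem isExtensible (hv : IsValuation v) (h : @HasNeutralExtensions _ hv.nameModel) :
    IsExtensible (fun p => v (idx eqCode [p.1, p.2]))
      (fun p => v (idx sCode [p.1, p.2.1, p.2.2])) (fun p => v (idx memCode [p.1, p.2])) where
  refl := hv.eq_refl
  symm := hv.eq_symm
  trans := hv.eq_trans
  congr_S ha hb hc := by
    rw [Bool.eq_iff_iff]
    exact ⟨hv.congr ha hb hc, hv.congr (hv.eq_symm ha) (hv.eq_symm hb) (hv.eq_symm hc)⟩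
  congr_M {a a' b b'} ha hb := by
    have h1 : Quotient.mk hv.setoid a = Quotient.mk hv.setoid a' := Quotient.sound ha
    have h2 : Quotient.mk hv.setoid b = Quotient.mk hv.setoid b' := Quotient.sound hb
    rw [Bool.eq_iff_iff, ← memS_mk hv, ← memS_mk hv, h1, h2]
  S_of_M h c := (mem_iff hv _ _).1 h c
  extend := by
    let _ := hv.nameModel
    intro L x P hinj hx hP hM
    -- The list may match one element with several equal names. Indexing by elements and choosing
    -- one name for each makes the family injective.
    let ι : Type := {y // y ∈ L.map Prod.fst}
    choose f hfL hf using fun i : ι => List.mem_map.1 i.2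
    have hfE : ∀ p (hp : p ∈ L), Quotient.mk hv.setoid
        (f ⟨p.1, List.mem_map_of_mem hp⟩).2 = Quotient.mk hv.setoid p.2 := by
      intro p hp
      exact Quotient.sound ((hinj _ (hfL _) p hp).1 (hf _))
    have hfin : Finite ι := List.finite_toSet (L.map Prod.fst)
    obtain ⟨b, hb1, hb2, hb3⟩ := h ι (fun i => Quotient.mk hv.setoid (f i).2)
      (fun i j k => P (i.elim x Subtype.val, j.elim x Subtype.val, k.elim x Subtype.val) = true)
      (fun i j hij => Subtype.ext (by
        rw [← hf i, ← hf j]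
        exact (hinj _ (hfL i) _ (hfL j)).2 (Quotient.exact hij)))
      (fun i j k => by
        rw [relS_mk]
        simp only [Option.elim]
        rw [← hP _ (hfL i) _ (hfL j) _ (hfL k), hf, hf, hf])
      (fun i j hij => by
        have := hM _ (hfL i) _ (hfL j) ((memS_mk hv _ _).1 hij)
        rwa [hf, hf] at this)
    induction b using Quotient.inductionOn with
    | h b =>
      refine ⟨b, fun p hp => ?_, ?_, ?_⟩
      · have := hb1 ⟨p.1, List.mem_map_of_mem hp⟩
        rw [hfE p hp, memS_mk, memS_mk] at this
        obtain ⟨h1, h2, h3⟩ := this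
        refine ⟨?_, by simpa using h2, by simpa using h3⟩
        by_contra hne
        exact h1 (Quotient.sound (s := hv.setoid) (Bool.not_eq_false _ ▸ hne :
          v (idx eqCode [p.2, b]) = true))
      · rw [memS_mk] at hb2
        simpa using hb2
      · have key : ∀ p ∈ L ++ [(x, b)], ∃ o : Option ι, o.elim x Subtype.val = p.1 ∧
            o.elim (Quotient.mk hv.setoid b) (fun i => Quotient.mk hv.setoid (f i).2) =
              Quotient.mk hv.setoid p.2 := by
          intro p hp
          rcases List.mem_append.1 hp with hp | hp
          · exact ⟨some ⟨p.1, List.mem_map_of_mem hp⟩, rfl, hfE p hp⟩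
          · rw [List.mem_singleton.1 hp]
            exact ⟨none, rfl, rfl⟩
        intro p hp q hq u hu
        obtain ⟨o, ho, ho'⟩ := key p hp
        obtain ⟨o₁, ho₁, ho₁'⟩ := key q hq
        obtain ⟨o₂, ho₂, ho₂'⟩ := key u hu
        have := hb3 o o₁ o₂
        rw [ho, ho₁, ho₂, ho', ho₁', ho₂', relS_mk] at this
        rw [Bool.eq_iff_iff]
        exact this

end IsValuation

end Quotient

/-- A satisfiable computably enumerable theory all of whose models have neutral extensions has a
computable model. -/
theorem hasComputableModel_of_extensions {T : LS.Theory} (hce : IsCE T)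
    (hmodel : ∃ (M : Type) (_ : LS.Structure M) (_ : Nonempty M), M ⊨ T)
    (hext : ∀ (M : Type) [LS.Structure M] [Nonempty M], M ⊨ T → HasNeutralExtensions M) :
    HasComputableModel T := by
  obtain ⟨M, _, ⟨z⟩, hM⟩ := hmodel
  obtain ⟨C, hC⟩ : ∃ C : Nat.Partrec.Code, ∀ m,
      (∃ σ ∈ T, godelNum σ = m) ↔ ∃ c, (C.evaln c m).isSome := by
    -- The program `C` halts exactly on the Gödel numbers of `T`; bounding its running time by `c`
    -- turns enumeration into a primitive recursive test.
    obtain ⟨C, hC⟩ := Nat.Partrec.Code.exists_code.1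
      (Partrec.nat_iff.1 (hce.map (Computable.const 0).to₂))
    refine ⟨C, fun m => ?_⟩
    have h1 : (∃ σ ∈ T, godelNum σ = m) ↔ ∃ x, x ∈ C.eval m := by
      rw [hC]
      simp [Part.mem_map_iff, Part.mem_assert_iff]
    rw [h1]
    simp only [Nat.Partrec.Code.evaln_complete, Option.isSome_iff_exists, Option.mem_def]
    exact exists_comm
  have havoid : ∃ v : ℕ → Bool, ∀ k, ∀ G ∈ nogoods C k, ∃ l ∈ G, v l.1 ≠ l.2 := by
    refine exists_avoids_nogoods RelS z C fun m c hmc => ?_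
    obtain ⟨σ, hσ, rfl⟩ := (hC m).2 ⟨c, hmc⟩
    exact (realize_iff_sat z σ default [] rfl fun i => i.elim0).1 (hM.realize_of_mem σ hσ)
  obtain ⟨g, v, pg, hlim, hv'⟩ := exists_limit_assignment (primrec_nogoods C) havoid
  obtain ⟨hv, hvT⟩ := isValuation_of_nogoods hv'
  have hT : ∀ σ ∈ T, v (idx (godelNum σ) []) = true := by
    intro σ hσ
    obtain ⟨c, hc⟩ := (hC _).1 ⟨σ, hσ, rfl⟩
    exact hvT _ c hc
  -- The model of names is again a model of `T`, but only a limit computable one; neutral extensions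
  -- are what it needs to have a computable copy.
  have hne : @HasNeutralExtensions _ hv.nameModel :=
    @hext (Quotient hv.setoid) hv.nameModel ⟨Quotient.mk _ 0⟩
      (@Theory.Model.mk LS _ hv.nameModel T
        fun σ hσ => (hv.nameModel_realize σ).2 (hT σ hσ))
  have pidx : ∀ (m : ℕ) {f : ℕ × ℕ → List ℕ}, Primrec f →
      Primrec₂ fun (s : ℕ) (p : ℕ × ℕ) => g s (idx m (f p)) := fun m f hf =>
    pg.comp Primrec.fst (primrec_idx.comp (.const m) (hf.comp Primrec.snd))
  have hpair : Primrec fun p : ℕ × ℕ => [p.1, p.2] := primrec_list₂ Primrec.fst Primrec.snd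
  have ptriple : Primrec₂ fun (s : ℕ) (p : ℕ × ℕ × ℕ) => g s (idx sCode [p.1, p.2.1, p.2.2]) :=
    pg.comp Primrec.fst (primrec_idx.comp (.const _) ((primrec_list₃ Primrec.fst
      (Primrec.fst.comp Primrec.snd) (Primrec.snd.comp Primrec.snd)).comp Primrec.snd))
  obtain ⟨R, G, hR, hG₁, hG₂, hGE, hGS⟩ := (hv.isExtensible hne).exists_computable_copy
    (pidx eqCode hpair) ptriple (pidx memCode hpair)
    (fun _ => hlim _) (fun _ => hlim _) (fun _ => hlim _)
  refine ⟨Set.univ, R, Set.univ_nonempty, fun _ _ => by simp, ?_, hR, ?_⟩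
  · exact PrimrecPred.computablePred
      ((Primrec.eq.comp (.const 0) (.const 0)).of_eq fun _ => by simp)
  · let _ := structOn Set.univ R
    refine ⟨fun σ hσ => ?_⟩
    refine (realize_iff_valuation (N := (Set.univ : Set ℕ)) hv (G := fun x a => G x a)
      (fun x => hG₁ x) (fun a => ?_) ?_ ?_ σ default [] rfl fun i => i.elim0).2 (hT σ hσ)
    · obtain ⟨x, hx⟩ := hG₂ a
      exact ⟨⟨x, trivial⟩, hx⟩
    · intro x y a b hx hy
      exact Subtype.ext_iff.trans (hGE hx hy)
    · intro x y z a b c hx hy hz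
      exact hGS hx hy hz

end Models
end Tern

namespace Tern
open FirstOrder FirstOrder.Language

/-! ### The sentences expressing neutral extensions -/

section Sentences

instance : LS.IsRelational := fun _ => inferInstanceAs (IsEmpty Empty)
instance : LMem.IsRelational := fun _ => inferInstanceAs (IsEmpty Empty)
instance : (LMem.sum LS).IsRelational := inferInstance

instance : Countable (Σ n, LS.Relations n) := by
  refine Function.Injective.countable (f := fun _ => (0 : ℕ)) ?_
  rintro ⟨_, ⟨⟩⟩ ⟨_, ⟨⟩⟩ _
  rfl

instance : Countable (Σ n, LMem.Relations n) := by
  refine Function.Injective.countable (f := fun _ => (0 : ℕ)) ?_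
  rintro ⟨_, ⟨⟩⟩ ⟨_, ⟨⟩⟩ _
  rfl

instance : Countable LS.Symbols :=
  have : IsEmpty (Σ n, LS.Functions n) := ⟨fun f => Empty.elim f.2⟩
  inferInstanceAs (Countable ((Σ n, LS.Functions n) ⊕ (Σ n, LS.Relations n)))

instance : Countable (LMem.sum LS).Symbols := by
  rw [← Cardinal.mk_le_aleph0_iff]
  change (LMem.sum LS).card ≤ _
  rw [card_sum]
  simp [Language.card, -Cardinal.mk_sigma]

/-- The formula `S(x, y, z)`. -/
def formulaS {α : Type} (x y z : α) : LS.Formula α :=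
  sSym.formula ![.var x, .var y, .var z]

/-- The formula `∀ z, S(x, y, z)`. -/
def formulaMem {α : Type} (x y : α) : LS.Formula α :=
  (sSym.boundedFormula ![.var (.inl x), .var (.inl y), .var (.inr 0)]).all

variable {N : Type} [LS.Structure N]

theorem realize_formulaS {α : Type} (x y z : α) (v : α → N) :
    (formulaS x y z).Realize v ↔ RelS (v x) (v y) (v z) := by
  rw [formulaS, Formula.realize_rel, rel_eq_relS]
  rfl

theorem realize_formulaMem {α : Type} (x y : α) (v : α → N) :
    (formulaMem x y).Realize v ↔ MemS (v x) (v y) := by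
  rw [formulaMem, Formula.Realize, BoundedFormula.realize_all]
  refine forall_congr' fun c => ?_
  rw [BoundedFormula.realize_rel, rel_eq_relS]
  rfl

open Classical in
/-- The formula saying that `S` agrees with the pattern `P`. -/
noncomputable def patternFormula {α : Type} [Finite α] (P : α → α → α → Prop) : LS.Formula α :=
  Formula.iInf fun t : α × α × α =>
    if P t.1 t.2.1 t.2.2 then formulaS t.1 t.2.1 t.2.2 else (formulaS t.1 t.2.1 t.2.2).not

theorem realize_patternFormula {α : Type} [Finite α] (P : α → α → α → Prop) (v : α → N) :
    (patternFormula P).Realize v ↔ ∀ i j k, P i j k ↔ RelS (v i) (v j) (v k) := by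
  rw [patternFormula, Formula.realize_iInf, Prod.forall]
  refine forall_congr' fun i => Prod.forall.trans (forall₂_congr fun j k => ?_)
  by_cases h : P i j k
  · simp [h, realize_formulaS]
  · simp [h, realize_formulaS, Formula.realize_not]

/-- The hypothesis on the given elements. -/
noncomputable def neutralPremise {ι : Type} [Finite ι]
    (P : Option ι → Option ι → Option ι → Prop) : LS.Formula ι :=
  (Formula.iInf fun t : {t : ι × ι // t.1 ≠ t.2} =>
      (Term.equal (.var t.1.1) (.var t.1.2) : LS.Formula ι).not) ⊓
    ((patternFormula fun i j k => P (some i) (some j) (some k)) ⊓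
      Formula.iInf fun t : {t : ι × ι // ¬ P (some t.1) (some t.2) none} =>
        (formulaMem t.1.1 t.1.2).not)

/-- The conclusion on the new element. -/
noncomputable def neutralConclusion {ι : Type} [Finite ι]
    (P : Option ι → Option ι → Option ι → Prop) : LS.Formula (Option ι) :=
  (Formula.iInf fun i : ι => ((Term.equal (.var (some i)) (.var none) : LS.Formula _).not ⊓
      ((formulaMem (some i) none).not ⊓ (formulaMem none (some i)).not))) ⊓
    ((formulaMem none none).not ⊓ patternFormula P)

/-- The sentence saying that the pattern `P` has neutral extensions. -/
noncomputable def neutralSentence {ι : Type} [Finite ι]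
    (P : Option ι → Option ι → Option ι → Prop) : LS.Sentence :=
  Formula.iAlls ι (((neutralPremise P).imp (Formula.iExs Unit
    ((neutralConclusion P).relabel fun o : Option ι => o.elim (.inr ()) .inl))).relabel
      (Sum.inr : ι → Empty ⊕ ι))

theorem realize_neutralPremise {ι : Type} [Finite ι]
    (P : Option ι → Option ι → Option ι → Prop) (a : ι → N) :
    (neutralPremise P).Realize a ↔ Function.Injective a ∧
      (∀ i j k, P (some i) (some j) (some k) ↔ RelS (a i) (a j) (a k)) ∧
      (∀ i j, MemS (a i) (a j) → P (some i) (some j) none) := by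
  rw [neutralPremise, Formula.realize_inf, Formula.realize_inf, Formula.realize_iInf,
    realize_patternFormula, Formula.realize_iInf]
  refine and_congr ?_ (and_congr_right' ?_)
  · simp only [Formula.realize_not, Formula.realize_equal, Term.realize_var, Subtype.forall,
      Prod.forall]
    exact forall₂_congr fun i j => not_imp_not
  · simp only [Formula.realize_not, realize_formulaMem, Subtype.forall, Prod.forall]
    exact forall₂_congr fun i j => not_imp_not

theorem realize_neutralConclusion {ι : Type} [Finite ι]
    (P : Option ι → Option ι → Option ι → Prop) (a : Option ι → N) :
    (neutralConclusion P).Realize a ↔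
      (∀ i, a (some i) ≠ a none ∧ ¬ MemS (a (some i)) (a none) ∧
        ¬ MemS (a none) (a (some i))) ∧ ¬ MemS (a none) (a none) ∧
      ∀ i j k, P i j k ↔ RelS (a i) (a j) (a k) := by
  rw [neutralConclusion, Formula.realize_inf, Formula.realize_inf, Formula.realize_iInf,
    realize_patternFormula]
  simp only [Formula.realize_inf, Formula.realize_not, Formula.realize_equal, Term.realize_var,
    realize_formulaMem, ne_eq]

theorem realize_neutralSentence {ι : Type} [Finite ι]
    (P : Option ι → Option ι → Option ι → Prop) :
    N ⊨ neutralSentence P ↔ ∀ a : ι → N, Function.Injective a →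
      (∀ i j k, P (some i) (some j) (some k) ↔ RelS (a i) (a j) (a k)) →
      (∀ i j, MemS (a i) (a j) → P (some i) (some j) none) →
      ∃ b, (∀ i, a i ≠ b ∧ ¬ MemS (a i) b ∧ ¬ MemS b (a i)) ∧ ¬ MemS b b ∧
        ∀ i j k, P i j k ↔ RelS (i.elim b a) (j.elim b a) (k.elim b a) := by
  rw [neutralSentence, Sentence.Realize, Formula.realize_iAlls]
  refine forall_congr' fun a => ?_
  rw [Formula.realize_relabel, Formula.realize_imp, Formula.realize_iExs]
  have : (fun x => Sum.elim (default : Empty → N) a x) ∘ Sum.inr = a := rfl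
  rw [this, realize_neutralPremise, and_imp, and_imp]
  refine imp_congr_right fun _ => imp_congr_right fun _ => imp_congr_right fun _ => ?_
  rw [(Equiv.funUnique Unit N).exists_congr_left]
  refine exists_congr fun b => ?_
  rw [Formula.realize_relabel, realize_neutralConclusion]
  have : (Sum.elim a ((Equiv.funUnique Unit N).symm b) ∘
      fun o : Option ι => o.elim (.inr ()) .inl) = fun o => o.elim b a := by
    funext o
    cases o <;> rfl
  rw [this]
  rfl

/-- Each pattern is fixed outside the structure, so the property splits into single sentences. Such
a sentence enters `T₀` by completeness for `T₁`, and returns to models of `T` by soundness. -/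
theorem hasNeutralExtensions_of_proves {T : LS.Theory} (hT : ∀ σ ∈ T₀, Proves T σ)
    (h : ∀ (M : Type) [(LMem.sum LS).Structure M] [Nonempty M], M ⊨ T₁ →
      @HasNeutralExtensions M ((LHom.sumInr : LS →ᴸ LMem.sum LS).reduct M))
    [Nonempty N] (hN : N ⊨ T) :
    HasNeutralExtensions N := by
  intro ι _ a P
  have hmem : neutralSentence P ∈ T₀ := by
    refine proves_of_forall_model fun M _ _ hM => ?_
    let _ := (LHom.sumInr : LS →ᴸ LMem.sum LS).reduct M
    rw [LHom.realize_onSentence]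
    rw [realize_neutralSentence]
    exact fun a => h M hM ι a P
  exact realize_neutralSentence P |>.1 ((hT _ hmem).soundness hN) a

end Sentences
end Tern

namespace Tern
open FirstOrder FirstOrder.Language

/-! ### Evaluating formulas of set theory -/

section Evaluation

variable {M : Type} [LMem.Structure M]

/-- The membership relation of a model of set theory. -/
def Mem (x y : M) : Prop := Structure.RelMap memSym ![x, y]

infix:50 " ∊ " => Mem

/-- The truth value of a formula, under an assignment of the variables. -/
def ev (φ : Fml) (d : ℕ) (e : ℕ → M) : Prop :=
  (φ d).Realize default fun i : Fin d => e i

theorem ev_mem {d : ℕ} {e : ℕ → M} {x y : ℕ} (hx : x < d) (hy : y < d) :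
    ev (Fml.mem x y) d e ↔ e x ∊ e y := by
  rw [ev, Fml.mem, dif_pos ⟨hx, hy⟩, BoundedFormula.realize_rel₂]
  rfl

theorem ev_eq {d : ℕ} {e : ℕ → M} {x y : ℕ} (hx : x < d) (hy : y < d) :
    ev (Fml.eq x y) d e ↔ e x = e y := by
  rw [ev, Fml.eq, dif_pos ⟨hx, hy⟩, BoundedFormula.realize_bdEqual]
  rfl

theorem ev_app {d k : ℕ} {e : ℕ → M} {φ : LMem.Formula (Fin k)} {v : Fin k → ℕ}
    (hv : ∀ i, v i < d) : ev (Fml.app φ v) d e ↔ φ.Realize fun i => e (v i) := by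
  rw [ev, Fml.app, dif_pos hv, BoundedFormula.realize_relabel, Formula.Realize]
  refine iff_of_eq (congrArg₂ _ ?_ ?_)
  · rfl
  · exact Subsingleton.elim _ _

theorem ev_not {φ : Fml} {d : ℕ} {e : ℕ → M} : ev (Fml.not φ) d e ↔ ¬ ev φ d e := Iff.rfl

theorem ev_imp {φ ψ : Fml} {d : ℕ} {e : ℕ → M} :
    ev (Fml.imp φ ψ) d e ↔ (ev φ d e → ev ψ d e) := Iff.rfl

theorem ev_and {φ ψ : Fml} {d : ℕ} {e : ℕ → M} :
    ev (Fml.and φ ψ) d e ↔ ev φ d e ∧ ev ψ d e := BoundedFormula.realize_inf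

theorem ev_or {φ ψ : Fml} {d : ℕ} {e : ℕ → M} :
    ev (Fml.or φ ψ) d e ↔ ev φ d e ∨ ev ψ d e := BoundedFormula.realize_sup

theorem ev_iff {φ ψ : Fml} {d : ℕ} {e : ℕ → M} :
    ev (Fml.iff φ ψ) d e ↔ (ev φ d e ↔ ev ψ d e) := BoundedFormula.realize_iff

/-- Total assignments turn quantification at depth `d` into an update at `d`, so looking up a
variable is only a comparison of numerals. -/
theorem snoc_eq_update {M : Type} (d : ℕ) (e : ℕ → M) (a : M) :
    Fin.snoc (α := fun _ => M) (fun i : Fin d => e i) a =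
      fun i : Fin (d + 1) => Function.update e d a i := by
  funext i
  induction i using Fin.lastCases with
  | last => simp
  | cast i =>
    rw [Fin.snoc_castSucc, Function.update_of_ne]
    · rfl
    · exact i.2.ne

theorem ev_all {φ : ℕ → Fml} {d : ℕ} {e : ℕ → M} :
    ev (Fml.all φ) d e ↔ ∀ a, ev (φ d) (d + 1) (Function.update e d a) := by
  rw [ev, Fml.all, BoundedFormula.realize_all]
  simp only [snoc_eq_update, ev]

theorem ev_ex {φ : ℕ → Fml} {d : ℕ} {e : ℕ → M} :
    ev (Fml.ex φ) d e ↔ ∃ a, ev (φ d) (d + 1) (Function.update e d a) := by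
  rw [ev, Fml.ex, BoundedFormula.realize_ex]
  simp only [snoc_eq_update, ev]

theorem ev_zero_iff {φ : Fml} (e : ℕ → M) : ev φ 0 e ↔ M ⊨ (φ 0 : LMem.Sentence) := by
  rw [ev, Sentence.Realize, Formula.Realize]
  exact iff_of_eq (congrArg₂ _ rfl (Subsingleton.elim _ _))

theorem ev_of_alls {φ : Fml} {n : ℕ} (h : M ⊨ ((φ n).alls : LMem.Sentence)) (e : ℕ → M) :
    ev φ n e := by
  rw [Sentence.Realize, BoundedFormula.realize_alls] at h
  exact h _

end Evaluation

/-! ### Definability with parameters, by instance search -/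

section Definability

variable {M : Type} [LMem.Structure M]

/-- A predicate of assignments that is definable in the model, with parameters. -/
class Dfn (P : (ℕ → M) → Prop) : Prop where
  exists_formula : ∃ φ : LMem.Formula (M ⊕ ℕ), ∀ e, φ.Realize (Sum.elim id e) ↔ P e

theorem Dfn.relabel {P : (ℕ → M) → Prop} (h : Dfn P) (s : ℕ → ℕ) :
    Dfn fun e => P fun n => e (s n) := by
  obtain ⟨φ, hφ⟩ := h
  refine ⟨φ.relabel (Sum.map id s), fun e => ?_⟩
  rw [Formula.realize_relabel, ← hφ]
  refine iff_of_eq (congrArg _ (funext fun x => ?_))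
  cases x <;> rfl

theorem Dfn.of_iff {P Q : (ℕ → M) → Prop} (h : Dfn P) (hPQ : ∀ e, P e ↔ Q e) : Dfn Q :=
  (funext fun e => propext (hPQ e) : P = Q) ▸ h

theorem dfn_mem (x y : M ⊕ ℕ) : Dfn fun e : ℕ → M => Sum.elim id e x ∊ Sum.elim id e y := by
  refine ⟨memSym.formula ![.var x, .var y], fun e => ?_⟩
  rw [Formula.realize_rel, Mem]
  refine iff_of_eq (congrArg _ (funext fun i => ?_))
  fin_cases i <;> rfl

theorem dfn_eq (x y : M ⊕ ℕ) : Dfn fun e : ℕ → M => Sum.elim id e x = Sum.elim id e y := by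
  refine ⟨Term.equal (.var x) (.var y), fun e => ?_⟩
  rw [Formula.realize_equal]
  rfl

instance dfn_false : Dfn fun _ : ℕ → M => False := ⟨⊥, fun _ => Iff.rfl⟩

instance dfn_imp {P Q : (ℕ → M) → Prop} [hP : Dfn P] [hQ : Dfn Q] : Dfn fun e => P e → Q e := by
  obtain ⟨φ, hφ⟩ := hP
  obtain ⟨ψ, hψ⟩ := hQ
  exact ⟨φ.imp ψ, fun e => by rw [Formula.realize_imp, hφ, hψ]⟩

instance dfn_not {P : (ℕ → M) → Prop} [hP : Dfn P] : Dfn fun e => ¬ P e :=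
  inferInstanceAs (Dfn fun e => P e → False)

instance dfn_and {P Q : (ℕ → M) → Prop} [hP : Dfn P] [hQ : Dfn Q] : Dfn fun e => P e ∧ Q e := by
  obtain ⟨φ, hφ⟩ := hP
  obtain ⟨ψ, hψ⟩ := hQ
  exact ⟨φ ⊓ ψ, fun e => by rw [Formula.realize_inf, hφ, hψ]⟩

instance dfn_or {P Q : (ℕ → M) → Prop} [hP : Dfn P] [hQ : Dfn Q] : Dfn fun e => P e ∨ Q e := by
  obtain ⟨φ, hφ⟩ := hP
  obtain ⟨ψ, hψ⟩ := hQ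
  exact ⟨φ ⊔ ψ, fun e => by rw [Formula.realize_sup, hφ, hψ]⟩

instance dfn_iff {P Q : (ℕ → M) → Prop} [hP : Dfn P] [hQ : Dfn Q] : Dfn fun e => P e ↔ Q e :=
  Dfn.of_iff (P := fun e => (P e → Q e) ∧ (Q e → P e)) inferInstance
    fun _ => iff_iff_implies_and_implies.symm

/-- The bound variable becomes index `0` and the others move up by one; the same shape at every
depth lets instance search pass through nested quantifiers. -/
instance dfn_exists {P : (ℕ → M) → M → Prop} [hP : Dfn fun e => P (fun n => e (n + 1)) (e 0)] :
    Dfn fun e => ∃ x, P e x := by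
  obtain ⟨φ, hφ⟩ := hP
  let s : M ⊕ ℕ → (M ⊕ ℕ) ⊕ Unit :=
    Sum.elim (fun a => .inl (.inl a)) fun n => Nat.casesOn n (.inr ()) fun n => .inl (.inr n)
  refine ⟨Formula.iExs Unit (φ.relabel s), fun e => ?_⟩
  rw [Formula.realize_iExs, (Equiv.funUnique Unit M).exists_congr_left]
  refine exists_congr fun x => ?_
  let e' : ℕ → M := fun n => Nat.casesOn n x e
  rw [Formula.realize_relabel]
  refine Iff.trans (iff_of_eq (congrArg _ (funext fun y => ?_))) (hφ e')
  rcases y with a | _ | n <;> rfl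

instance dfn_forall {P : (ℕ → M) → M → Prop} [hP : Dfn fun e => P (fun n => e (n + 1)) (e 0)] :
    Dfn fun e => ∀ x, P e x :=
  Dfn.of_iff (P := fun e => ¬ ∃ x, ¬ P e x) inferInstance fun _ => not_exists_not

/-- A function of assignments whose graph is definable in the model, with parameters. -/
class Tm (f : (ℕ → M) → M) : Prop where
  graph : Dfn fun e => e 0 = f fun n => e (n + 1)

instance tm_var (n : ℕ) : Tm fun e : ℕ → M => e n := ⟨dfn_eq (.inr 0) (.inr (n + 1))⟩

instance tm_const (a : M) : Tm fun _ : ℕ → M => a := ⟨dfn_eq (.inr 0) (.inl a)⟩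

/-- A definable function is substituted by quantifying over its value, since the language has no
function symbols. -/
theorem Dfn.comp₁ {R : M → Prop} (h : Dfn fun e : ℕ → M => R (e 0)) (f : (ℕ → M) → M)
    [hf : Tm f] : Dfn fun e => R (f e) := by
  have := hf.graph
  have := h.relabel fun _ => 0
  exact Dfn.of_iff (P := fun e => ∃ x, x = f e ∧ R x) inferInstance fun e => by simp

theorem Dfn.comp₂ {R : M → M → Prop} (h : Dfn fun e : ℕ → M => R (e 0) (e 1))
    (f g : (ℕ → M) → M) [hf : Tm f] [hg : Tm g] : Dfn fun e => R (f e) (g e) := by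
  have h1 : Dfn fun e => e 1 = f fun n => e (n + 1 + 1) :=
    hf.graph.relabel fun n => Nat.casesOn n 1 fun n => n + 1 + 1
  have h2 : Dfn fun e => e 0 = g fun n => e (n + 1 + 1) :=
    hg.graph.relabel fun n => Nat.casesOn n 0 fun n => n + 1 + 1
  have h3 : Dfn fun e => R (e 1) (e 0) := h.relabel fun n => Nat.casesOn n 1 fun _ => 0
  refine Dfn.of_iff (P := fun e => ∃ x y, x = f e ∧ y = g e ∧ R x y) ?_ fun e => by simp
  exact dfn_exists (hP := dfn_exists (hP := inferInstanceAs
    (Dfn fun e => e 1 = f (fun n => e (n + 1 + 1)) ∧ e 0 = g (fun n => e (n + 1 + 1)) ∧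
      R (e 1) (e 0))))

theorem Dfn.comp₃ {R : M → M → M → Prop} (h : Dfn fun e : ℕ → M => R (e 0) (e 1) (e 2))
    (f g k : (ℕ → M) → M) [hf : Tm f] [hg : Tm g] [hk : Tm k] :
    Dfn fun e => R (f e) (g e) (k e) := by
  have h1 : Dfn fun e => e 0 = f fun n => e (n + 1) := hf.graph
  have h2 : Dfn fun e => R (e 0) (g fun n => e (n + 1)) (k fun n => e (n + 1)) := by
    have h3 : Dfn fun e => e 1 = g fun n => e (n + 1 + 1 + 1) :=
      hg.graph.relabel fun n => Nat.casesOn n 1 fun n => n + 1 + 1 + 1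
    have h4 : Dfn fun e => e 0 = k fun n => e (n + 1 + 1 + 1) :=
      hk.graph.relabel fun n => Nat.casesOn n 0 fun n => n + 1 + 1 + 1
    have h5 : Dfn fun e => R (e 2) (e 1) (e 0) :=
      h.relabel fun n => Nat.casesOn n 2 fun n => Nat.casesOn n 1 fun _ => 0
    refine Dfn.of_iff (P := fun e => ∃ y z, y = g (fun n => e (n + 1)) ∧
      z = k (fun n => e (n + 1)) ∧ R (e 0) y z) ?_ fun e => by simp
    exact dfn_exists (hP := dfn_exists (hP := inferInstanceAs
      (Dfn fun e => e 1 = g (fun n => e (n + 1 + 1 + 1)) ∧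
        e 0 = k (fun n => e (n + 1 + 1 + 1)) ∧ R (e 2) (e 1) (e 0))))
  refine Dfn.of_iff (P := fun e => ∃ x, x = f e ∧ R x (g e) (k e)) ?_ fun e => by simp
  exact dfn_exists (hP := inferInstanceAs (Dfn fun e => e 0 = f (fun n => e (n + 1)) ∧
    R (e 0) (g fun n => e (n + 1)) (k fun n => e (n + 1))))

instance dfn_mem_tm {f g : (ℕ → M) → M} [hf : Tm f] [hg : Tm g] : Dfn fun e => f e ∊ g e :=
  (dfn_mem (.inr 0) (.inr 1)).comp₂ f g

instance dfn_eq_tm {f g : (ℕ → M) → M} [hf : Tm f] [hg : Tm g] : Dfn fun e => f e = g e :=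
  (dfn_eq (.inr 0) (.inr 1)).comp₂ f g

end Definability
end Tern

namespace Tern
open FirstOrder FirstOrder.Language

/-! ### The axioms of set theory in a model -/

section Description

variable {M : Type} [LMem.Structure M]

theorem Tm.shift {f : (ℕ → M) → M} (hf : Tm f) : Tm fun e => f fun n => e (n + 1) :=
  ⟨hf.graph.relabel fun n => Nat.casesOn n 0 fun n => n + 1 + 1⟩

theorem Tm.comp₁ {F : M → M} (h : Tm fun e : ℕ → M => F (e 0)) (f : (ℕ → M) → M) [hf : Tm f] :
    Tm fun e => F (f e) :=
  have := hf.shift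
  ⟨h.graph.comp₂ (R := fun x y => x = F y) (fun e => e 0) fun e => f fun n => e (n + 1)⟩

theorem Tm.comp₂ {F : M → M → M} (h : Tm fun e : ℕ → M => F (e 0) (e 1)) (f g : (ℕ → M) → M)
    [hf : Tm f] [hg : Tm g] : Tm fun e => F (f e) (g e) :=
  have := hf.shift
  have := hg.shift
  ⟨h.graph.comp₃ (R := fun x y z => x = F y z) (fun e => e 0) (fun e => f fun n => e (n + 1))
    fun e => g fun n => e (n + 1)⟩

/-- The schemes expect finitely many parameters followed by the arguments. Only finitely many
variables occur in the given formula; they are numbered to become the parameters, and the two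
arguments fill the last two slots. -/
theorem Dfn.exists_formula_fin {R : M → M → Prop} (h : Dfn fun e : ℕ → M => R (e 0) (e 1)) :
    ∃ (n : ℕ) (ψ : LMem.Formula (Fin (n + 2))) (p : Fin n → M), ∀ x y,
      ψ.Realize (Fin.snoc (α := fun _ => M) (Fin.snoc (α := fun _ => M) p x) y) ↔ R x y := by
  classical
  obtain ⟨φ, hφ⟩ := h
  cases isEmpty_or_nonempty M with
  | inl _ => exact ⟨0, ⊥, Fin.elim0, fun x => isEmptyElim x⟩
  | inr hM =>
    let t := BoundedFormula.freeVarFinset φ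
    let q : t ≃ Fin t.card := t.equivFin
    let p : Fin t.card → M := fun i => Sum.elim id (fun _ => Classical.arbitrary M) (q.symm i).1
    let g : t → Fin (t.card + 2) := fun z =>
      Sum.elim (fun _ => (q z).castSucc.castSucc)
        (fun n => Nat.casesOn n (Fin.last _).castSucc fun _ => Fin.last _) z.1
    refine ⟨t.card, BoundedFormula.restrictFreeVar φ g, p, fun x y => ?_⟩
    let e : ℕ → M := fun n => Nat.casesOn n x fun _ => y
    refine (BoundedFormula.realize_restrictFreeVar (Sum.elim id e) ?_).trans (hφ e)
    rintro ⟨a | _ | n, hz⟩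
    · simp [g, p]
    · simp [g, e]
    · simp [g, e]

variable [Nonempty M]

open Classical in
/-- The unique element with the property `P`. -/
noncomputable def the (P : M → Prop) : M :=
  if h : ∃ x, ∀ z, P z ↔ z = x then h.choose else Classical.arbitrary M

theorem the_eq_iff {M : Type} [Nonempty M] {P : M → Prop} (h : ∃ x, ∀ z, P z ↔ z = x)
    (y : M) : y = the P ↔ P y := by
  rw [the, dif_pos h]
  exact (h.choose_spec y).symm

/-- The junk value is one fixed element, hence a parameter, and the graph is definable whether or
not the description succeeds. -/
instance tm_the {P : (ℕ → M) → M → Prop} [hP : Dfn fun e => P (fun n => e (n + 1)) (e 0)] :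
    Tm fun e => the (P e) := by
  have h0 : Dfn fun e => P (fun n => e (n + 1 + 1 + 1)) (e 0) :=
    hP.relabel fun n => Nat.casesOn n 0 fun n => n + 1 + 1 + 1
  have h1 : Dfn fun e => ∃ x, ∀ z, P (fun n => e (n + 1)) z ↔ z = x :=
    dfn_exists (hP := dfn_forall (hP := inferInstanceAs
      (Dfn fun e => P (fun n => e (n + 1 + 1 + 1)) (e 0) ↔ e 0 = e 1)))
  refine ⟨Dfn.of_iff (P := fun e => ((∃ x, ∀ z, P (fun n => e (n + 1)) z ↔ z = x) ∧
    P (fun n => e (n + 1)) (e 0)) ∨ (¬ (∃ x, ∀ z, P (fun n => e (n + 1)) z ↔ z = x) ∧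
      e 0 = Classical.arbitrary M)) inferInstance fun e => ?_⟩
  by_cases h : ∃ x, ∀ z, P (fun n => e (n + 1)) z ↔ z = x
  · simp only [h, true_and, not_true, false_and, or_false, the_eq_iff h]
  · simp only [h, false_and, not_false_iff, true_and, false_or, the, dif_neg, not_false_iff]

/-- The set of all elements with the property `P`. -/
noncomputable def cls (P : M → Prop) : M := the fun z => ∀ w, w ∊ z ↔ P w

instance tm_cls {P : (ℕ → M) → M → Prop} [hP : Dfn fun e => P (fun n => e (n + 1)) (e 0)] :
    Tm fun e => cls (P e) := by
  have : Dfn fun e => P (fun n => e (n + 1 + 1)) (e 0) :=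
    hP.relabel fun n => Nat.casesOn n 0 fun n => n + 1 + 1
  exact tm_the (hP := dfn_forall (hP := inferInstanceAs
    (Dfn fun e => e 0 ∊ e 1 ↔ P (fun n => e (n + 1 + 1)) (e 0))))

/-- The elements with the property `P` form a set. -/
def IsSet (P : M → Prop) : Prop := ∃ z, ∀ w, w ∊ z ↔ P w

theorem mem_cls {P : M → Prop} (hext : ∀ x y : M, (∀ z, z ∊ x ↔ z ∊ y) → x = y)
    (h : IsSet P) (w : M) : w ∊ cls P ↔ P w := by
  obtain ⟨z, hz⟩ := h
  refine (the_eq_iff (P := fun z => ∀ w, w ∊ z ↔ P w) ⟨z, fun z' => ⟨fun h => ?_, ?_⟩⟩ _).1 rfl w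
  · exact hext _ _ fun w => (h w).trans (hz w).symm
  · rintro rfl
    exact hz

end Description

section Axioms

set_option linter.unusedSectionVars false

variable {M : Type} [LMem.Structure M] [Nonempty M] [hM : M ⊨ ZFminusInfPlus]

theorem mext {x y : M} (h : ∀ z, z ∊ x ↔ z ∊ y) : x = y := by
  have h0 : M ⊨ extensionality := hM.realize_of_mem _ (by simp [ZFminusInfPlus])
  rw [extensionality, ← ev_zero_iff (fun _ => x)] at h0
  simp (disch := omega) only [ev_all, ev_imp, ev_iff, ev_mem, ev_eq, Function.update_of_ne,
    Function.update_self] at h0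
  exact h0 x y h

theorem IsSet.mem_cls {P : M → Prop} (h : IsSet P) {w : M} : w ∊ cls P ↔ P w :=
  Tern.mem_cls (fun _ _ => mext) h w

theorem isSet_pair (x y : M) : IsSet fun w => w = x ∨ w = y := by
  have h0 : M ⊨ pairing := hM.realize_of_mem _ (by simp [ZFminusInfPlus])
  rw [pairing, ← ev_zero_iff (fun _ => x)] at h0
  simp (disch := omega) only [ev_all, ev_ex, ev_or, ev_iff, ev_mem, ev_eq, Function.update_of_ne,
    Function.update_self] at h0
  exact h0 x y

theorem isSet_union (x : M) : IsSet fun w => ∃ y, y ∊ x ∧ w ∊ y := by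
  have h0 : M ⊨ union := hM.realize_of_mem _ (by simp [ZFminusInfPlus])
  rw [union, ← ev_zero_iff (fun _ => x)] at h0
  simp (disch := omega) only [ev_all, ev_ex, ev_and, ev_iff, ev_mem, Function.update_of_ne,
    Function.update_self] at h0
  exact h0 x

/-- `x ⊆ y` -/
def Sub (x y : M) : Prop := ∀ z, z ∊ x → z ∊ y

/-- `x` is a transitive set. -/
def Trans (x : M) : Prop := ∀ y, y ∊ x → Sub y x

theorem ev_subset {d : ℕ} {e : ℕ → M} {x y : ℕ} (hx : x < d) (hy : y < d) :
    ev (subset x y) d e ↔ Sub (e x) (e y) := by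
  simp (disch := omega) only [subset, ev_all, ev_imp, ev_mem, Function.update_of_ne,
    Function.update_self, Sub]

theorem ev_isTrans {d : ℕ} {e : ℕ → M} {x : ℕ} (hx : x < d) :
    ev (isTrans x) d e ↔ Trans (e x) := by
  simp (disch := omega) only [isTrans, ev_all, ev_imp, ev_mem, ev_subset, Function.update_of_ne,
    Function.update_self, Trans]

theorem isSet_powerset (x : M) : IsSet fun w => Sub w x := by
  have h0 : M ⊨ powerSet := hM.realize_of_mem _ (by simp [ZFminusInfPlus])
  rw [powerSet, ← ev_zero_iff (fun _ => x)] at h0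
  simp (disch := omega) only [ev_all, ev_ex, ev_iff, ev_mem, ev_subset, Function.update_of_ne,
    Function.update_self] at h0
  exact h0 x

theorem exists_minimal_mem {x y : M} (h : y ∊ x) : ∃ y, y ∊ x ∧ ∀ z, z ∊ y → ¬ z ∊ x := by
  have h0 : M ⊨ regularity := hM.realize_of_mem _ (by simp [ZFminusInfPlus])
  rw [regularity, ← ev_zero_iff (fun _ => x)] at h0
  simp (disch := omega) only [ev_all, ev_ex, ev_imp, ev_and, ev_not, ev_mem, Function.update_of_ne,
    Function.update_self] at h0
  obtain ⟨m, hm, h⟩ := h0 x ⟨y, h⟩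
  exact ⟨m, hm, fun z hz hz' => h ⟨z, hz', hz⟩⟩

theorem exists_trans_superset (x : M) : ∃ y, Sub x y ∧ Trans y := by
  have h0 : M ⊨ transitiveClosure := hM.realize_of_mem _ (by simp [ZFminusInfPlus])
  rw [transitiveClosure, ← ev_zero_iff (fun _ => x)] at h0
  simp (disch := omega) only [ev_all, ev_ex, ev_and, ev_subset, ev_isTrans, Function.update_of_ne,
    Function.update_self] at h0
  exact h0 x

theorem ev_app_snoc {n d : ℕ} {φ : LMem.Formula (Fin (n + 1))} {v : Fin n → ℕ} {x : ℕ}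
    {e : ℕ → M} {p : Fin n → M} (hv : ∀ i, v i < d ∧ e (v i) = p i) (hx : x < d) :
    ev (Fml.app φ (Fin.snoc (α := fun _ => ℕ) v x)) d e ↔
      φ.Realize (Fin.snoc (α := fun _ => M) p (e x)) := by
  rw [ev_app]
  · refine iff_of_eq (congrArg _ (funext fun i => ?_))
    induction i using Fin.lastCases with
    | last => simp
    | cast i => simpa using (hv i).2
  · intro i
    induction i using Fin.lastCases with
    | last => simpa using hx
    | cast i => simpa using (hv i).1

theorem isSet_sep {P : M → Prop} (a : M) [hP : Dfn fun e : ℕ → M => P (e 0)] :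
    IsSet fun w => w ∊ a ∧ P w := by
  obtain ⟨n, ψ, p, hψ⟩ := Dfn.exists_formula_fin (R := fun _ y => P y)
    (hP.relabel fun n => n + 1)
  have h0 : M ⊨ separation (n + 1) ψ := hM.realize_of_mem _ (.inl (.inr ⟨_, _, rfl⟩))
  -- The formula comes with a slot for an ignored argument; it is filled with `a` as one more
  -- parameter.
  let q : Fin (n + 1) → M := Fin.snoc (α := fun _ => M) p a
  have h1 := ev_of_alls h0 fun k => if h : k < n + 1 then q ⟨k, h⟩ else a
  rw [ev_all] at h1
  specialize h1 a
  rw [ev_ex] at h1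
  obtain ⟨b, hb⟩ := h1
  rw [ev_all] at hb
  refine ⟨b, fun x => ?_⟩
  specialize hb x
  rw [ev_iff, ev_and, ev_app_snoc (p := q) _ (by omega)] at hb
  · simp (disch := omega) only [ev_mem, Function.update_of_ne, Function.update_self] at hb
    rw [hb, hψ]
  · intro i
    have := i.2
    refine ⟨by omega, ?_⟩
    simp (disch := omega) only [Function.update_of_ne, dif_pos this]

theorem isSet_repl {F : M → M} (a : M) [hF : Tm fun e : ℕ → M => F (e 0)] :
    IsSet fun w => ∃ x, x ∊ a ∧ w = F x := by
  obtain ⟨n, ψ, p, hψ⟩ := Dfn.exists_formula_fin (R := fun x y => y = F x)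
    (inferInstanceAs (Dfn fun e : ℕ → M => e 1 = F (e 0)))
  have h0 : M ⊨ replacement n ψ := hM.realize_of_mem _ (.inr ⟨_, _, rfl⟩)
  have h1 := ev_of_alls h0 fun k => if h : k < n then p ⟨k, h⟩ else a
  have key (d : ℕ) (e : ℕ → M) (x y : ℕ) (hd : n ≤ d) (he : ∀ i : Fin n, e i = p i) (hx : x < d)
      (hy : y < d) : ev (Fml.app ψ (Fin.snoc (α := fun _ => ℕ)
        (Fin.snoc (fun i : Fin n => (i : ℕ)) x : Fin (n + 1) → ℕ) y)) d e ↔ e y = F (e x) := by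
    rw [ev_app_snoc (p := Fin.snoc (α := fun _ => M) p (e x)) _ hy, hψ]
    intro i
    induction i using Fin.lastCases with
    | last => simpa using hx
    | cast i => simpa [he] using i.2.trans_le hd
  rw [ev_all] at h1
  specialize h1 a
  rw [ev_imp, ev_all, ev_ex] at h1
  obtain ⟨b, hb⟩ := h1 fun x => by
    rw [ev_imp, ev_ex]
    refine fun _ => ⟨F x, ?_⟩
    rw [ev_all]
    intro y
    rw [ev_iff, key _ _ _ _ (by omega) _ (by omega) (by omega)]
    · simp (disch := omega) only [ev_eq, Function.update_of_ne, Function.update_self]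
    · intro i
      have := i.2
      simp (disch := omega) only [Function.update_of_ne, dif_pos this]
  rw [ev_all] at hb
  have hb' : ∀ x, x ∊ a → F x ∊ b := by
    intro x hx
    specialize hb x
    rw [ev_imp, ev_ex] at hb
    simp (disch := omega) only [ev_mem, Function.update_of_ne, Function.update_self] at hb
    obtain ⟨y, hy⟩ := hb hx
    rw [ev_and, key _ _ _ _ (by omega) _ (by omega) (by omega)] at hy
    · simp (disch := omega) only [ev_mem, Function.update_of_ne, Function.update_self] at hy
      exact hy.2 ▸ hy.1
    · intro i
      have := i.2
      simp (disch := omega) only [Function.update_of_ne, dif_pos this]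
  have hF' (f : (ℕ → M) → M) [Tm f] : Tm fun e => F (f e) := hF.comp₁ f
  -- The scheme yields only a set `b` that covers the image; separation cuts out the image itself.
  obtain ⟨c, hc⟩ := isSet_sep (P := fun w => ∃ x, x ∊ a ∧ w = F x) b
  refine ⟨c, fun w => (hc w).trans ⟨And.right, fun h => ⟨?_, h⟩⟩⟩
  obtain ⟨x, hx, rfl⟩ := h
  exact hb' x hx

end Axioms
end Tern

namespace Tern
open FirstOrder FirstOrder.Language

/-! ### Basic set theory in a model -/

section Basic

set_option linter.unusedSectionVars false

variable {M : Type} [LMem.Structure M] [Nonempty M]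

/-- `∅` -/
noncomputable def emp : M := cls fun _ => False
/-- `{x, y}` -/
noncomputable def upair (x y : M) : M := cls fun w => w = x ∨ w = y
/-- `⋃ x` -/
noncomputable def sUnion (x : M) : M := cls fun w => ∃ y, y ∊ x ∧ w ∊ y
/-- `x ∪ {u}` -/
noncomputable def ins (u x : M) : M := cls fun w => w ∊ x ∨ w = u
/-- The power set. -/
noncomputable def pow (x : M) : M := cls fun w => Sub w x
/-- The Kuratowski pair. -/
noncomputable def pr (x y : M) : M := upair (upair x x) (upair x y)
/-- The ordered triple. -/
noncomputable def tr (x y z : M) : M := pr x (pr y z)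
/-- The successor `x ∪ {x}`. -/
noncomputable def suc (x : M) : M := ins x x

variable {f g k : (ℕ → M) → M} [Tm f] [Tm g] [Tm k]

instance : Dfn fun e => Sub (f e) (g e) :=
  Dfn.comp₂ (R := Sub) (inferInstanceAs (Dfn fun e : ℕ → M => ∀ z, z ∊ e 0 → z ∊ e 1)) f g
instance : Dfn fun e => Trans (f e) :=
  Dfn.comp₁ (R := Trans) (inferInstanceAs (Dfn fun e : ℕ → M => ∀ z, z ∊ e 0 → Sub z (e 0))) f
instance : Tm fun e => upair (f e) (g e) :=
  Tm.comp₂ (F := upair) (inferInstanceAs (Tm fun e : ℕ → M => cls fun w => w = e 0 ∨ w = e 1)) f g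
instance : Tm fun e => ins (f e) (g e) :=
  Tm.comp₂ (F := ins) (inferInstanceAs (Tm fun e : ℕ → M => cls fun w => w ∊ e 1 ∨ w = e 0)) f g
instance : Tm fun e => pow (f e) :=
  Tm.comp₁ (F := pow) (inferInstanceAs (Tm fun e : ℕ → M => cls fun w => Sub w (e 0))) f
instance : Tm fun e => pr (f e) (g e) :=
  inferInstanceAs (Tm fun e : ℕ → M => upair (upair (f e) (f e)) (upair (f e) (g e)))
instance : Tm fun e => tr (f e) (g e) (k e) :=
  inferInstanceAs (Tm fun e : ℕ → M => pr (f e) (pr (g e) (k e)))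
instance : Tm fun e => suc (f e) := inferInstanceAs (Tm fun e : ℕ → M => ins (f e) (f e))

variable [hM : M ⊨ ZFminusInfPlus]

theorem not_mem_emp {x : M} : ¬ x ∊ emp := by
  rw [emp, IsSet.mem_cls]
  · exact id
  · obtain ⟨z, hz⟩ := isSet_sep (P := fun _ => False) x
    exact ⟨z, fun w => (hz w).trans (by simp)⟩

theorem mem_upair {x y w : M} : w ∊ upair x y ↔ w = x ∨ w = y := (isSet_pair x y).mem_cls

theorem mem_sUnion {x w : M} : w ∊ sUnion x ↔ ∃ y, y ∊ x ∧ w ∊ y := (isSet_union x).mem_cls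

theorem isSet_ins (u x : M) : IsSet fun w => w ∊ x ∨ w = u :=
  ⟨sUnion (upair x (upair u u)), fun w => by
    simp only [mem_sUnion, mem_upair]
    constructor
    · rintro ⟨y, rfl | rfl, h⟩
      · exact .inl h
      · exact .inr (by simpa [mem_upair] using h)
    · rintro (h | rfl)
      · exact ⟨x, .inl rfl, h⟩
      · exact ⟨_, .inr rfl, mem_upair.2 (.inl rfl)⟩⟩

theorem mem_ins {u x w : M} : w ∊ ins u x ↔ w ∊ x ∨ w = u := (isSet_ins u x).mem_cls

theorem mem_suc {x w : M} : w ∊ suc x ↔ w ∊ x ∨ w = x := mem_ins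

theorem mem_pow {x w : M} : w ∊ pow x ↔ Sub w x := (isSet_powerset x).mem_cls

theorem eq_emp_iff {x : M} : x = emp ↔ ∀ z, ¬ z ∊ x :=
  ⟨fun h _ => h ▸ not_mem_emp, fun h => mext fun z => iff_of_false (h z) not_mem_emp⟩

theorem exists_mem_of_ne_emp {x : M} (h : x ≠ emp) : ∃ y, y ∊ x := by
  simpa [eq_emp_iff] using h

theorem upair_inj {x y x' y' : M} (h : upair x y = upair x' y') :
    (x = x' ∧ y = y') ∨ (x = y' ∧ y = x') := by
  have h1 (w : M) : w = x ∨ w = y ↔ w = x' ∨ w = y' := by rw [← mem_upair, h, mem_upair]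
  have := h1 x
  have := h1 y
  have := h1 x'
  have := h1 y'
  grind

theorem pr_inj {x y x' y' : M} : pr x y = pr x' y' ↔ x = x' ∧ y = y' := by
  refine ⟨fun h => ?_, fun h => by rw [h.1, h.2]⟩
  rcases upair_inj h with ⟨h1, h2⟩ | ⟨h1, h2⟩
  · have := upair_inj h1
    have := upair_inj h2
    grind
  · have := upair_inj h1
    have := upair_inj h2
    grind

theorem tr_inj {x y z x' y' z' : M} : tr x y z = tr x' y' z' ↔ x = x' ∧ y = y' ∧ z = z' := by
  simp [tr, pr_inj]

/-- Regularity is applied to the counterexamples inside a transitive set containing `x`. This is the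
point at which the axiom of transitive closure is used. -/
theorem mem_induction {P : M → Prop} [hP : Dfn fun e : ℕ → M => P (e 0)]
    (h : ∀ x, (∀ y, y ∊ x → P y) → P x) (x : M) : P x := by
  by_contra hx
  obtain ⟨t, ht, ht'⟩ := exists_trans_superset (upair x x)
  obtain ⟨a, ha⟩ := isSet_sep (P := fun y => ¬ P y) t
  obtain ⟨m, hm, hm'⟩ := exists_minimal_mem ((ha x).2 ⟨ht x (mem_upair.2 (.inl rfl)), hx⟩)
  refine ((ha m).1 hm).2 (h m fun y hy => ?_)
  by_contra hy'
  exact hm' y hy ((ha y).2 ⟨ht' _ ((ha m).1 hm).1 _ hy, hy'⟩)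

theorem not_mem_self (x : M) : ¬ x ∊ x := by
  intro h
  obtain ⟨y, hy, h'⟩ := exists_minimal_mem (mem_upair.2 (.inl rfl) : x ∊ upair x x)
  obtain rfl : y = x := by simpa [mem_upair] using hy
  exact h' y h hy

theorem mem_asymm {x y : M} (h : x ∊ y) : ¬ y ∊ x := by
  intro h'
  obtain ⟨z, hz, h1⟩ := exists_minimal_mem (mem_upair.2 (.inl rfl) : x ∊ upair x y)
  rcases mem_upair.1 hz with rfl | rfl
  · exact h1 y h' (mem_upair.2 (.inr rfl))
  · exact h1 x h (mem_upair.2 (.inl rfl))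

/-- `x` is an ordinal. -/
def Ord (x : M) : Prop := Trans x ∧ ∀ y, y ∊ x → Trans y

/-- `x` is non-empty and closed under successor. -/
def Limit (x : M) : Prop := (∃ y, y ∊ x) ∧ ∀ y, y ∊ x → ∃ z, z ∊ x ∧ z = suc y

/-- `x ≤ y`, for ordinals -/
def Le (x y : M) : Prop := x ∊ y ∨ x = y

instance : Dfn fun e => Ord (f e) :=
  Dfn.comp₁ (R := Ord)
    (inferInstanceAs (Dfn fun e : ℕ → M => Trans (e 0) ∧ ∀ z, z ∊ e 0 → Trans z)) f
instance : Dfn fun e => Limit (f e) :=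
  Dfn.comp₁ (R := Limit) (inferInstanceAs (Dfn fun e : ℕ → M =>
    (∃ y, y ∊ e 0) ∧ ∀ y, y ∊ e 0 → ∃ z, z ∊ e 0 ∧ z = suc y)) f
instance : Dfn fun e => Le (f e) (g e) :=
  inferInstanceAs (Dfn fun e : ℕ → M => f e ∊ g e ∨ f e = g e)

theorem Ord.of_mem {x y : M} (h : Ord x) (hy : y ∊ x) : Ord y :=
  ⟨h.2 y hy, fun z hz => h.2 z (h.1 y hy z hz)⟩

theorem Ord.mem_trans {x y z : M} (h : Ord x) (hy : y ∊ x) (hz : z ∊ y) : z ∊ x := h.1 y hy z hz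

theorem Ord.of_le {x y : M} (h : Ord x) (hy : Le y x) : Ord y := by
  rcases hy with hy | rfl
  · exact h.of_mem hy
  · exact h

theorem ord_emp : Ord (emp : M) :=
  ⟨fun _ h => (not_mem_emp h).elim, fun _ h => (not_mem_emp h).elim⟩

theorem Ord.suc {x : M} (h : Ord x) : Ord (suc x) := by
  constructor
  · intro y hy z hz
    rcases mem_suc.1 hy with hy | rfl
    · exact mem_suc.2 (.inl (h.mem_trans hy hz))
    · exact mem_suc.2 (.inl hz)
  · intro y hy
    rcases mem_suc.1 hy with hy | rfl
    · exact h.2 y hy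
    · exact h.1

theorem mem_suc_self (x : M) : x ∊ suc x := mem_suc.2 (.inr rfl)

theorem Ord.induction {P : M → Prop} [hP : Dfn fun e : ℕ → M => P (e 0)]
    (h : ∀ x, Ord x → (∀ y, y ∊ x → P y) → P x) {x : M} (hx : Ord x) : P x :=
  mem_induction (P := fun x => Ord x → P x)
    (fun x ih hx => h x hx fun y hy => ih y hy (hx.of_mem hy)) x hx

theorem Ord.trichotomy {x y : M} (hx : Ord x) (hy : Ord y) : x ∊ y ∨ x = y ∨ y ∊ x := by
  refine Ord.induction (P := fun x => ∀ y, Ord y → x ∊ y ∨ x = y ∨ y ∊ x) ?_ hx y hy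
  intro x hx ih y hy
  refine Ord.induction (P := fun y => x ∊ y ∨ x = y ∨ y ∊ x) ?_ hy
  intro y hy ih'
  by_cases h1 : ∀ z, z ∊ x → z ∊ y
  · by_cases h2 : ∀ z, z ∊ y → z ∊ x
    · exact .inr (.inl (mext fun z => ⟨h1 z, h2 z⟩))
    · push Not at h2
      obtain ⟨z, hz, hz'⟩ := h2
      rcases ih' z hz with h | h | h
      · exact .inl (hy.mem_trans hz h)
      · exact .inl (h ▸ hz)
      · exact (hz' h).elim
  · push Not at h1
    obtain ⟨z, hz, hz'⟩ := h1
    rcases ih z hz y hy with h | h | h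
    · exact (hz' h).elim
    · exact .inr (.inr (h ▸ hz))
    · exact .inr (.inr (hx.mem_trans hz h))

theorem Ord.le_or_lt {x y : M} (hx : Ord x) (hy : Ord y) : Le x y ∨ y ∊ x := by
  rcases hx.trichotomy hy with h | h | h
  · exact .inl (.inl h)
  · exact .inl (.inr h)
  · exact .inr h

/-- If `x` is not closed under successor at some `y ∈ x`, trichotomy leaves only `x = y + 1`. -/
theorem Ord.cases {x : M} (hx : Ord x) : x = emp ∨ (∃ y, Ord y ∧ x = Tern.suc y) ∨ Limit x := by
  by_cases h0 : x = emp
  · exact .inl h0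
  by_cases h1 : ∀ y, y ∊ x → ∃ z, z ∊ x ∧ z = Tern.suc y
  · exact .inr (.inr ⟨exists_mem_of_ne_emp h0, h1⟩)
  push Not at h1
  obtain ⟨y, hy, h⟩ := h1
  refine .inr (.inl ⟨y, hx.of_mem hy, ?_⟩)
  rcases hx.trichotomy (hx.of_mem hy).suc with h' | h' | h'
  · rcases mem_suc.1 h' with h' | rfl
    · exact (mem_asymm hy h').elim
    · exact (not_mem_self _ hy).elim
  · exact h'
  · exact (h _ h' rfl).elim

theorem suc_inj {x y : M} (h : suc x = suc y) : x = y := by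
  have h1 := mem_suc.1 (h ▸ mem_suc_self x)
  have h2 := mem_suc.1 (h.symm ▸ mem_suc_self y)
  rcases h1 with h1 | h1
  · rcases h2 with h2 | h2
    · exact (mem_asymm h1 h2).elim
    · exact h2.symm
  · exact h1

theorem not_limit_emp : ¬ Limit (emp : M) := fun ⟨⟨_, h⟩, _⟩ => not_mem_emp h

theorem suc_ne_emp (x : M) : suc x ≠ emp := fun h => not_mem_emp (h ▸ mem_suc_self x)

theorem not_limit_suc (x : M) : ¬ Limit (suc x) := by
  rintro ⟨-, h⟩
  obtain ⟨z, hz, rfl⟩ := h x (mem_suc_self x)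
  exact not_mem_self _ hz

theorem Limit.suc_mem {x y : M} (h : Limit x) (hy : y ∊ x) : suc y ∊ x := by
  obtain ⟨z, hz, rfl⟩ := h.2 y hy
  exact hz

/-- Transfinite induction. -/
theorem Ord.limitInduction {P : M → Prop} [hP : Dfn fun e : ℕ → M => P (e 0)] (h0 : P emp)
    (hs : ∀ x, Ord x → P x → P (Tern.suc x))
    (hl : ∀ x, Ord x → Limit x → (∀ y, y ∊ x → P y) → P x) {x : M} (hx : Ord x) : P x := by
  refine Ord.induction (fun x hx ih => ?_) hx
  rcases hx.cases with rfl | ⟨y, hy, rfl⟩ | h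
  · exact h0
  · exact hs y hy (ih y (mem_suc_self y))
  · exact hl x hx h ih

theorem ord_sUnion {x : M} (h : ∀ y, y ∊ x → Ord y) : Ord (sUnion x) := by
  constructor
  · intro y hy z hz
    obtain ⟨u, hu, hy⟩ := mem_sUnion.1 hy
    exact mem_sUnion.2 ⟨u, hu, (h u hu).mem_trans hy hz⟩
  · intro y hy
    obtain ⟨u, hu, hy⟩ := mem_sUnion.1 hy
    exact (h u hu).2 y hy

end Basic
end Tern

namespace Tern
open FirstOrder FirstOrder.Language

/-! ### Transfinite recursion in a model -/

section Recursion

set_option linter.unusedSectionVars false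

variable {M : Type} [LMem.Structure M] [Nonempty M]

/-- `h` is a function on `α + 1` that obeys the clauses of the recursion. -/
def IsRecFun (F : M → M → M) (h α : M) : Prop :=
  (∀ p, p ∊ h → ∃ γ y, Le γ α ∧ p = pr γ y) ∧
  (∀ γ, Le γ α → ∃ y, ∀ z, pr γ z ∊ h ↔ z = y) ∧
  (∀ γ y, γ = emp ∧ pr γ y ∊ h → y = emp) ∧
  (∀ γ δ y z, δ = suc γ ∧ pr γ y ∊ h ∧ pr δ z ∊ h → z = F γ y) ∧
  (∀ γ y, Limit γ ∧ pr γ y ∊ h → ∀ z, z ∊ y ↔ ∃ δ w, δ ∊ γ ∧ pr δ w ∊ h ∧ z ∊ w)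

/-- `x` is the value at `α` of the function defined by transfinite recursion from `F`. -/
def IsRec (F : M → M → M) (α x : M) : Prop := ∃ h, IsRecFun F h α ∧ pr α x ∊ h

/-- The function defined by transfinite recursion from `F`. -/
noncomputable def trec (F : M → M → M) (α : M) : M := the (IsRec F α)

variable {F : M → M → M}

variable [hM : M ⊨ ZFminusInfPlus]

theorem Ord.le_trans {x y z : M} (h : Ord z) (hy : Le y z) (hx : Le x y) : Le x z := by
  rcases hy with hy | rfl
  · rcases hx with hx | rfl
    · exact .inl (h.mem_trans hy hx)
    · exact .inl hy
  · exact hx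

theorem IsRecFun.unique {h h' α α' : M} (hh : IsRecFun F h α) (hh' : IsRecFun F h' α') (hα : Ord α)
    (hα' : Ord α') {γ : M} (hγ : Le γ α) (hγ' : Le γ α') {y y' : M} (hy : pr γ y ∊ h)
    (hy' : pr γ y' ∊ h') : y = y' := by
  obtain ⟨-, hf, h0, hs, hl⟩ := hh
  obtain ⟨-, hf', h0', hs', hl'⟩ := hh'
  refine Ord.limitInduction (P := fun γ => Le γ α → Le γ α' → ∀ y y', pr γ y ∊ h →
    pr γ y' ∊ h' → y = y') ?_ ?_ ?_ (hα.of_le hγ) hγ hγ' y y' hy hy'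
  · intro _ _ y y' hy hy'
    rw [h0 _ _ ⟨rfl, hy⟩, h0' _ _ ⟨rfl, hy'⟩]
  · intro γ _ ih hγ hγ' y y' hy hy'
    have h1 : Le γ α := hα.le_trans hγ (.inl (mem_suc_self γ))
    have h2 : Le γ α' := hα'.le_trans hγ' (.inl (mem_suc_self γ))
    obtain ⟨u, hu⟩ := hf γ h1
    obtain ⟨u', hu'⟩ := hf' γ h2
    obtain rfl := ih h1 h2 u u' ((hu u).2 rfl) ((hu' u').2 rfl)
    rw [hs _ _ _ _ ⟨rfl, (hu u).2 rfl, hy⟩, hs' _ _ _ _ ⟨rfl, (hu' u).2 rfl, hy'⟩]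
  · intro γ _ hlim ih hγ hγ' y y' hy hy'
    refine mext fun z => (hl _ _ ⟨hlim, hy⟩ z).trans (Iff.trans ?_ (hl' _ _ ⟨hlim, hy'⟩ z).symm)
    refine exists_congr fun δ => ?_
    constructor
    · rintro ⟨w, hδ, hw, hz⟩
      have h1 : Le δ α := hα.le_trans hγ (.inl hδ)
      have h2 : Le δ α' := hα'.le_trans hγ' (.inl hδ)
      obtain ⟨u', hu'⟩ := hf' δ h2
      obtain rfl := ih δ hδ h1 h2 w u' hw ((hu' u').2 rfl)
      exact ⟨w, hδ, (hu' w).2 rfl, hz⟩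
    · rintro ⟨w, hδ, hw, hz⟩
      have h1 : Le δ α := hα.le_trans hγ (.inl hδ)
      have h2 : Le δ α' := hα'.le_trans hγ' (.inl hδ)
      obtain ⟨u, hu⟩ := hf δ h1
      obtain rfl := ih δ hδ h1 h2 u w ((hu u).2 rfl) hw
      exact ⟨u, hδ, (hu u).2 rfl, hz⟩

theorem IsRec.unique {α x y : M} (hα : Ord α) (hx : IsRec F α x) (hy : IsRec F α y) : x = y := by
  obtain ⟨h, hh, hx⟩ := hx
  obtain ⟨h', hh', hy⟩ := hy
  exact hh.unique hh' hα hα (.inr rfl) (.inr rfl) hx hy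

theorem IsRecFun.restrict {h α β y : M} (hh : IsRecFun F h α) (hα : Ord α) (hβ : Le β α)
    (hy : pr β y ∊ h) : IsRec F β y := by
  obtain ⟨hd, hf, h0, hs, hl⟩ := hh
  obtain ⟨h', hh'⟩ := isSet_sep (P := fun p => ∃ γ y, Le γ β ∧ p = pr γ y) h
  have key (γ y : M) : pr γ y ∊ h' ↔ pr γ y ∊ h ∧ Le γ β := by
    rw [hh']
    refine and_congr_right fun _ => ⟨?_, fun h => ⟨γ, y, h, rfl⟩⟩
    rintro ⟨γ', y', h, e⟩
    rwa [(pr_inj.1 e).1]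
  refine ⟨h', ⟨fun p hp => ((hh' p).1 hp).2, fun γ hγ => ?_, ?_, ?_, ?_⟩,
    (key _ _).2 ⟨hy, .inr rfl⟩⟩
  · obtain ⟨y, hy⟩ := hf γ (hα.le_trans hβ hγ)
    exact ⟨y, fun z => by rw [key, hy, and_iff_left hγ]⟩
  · rintro γ y ⟨hγ, hy⟩
    exact h0 γ y ⟨hγ, ((key _ _).1 hy).1⟩
  · rintro γ δ y z ⟨hγ, hy, hz⟩
    exact hs γ δ y z ⟨hγ, ((key _ _).1 hy).1, ((key _ _).1 hz).1⟩
  · rintro γ y ⟨hγ, hy⟩ z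
    have hy := (key _ _).1 hy
    rw [hl γ y ⟨hγ, hy.1⟩]
    refine exists₂_congr fun δ w => and_congr_right fun hδ => ?_
    rw [key, and_iff_left ((hα.of_le hβ).le_trans hy.2 (.inl hδ))]

theorem IsRec.emp {x : M} (h : IsRec F emp x) : x = emp := by
  obtain ⟨h, ⟨-, -, h0, -⟩, hx⟩ := h
  exact h0 _ _ ⟨rfl, hx⟩

theorem IsRec.suc {γ x : M} (hγ : Ord γ) (h : IsRec F (suc γ) x) :
    ∃ y, IsRec F γ y ∧ x = F γ y := by
  obtain ⟨h, hh, hx⟩ := h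
  have hle : Le γ (Tern.suc γ) := .inl (mem_suc_self γ)
  obtain ⟨y, hy⟩ := hh.2.1 γ hle
  exact ⟨y, hh.restrict hγ.suc hle ((hy y).2 rfl), hh.2.2.2.1 _ _ _ _ ⟨rfl, (hy y).2 rfl, hx⟩⟩

theorem IsRec.limit {γ x : M} (hγ : Ord γ) (hl : Limit γ) (h : IsRec F γ x) (z : M) :
    z ∊ x ↔ ∃ δ w, δ ∊ γ ∧ IsRec F δ w ∧ z ∊ w := by
  obtain ⟨h, hh, hx⟩ := h
  rw [hh.2.2.2.2 _ _ ⟨hl, hx⟩]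
  refine exists_congr fun δ => ⟨?_, ?_⟩
  · rintro ⟨w, hδ, hw, hz⟩
    exact ⟨w, hδ, hh.restrict hγ (.inl hδ) hw, hz⟩
  · rintro ⟨w, hδ, hw, hz⟩
    obtain ⟨y, hy⟩ := hh.2.1 δ (.inl hδ)
    have hy := (hy y).2 rfl
    obtain rfl := (hh.restrict hγ (.inl hδ) hy).unique (hγ.of_mem hδ) hw
    exact ⟨y, hδ, hy, hz⟩

/-- `F` is definable. -/
class TmFun (F : M → M → M) : Prop where
  tm : Tm fun e : ℕ → M => F (e 0) (e 1)

variable [hF : TmFun F]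

instance {f g : (ℕ → M) → M} [Tm f] [Tm g] : Dfn fun e => IsRecFun F (f e) (g e) :=
  have (f g : (ℕ → M) → M) [Tm f] [Tm g] : Tm fun e => F (f e) (g e) := hF.tm.comp₂ f g
  Dfn.comp₂ (R := IsRecFun F) (inferInstanceAs (Dfn fun e : ℕ → M =>
    (∀ p, p ∊ e 0 → ∃ γ y, Le γ (e 1) ∧ p = pr γ y) ∧
    (∀ γ, Le γ (e 1) → ∃ y, ∀ z, pr γ z ∊ e 0 ↔ z = y) ∧
    (∀ γ y, γ = emp ∧ pr γ y ∊ e 0 → y = emp) ∧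
    (∀ γ δ y z, δ = suc γ ∧ pr γ y ∊ e 0 ∧ pr δ z ∊ e 0 → z = F γ y) ∧
    (∀ γ y, Limit γ ∧ pr γ y ∊ e 0 → ∀ z, z ∊ y ↔ ∃ δ w, δ ∊ γ ∧ pr δ w ∊ e 0 ∧ z ∊ w))) f g

instance {f g : (ℕ → M) → M} [Tm f] [Tm g] : Dfn fun e => IsRec F (f e) (g e) :=
  Dfn.comp₂ (R := IsRec F)
    (inferInstanceAs (Dfn fun e : ℕ → M => ∃ h, IsRecFun F h (e 0) ∧ pr (e 0) (e 1) ∊ h)) f g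

instance {f : (ℕ → M) → M} [Tm f] : Tm fun e => trec F (f e) :=
  Tm.comp₁ (F := trec F) (inferInstanceAs (Tm fun e : ℕ → M => the fun x => IsRec F (e 0) x)) f

/-- By induction the values below `α` are unique. Replacement collects them into a function, to
which the pair of `α` with the value prescribed by the relevant clause is added. -/
theorem exists_isRec {α : M} (hα : Ord α) : ∃ x, IsRec F α x := by
  refine Ord.induction (P := fun α => ∃ x, IsRec F α x) (fun α hα ih => ?_) hα
  have ih' (γ : M) (hγ : γ ∊ α) : ∀ x, x = trec F γ ↔ IsRec F γ x := by
    obtain ⟨x, hx⟩ := ih γ hγ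
    exact the_eq_iff ⟨x, fun z => ⟨fun hz => hz.unique (hα.of_mem hγ) hx, fun h => h ▸ hx⟩⟩
  -- Stating all three clauses for one `X` lets the verification of the recursion function treat
  -- zero, successors and limits together.
  have hX : ∃ X, (α = emp → X = emp) ∧ (∀ γ, α = suc γ → X = F γ (trec F γ)) ∧
      (Limit α → ∀ z, z ∊ X ↔ ∃ δ, δ ∊ α ∧ z ∊ trec F δ) := by
    rcases hα.cases with rfl | ⟨γ, hγ, rfl⟩ | hl
    · exact ⟨emp, fun _ => rfl, fun γ h => (suc_ne_emp _ h.symm).elim,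
        fun h => (not_limit_emp h).elim⟩
    · exact ⟨F γ (trec F γ), fun h => (suc_ne_emp _ h).elim, fun γ' h => by rw [suc_inj h],
        fun h => (not_limit_suc _ h).elim⟩
    · obtain ⟨b, hb⟩ := isSet_repl (F := fun γ => trec F γ) α
      refine ⟨sUnion b, ?_, ?_, fun _ z => ?_⟩
      · rintro rfl
        exact (not_limit_emp hl).elim
      · rintro γ rfl
        exact (not_limit_suc _ hl).elim
      · rw [mem_sUnion]
        constructor
        · rintro ⟨y, hy, hz⟩
          obtain ⟨δ, hδ, rfl⟩ := (hb y).1 hy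
          exact ⟨δ, hδ, hz⟩
        · rintro ⟨δ, hδ, hz⟩
          exact ⟨_, (hb _).2 ⟨δ, hδ, rfl⟩, hz⟩
  obtain ⟨X, hX0, hXs, hXl⟩ := hX
  obtain ⟨g, hg⟩ := isSet_repl (F := fun γ => pr γ (trec F γ)) α
  have key (γ z : M) : pr γ z ∊ ins (pr α X) g ↔
      (γ ∊ α ∧ z = trec F γ) ∨ (γ = α ∧ z = X) := by
    rw [mem_ins, hg, pr_inj]
    refine or_congr ⟨?_, fun h => ⟨γ, h.1, by rw [h.2]⟩⟩ Iff.rfl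
    rintro ⟨γ', h, e⟩
    obtain ⟨rfl, rfl⟩ := pr_inj.1 e
    exact ⟨h, rfl⟩
  refine ⟨X, ins (pr α X) g, ⟨?_, ?_, ?_, ?_, ?_⟩, (key _ _).2 (.inr ⟨rfl, rfl⟩)⟩
  · intro p hp
    rcases mem_ins.1 hp with hp | rfl
    · obtain ⟨γ, hγ, rfl⟩ := (hg p).1 hp
      exact ⟨γ, _, .inl hγ, rfl⟩
    · exact ⟨α, X, .inr rfl, rfl⟩
  · rintro γ (hγ | rfl)
    · refine ⟨trec F γ, fun z => (key _ _).trans ?_⟩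
      have : γ ≠ α := fun h => not_mem_self _ (h ▸ hγ)
      simp [this, hγ]
    · refine ⟨X, fun z => (key _ _).trans ?_⟩
      simp [not_mem_self]
  · rintro γ y ⟨rfl, hy⟩
    rcases (key _ _).1 hy with ⟨hγ, hy⟩ | ⟨hγ, rfl⟩
    · exact ((ih' _ hγ _).1 hy).emp
    · exact hX0 hγ.symm
  · rintro γ δ y z ⟨rfl, hy, hz⟩
    rcases (key _ _).1 hz with ⟨hδ, hz⟩ | ⟨hδ, rfl⟩
    · have hγ : γ ∊ α := hα.mem_trans hδ (mem_suc_self γ)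
      obtain ⟨y', hy', rfl⟩ := ((ih' _ hδ _).1 hz).suc (hα.of_mem hγ)
      rcases (key _ _).1 hy with ⟨_, hy⟩ | ⟨rfl, _⟩
      · rw [((ih' _ hγ _).1 hy).unique (hα.of_mem hγ) hy']
      · exact (not_mem_self _ hγ).elim
    · have hγ : γ ∊ α := hδ ▸ mem_suc_self γ
      rcases (key _ _).1 hy with ⟨_, rfl⟩ | ⟨rfl, _⟩
      · exact hXs γ hδ.symm
      · exact (not_mem_self _ hγ).elim
  · rintro γ y ⟨hl, hy⟩ z
    have hle : Le γ α := by
      rcases (key _ _).1 hy with h | h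
      · exact .inl h.1
      · exact .inr h.1
    have hrec : z ∊ y ↔ ∃ δ, δ ∊ γ ∧ z ∊ trec F δ := by
      rcases (key _ _).1 hy with ⟨hγ, hy⟩ | ⟨rfl, rfl⟩
      · rw [((ih' _ hγ _).1 hy).limit (hα.of_mem hγ) hl]
        refine exists_congr fun δ => ⟨?_, fun ⟨hδ, hz⟩ => ?_⟩
        · rintro ⟨w, hδ, hw, hz⟩
          exact ⟨hδ, (ih' _ (hα.mem_trans hγ hδ) _).2 hw ▸ hz⟩
        · exact ⟨_, hδ, (ih' _ (hα.mem_trans hγ hδ) _).1 rfl, hz⟩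
      · exact hXl hl z
    rw [hrec]
    refine exists_congr fun δ => ⟨fun ⟨hδ, hz⟩ => ⟨_, hδ, (key _ _).2 (.inl ⟨?_, rfl⟩), hz⟩, ?_⟩
    · rcases hle with hγ | rfl
      · exact hα.mem_trans hγ hδ
      · exact hδ
    · rintro ⟨w, hδ, hw, hz⟩
      rcases (key _ _).1 hw with ⟨_, rfl⟩ | ⟨rfl, _⟩
      · exact ⟨hδ, hz⟩
      · rcases hle with hγ | rfl
        · exact (mem_asymm hγ hδ).elim
        · exact (not_mem_self _ hδ).elim

theorem eq_trec_iff {α : M} (hα : Ord α) {x : M} : x = trec F α ↔ IsRec F α x := by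
  obtain ⟨x, hx⟩ := exists_isRec (F := F) hα
  exact the_eq_iff ⟨x, fun z => ⟨fun hz => hz.unique hα hx, fun h => h ▸ hx⟩⟩ _

theorem trec_emp : trec F (emp : M) = emp := ((eq_trec_iff ord_emp).1 rfl).emp

theorem trec_suc {α : M} (hα : Ord α) : trec F (suc α) = F α (trec F α) := by
  obtain ⟨y, hy, h⟩ := ((eq_trec_iff (F := F) hα.suc).1 rfl).suc hα
  rw [h, (eq_trec_iff hα).2 hy]

theorem mem_trec_limit {α : M} (hα : Ord α) (hl : Limit α) {z : M} :
    z ∊ trec F α ↔ ∃ δ, δ ∊ α ∧ z ∊ trec F δ := by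
  rw [((eq_trec_iff (F := F) hα).1 rfl).limit hα hl]
  refine exists_congr fun δ => ⟨?_, fun ⟨hδ, hz⟩ => ⟨_, hδ, (eq_trec_iff (hα.of_mem hδ)).1 rfl, hz⟩⟩
  rintro ⟨w, hδ, hw, hz⟩
  exact ⟨hδ, (eq_trec_iff (hα.of_mem hδ)).2 hw ▸ hz⟩

end Recursion
end Tern

namespace Tern
open FirstOrder FirstOrder.Language

/-! ### The cumulative hierarchy in a model -/

section Hierarchy

set_option linter.unusedSectionVars false

variable {M : Type} [LMem.Structure M] [Nonempty M]

/-- `x + k` -/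
noncomputable def addN : ℕ → M → M
  | 0, x => x
  | k + 1, x => suc (addN k x)

/-- `V_α` -/
noncomputable def V (α : M) : M := trec (fun _ y => pow y) α

/-- `6 · α` -/
noncomputable def six (α : M) : M := trec (fun _ y => addN 6 y) α

/-- `V_{6α}` -/
noncomputable def W (α : M) : M := V (six α)

variable {f : (ℕ → M) → M}

theorem tm_addN (k : ℕ) [hf : Tm f] : Tm fun e => addN k (f e) := by
  induction k with
  | zero => exact hf
  | succ k ih => exact inferInstanceAs (Tm fun e => suc (addN k (f e)))

instance (k : ℕ) [Tm f] : Tm fun e => addN k (f e) := tm_addN k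
instance : TmFun fun _ y : M => pow y := ⟨inferInstance⟩
instance : TmFun fun _ y : M => addN 6 y := ⟨inferInstance⟩

variable [hM : M ⊨ ZFminusInfPlus]

instance [Tm f] : Tm fun e => V (f e) :=
  inferInstanceAs (Tm fun e => trec (fun _ y => pow y) (f e))
instance [Tm f] : Tm fun e => six (f e) :=
  inferInstanceAs (Tm fun e => trec (fun _ y => addN 6 y) (f e))
instance [Tm f] : Tm fun e => W (f e) :=
  inferInstanceAs (Tm fun e => V (six (f e)))

/-- This uniform description replaces the three clauses of the recursion and yields monotonicity and
transitivity at once. -/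
theorem mem_V {α : M} (hα : Ord α) {x : M} : x ∊ V α ↔ ∃ β, β ∊ α ∧ Sub x (V β) := by
  refine Ord.induction (P := fun α => ∀ x, x ∊ V α ↔ ∃ β, β ∊ α ∧ Sub x (V β)) ?_ hα x
  intro α hα ih x
  rcases hα.cases with rfl | ⟨γ, hγ, rfl⟩ | hl
  · simp [V, trec_emp, not_mem_emp]
  · have h1 : x ∊ V (suc γ) ↔ Sub x (V γ) := by
      rw [V, trec_suc hγ, mem_pow]
      rfl
    rw [h1]
    refine ⟨fun h => ⟨γ, mem_suc_self γ, h⟩, ?_⟩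
    rintro ⟨β, hβ, h⟩
    rcases mem_suc.1 hβ with hβ' | rfl
    · intro z hz
      obtain ⟨β', hβ₁, h'⟩ := (ih β hβ z).1 (h z hz)
      exact (ih γ (mem_suc_self γ) z).2 ⟨β', hγ.mem_trans hβ' hβ₁, h'⟩
    · exact h
  · rw [V, mem_trec_limit hα hl]
    change (∃ δ, δ ∊ α ∧ x ∊ V δ) ↔ _
    constructor
    · rintro ⟨δ, hδ, h⟩
      obtain ⟨β, hβ, h⟩ := (ih δ hδ x).1 h
      exact ⟨β, hα.mem_trans hδ hβ, h⟩
    · rintro ⟨β, hβ, h⟩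
      exact ⟨suc β, hl.suc_mem hβ, (ih _ (hl.suc_mem hβ) x).2 ⟨β, mem_suc_self β, h⟩⟩

theorem mem_V_suc {α : M} (hα : Ord α) {x : M} : x ∊ V (suc α) ↔ Sub x (V α) := by
  rw [V, trec_suc hα, mem_pow]
  rfl

theorem V_mono {α β : M} (hα : Ord α) (h : Le β α) : Sub (V β) (V α) := by
  rcases h with h | rfl
  · intro x hx
    obtain ⟨γ, hγ, h'⟩ := (mem_V (hα.of_mem h)).1 hx
    exact (mem_V hα).2 ⟨γ, hα.mem_trans h hγ, h'⟩
  · exact fun _ => id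

theorem trans_V {α : M} (hα : Ord α) : Trans (V α) := by
  intro x hx z hz
  obtain ⟨β, hβ, h⟩ := (mem_V hα).1 hx
  exact V_mono hα (.inl hβ) _ (h z hz)

theorem ord_sub_V {α : M} (hα : Ord α) : Sub α (V α) := by
  refine Ord.induction (P := fun α => Sub α (V α)) (fun α hα ih γ hγ => ?_) hα
  exact (mem_V hα).2 ⟨γ, hγ, ih γ hγ⟩

theorem ord_not_mem_V {α : M} (hα : Ord α) : ¬ α ∊ V α := by
  refine Ord.induction (P := fun α => ¬ α ∊ V α) (fun α hα ih h => ?_) hα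
  obtain ⟨β, hβ, h⟩ := (mem_V hα).1 h
  exact ih β hβ (h β hβ)

theorem exists_mem_V (x : M) : ∃ α, Ord α ∧ x ∊ V α := by
  refine mem_induction (P := fun x => ∃ α, Ord α ∧ x ∊ V α) (fun x ih => ?_) x
  -- Least ranks are single-valued and definable, so replacement applies to them.
  let r : M → M := fun y => the fun α => (Ord α ∧ y ∊ V α) ∧ ∀ β, Ord β ∧ y ∊ V β → Le α β
  have hr (y : M) (hy : y ∊ x) : Ord (r y) ∧ y ∊ V (r y) := by
    obtain ⟨α, hα, h⟩ := ih y hy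
    have : ∃ α, (Ord α ∧ y ∊ V α) ∧ ∀ β, Ord β ∧ y ∊ V β → Le α β := by
      refine Ord.induction (P := fun α => y ∊ V α → ∃ α, (Ord α ∧ y ∊ V α) ∧
        ∀ β, Ord β ∧ y ∊ V β → Le α β) (fun α hα ih h => ?_) hα h
      by_cases hmin : ∃ β, β ∊ α ∧ y ∊ V β
      · obtain ⟨β, hβ, h⟩ := hmin
        exact ih β hβ h
      · refine ⟨α, ⟨hα, h⟩, fun β hβ => (hα.le_or_lt hβ.1).resolve_right fun h => ?_⟩
        exact hmin ⟨β, h, hβ.2⟩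
    obtain ⟨α, hα⟩ := this
    refine ((the_eq_iff ⟨α, fun β => ⟨fun hβ => ?_, fun h => h ▸ hα⟩⟩ (r y)).1 rfl).1
    rcases hα.2 β hβ.1 with h1 | h1
    · rcases hβ.2 α hα.1 with h2 | h2
      · exact (mem_asymm h1 h2).elim
      · exact h2
    · exact h1.symm
  obtain ⟨b, hb⟩ := isSet_repl (F := r) x
  have hb' : ∀ y, y ∊ b → Ord y := by
    intro y hy
    obtain ⟨z, hz, rfl⟩ := (hb y).1 hy
    exact (hr z hz).1
  have hσ := ord_sUnion hb'
  refine ⟨suc (sUnion b), hσ.suc, (mem_V_suc hσ).2 fun y hy => ?_⟩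
  refine V_mono hσ ?_ y (hr y hy).2
  refine ((hr y hy).1.le_or_lt hσ).resolve_right fun h => ?_
  exact not_mem_self _ (mem_sUnion.2 ⟨_, (hb _).2 ⟨y, hy, rfl⟩, h⟩)

theorem ord_addN {α : M} (hα : Ord α) (k : ℕ) : Ord (addN k α) := by
  induction k with
  | zero => exact hα
  | succ k ih => exact ih.suc

theorem le_addN {α : M} (hα : Ord α) (k : ℕ) : Le α (addN k α) := by
  induction k with
  | zero => exact .inr rfl
  | succ k ih => exact (ord_addN hα (k + 1)).le_trans (.inl (mem_suc_self _)) ih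

theorem six_emp : six (emp : M) = emp := trec_emp

theorem six_suc {α : M} (hα : Ord α) : six (suc α) = addN 6 (six α) := trec_suc hα

theorem mem_six_limit {α : M} (hα : Ord α) (hl : Limit α) {z : M} :
    z ∊ six α ↔ ∃ δ, δ ∊ α ∧ z ∊ six δ := mem_trec_limit hα hl

theorem ord_six {α : M} (hα : Ord α) : Ord (six α) := by
  refine Ord.limitInduction (P := fun α => Ord (six α)) ?_ ?_ ?_ hα
  · rw [six_emp]
    exact ord_emp
  · intro α hα ih
    rw [six_suc hα]
    exact ord_addN ih 6
  · intro α hα hl ih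
    constructor
    · intro y hy z hz
      obtain ⟨δ, hδ, h⟩ := (mem_six_limit hα hl).1 hy
      exact (mem_six_limit hα hl).2 ⟨δ, hδ, (ih δ hδ).mem_trans h hz⟩
    · intro y hy
      obtain ⟨δ, hδ, h⟩ := (mem_six_limit hα hl).1 hy
      exact (ih δ hδ).2 y h

theorem six_mem_suc {α : M} (hα : Ord α) : six α ∊ six (suc α) := by
  rw [six_suc hα]
  exact mem_suc.2 (le_addN (ord_six hα) 5)

theorem six_mono {α β : M} (hα : Ord α) (h : Le β α) : Le (six β) (six α) := by
  refine Ord.limitInduction (P := fun α => ∀ β, Le β α → Le (six β) (six α)) ?_ ?_ ?_ hα β h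
  · rintro β (h | rfl)
    · exact (not_mem_emp h).elim
    · exact .inr rfl
  · rintro α hα ih β (h | rfl)
    · exact (ord_six hα.suc).le_trans (.inl (six_mem_suc hα)) (ih β (mem_suc.1 h))
    · exact .inr rfl
  · rintro α hα hl ih β (h | rfl)
    · exact .inl ((mem_six_limit hα hl).2 ⟨suc β, hl.suc_mem h, six_mem_suc (hα.of_mem h)⟩)
    · exact .inr rfl

/-- Suppose `6α < α`. Then `6(6α) < 6(6α + 1) ≤ 6α`, contrary to the induction hypothesis at `6α`.
-/
theorem le_six {α : M} (hα : Ord α) : Le α (six α) := by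
  refine Ord.induction (P := fun α => Le α (six α)) (fun α hα ih => ?_) hα
  refine (hα.le_or_lt (ord_six hα)).resolve_right fun h => ?_
  have h1 := ih _ h
  have h3 : Le (suc (six α)) α := by
    refine ((hα.of_mem h).suc.le_or_lt hα).resolve_right fun h' => ?_
    rcases mem_suc.1 h' with h' | h'
    · exact mem_asymm h h'
    · exact not_mem_self (six α) (by rwa [← h'] at h ⊢)
  have h4 : six (six α) ∊ six α := by
    have h5 := six_mem_suc (hα.of_mem h)
    rcases six_mono hα h3 with h6 | h6
    · exact (ord_six hα).mem_trans h6 h5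
    · rwa [h6] at h5
  rcases h1 with h1 | h1
  · exact mem_asymm h1 h4
  · exact not_mem_self (six α) (by rwa [← h1] at h4)

theorem W_mono {α β : M} (hα : Ord α) (h : Le β α) : Sub (W β) (W α) :=
  V_mono (ord_six hα) (six_mono hα h)

theorem trans_W {α : M} (hα : Ord α) : Trans (W α) := trans_V (ord_six hα)

theorem W_emp : W (emp : M) = emp := by
  rw [W, six_emp]
  exact trec_emp

theorem Limit.exists_mem_W {α : M} (hα : Ord α) (hl : Limit α) {x : M} (hx : x ∊ W α) :
    ∃ δ, δ ∊ α ∧ x ∊ W δ := by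
  obtain ⟨β, hβ, h⟩ := (mem_V (ord_six hα)).1 hx
  obtain ⟨δ, hδ, h'⟩ := (mem_six_limit hα hl).1 hβ
  exact ⟨δ, hδ, (mem_V (ord_six (hα.of_mem hδ))).2 ⟨β, h', h⟩⟩

theorem exists_mem_W (x : M) : ∃ α, Ord α ∧ x ∊ W α := by
  obtain ⟨α, hα, h⟩ := exists_mem_V x
  exact ⟨α, hα, V_mono (ord_six hα) (le_six hα) x h⟩

theorem exists_mem_W₂ {α β : M} (hα : Ord α) (hβ : Ord β) {x y : M} (hx : x ∊ W α) (hy : y ∊ W β) :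
    ∃ γ, (γ = α ∨ γ = β) ∧ x ∊ W γ ∧ y ∊ W γ := by
  rcases hα.le_or_lt hβ with h | h
  · exact ⟨β, .inr rfl, W_mono hβ h x hx, hy⟩
  · exact ⟨α, .inl rfl, hx, W_mono hα (.inl h) y hy⟩

/-- The marker `6α + 3`. -/
noncomputable def mark (α : M) : M := addN 3 (six α)

instance [Tm f] : Tm fun e => mark (f e) := inferInstanceAs (Tm fun e => addN 3 (six (f e)))

theorem mark_not_mem_W {α : M} (hα : Ord α) : ¬ mark α ∊ W α := by
  intro h
  exact ord_not_mem_V (ord_addN (ord_six hα) 3)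
    (V_mono (ord_addN (ord_six hα) 3) (le_addN (ord_six hα) 3) _ h)

/-- By transitivity of `V_{6α}` the marker would be a member too, but its rank is too large. -/
theorem pr_mark_not_mem_W {α : M} (hα : Ord α) (u : M) : ¬ pr (mark α) u ∊ W α := fun h =>
  mark_not_mem_W hα (trans_W hα _ (trans_W hα _ h _ (mem_upair.2 (.inl rfl))) _
    (mem_upair.2 (.inl rfl)))

/-- Both members of the Kuratowski pair contain the marker, which no element of `V_{6α}` does. -/
theorem not_mem_pr_mark {α : M} (hα : Ord α) {u x : M} (hx : x ∊ W α) : ¬ x ∊ pr (mark α) u := by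
  intro h
  refine mark_not_mem_W hα (trans_W hα _ hx _ ?_)
  rcases mem_upair.1 h with rfl | rfl <;> exact mem_upair.2 (.inl rfl)

theorem pr_mem_V {α x y : M} (hα : Ord α) (hx : x ∊ V α) (hy : y ∊ V α) :
    pr x y ∊ V (suc (suc α)) := by
  rw [mem_V_suc hα.suc]
  have hu (z : M) (hz : z ∊ V α) : upair x z ∊ V (suc α) := by
    rw [mem_V_suc hα]
    intro w hw
    rcases mem_upair.1 hw with rfl | rfl <;> assumption
  intro w hw
  rcases mem_upair.1 hw with rfl | rfl
  · exact hu _ hx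
  · exact hu _ hy

/-- Here the six steps are used up: the marker `6α + 3` first appears in `V_{6α+4}`, the inner pair
is in `V_{6α+2}`, and the outer pair adds two more levels. -/
theorem pr_mark_mem_W {α A B : M} (hα : Ord α) (hA : A ∊ W α) (hB : B ∊ W α) :
    pr (mark α) (pr A B) ∊ W (suc α) := by
  rw [W, six_suc hα]
  have ho := ord_six hα
  refine pr_mem_V (ord_addN ho 4) ?_ ?_
  · exact ord_sub_V (ord_addN ho 4) _ (mem_suc_self _)
  · refine V_mono (ord_addN ho 4) ?_ _ (pr_mem_V ho hA hB)
    exact (ord_addN ho 4).le_trans (.inl (mem_suc_self _)) (.inl (mem_suc_self _))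

end Hierarchy
end Tern

namespace Tern
open FirstOrder FirstOrder.Language

/-! ### The relation `S` in a model -/

section Levels

set_option linter.unusedSectionVars false

variable {M : Type} [LMem.Structure M] [Nonempty M]

/-- `x` is finite in the sense of Kuratowski. -/
abbrev KFinite (x : M) : Prop :=
  ∀ f, (∀ e, e = emp → e ∊ f) ∧ (∀ y u z, y ∊ f ∧ u ∊ x ∧ z = ins u y → z ∊ f) → x ∊ f

/-- `A = (D, R, E)` is an `(S, ∈)`-structure. -/
abbrev IsStr (A D R E : M) : Prop :=
  A = tr D R E ∧ KFinite D ∧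
  (∀ t, t ∊ R → ∃ a b c, a ∊ D ∧ b ∊ D ∧ c ∊ D ∧ t = tr a b c) ∧
  (∀ t, t ∊ E → ∃ a b, a ∊ D ∧ b ∊ D ∧ t = pr a b) ∧
  (∀ a b c, a ∊ D ∧ b ∊ D ∧ c ∊ D ∧ pr a b ∊ E → tr a b c ∊ R)

/-- `(D', R', E')` extends `(D, R, E)` neutrally by `v`. -/
abbrev NeutralExt (D R E D' R' E' v : M) : Prop :=
  ¬ v ∊ D ∧ D' = ins v D ∧
  (∀ a b c, a ∊ D ∧ b ∊ D ∧ c ∊ D → (tr a b c ∊ R ↔ tr a b c ∊ R')) ∧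
  (∀ a b, a ∊ D ∧ b ∊ D → (pr a b ∊ E ↔ pr a b ∊ E')) ∧
  (∀ x, x ∊ D' → ¬ pr x v ∊ E' ∧ ¬ pr v x ∊ E')

/-- `E` is the membership relation on `D`. -/
abbrev Absolute (D E : M) : Prop := ∀ a b, a ∊ D ∧ b ∊ D → (a ∊ b ↔ pr a b ∊ E)

/-- `R` is the restriction of `s` to `D`. -/
abbrev Restr (D R s : M) : Prop :=
  ∀ a b c, a ∊ D ∧ b ∊ D ∧ c ∊ D → (tr a b c ∊ R ↔ tr a b c ∊ s)

/-- `y` is the image of `x`, where `v` is sent to `(κ, (A, B))`. -/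
abbrev Image (D A B v κ x y : M) : Prop := (x ∊ D ∧ y = x) ∨ (x = v ∧ y = pr κ (pr A B))

/-- The data from which the level after `s` adds a new element. -/
abbrev Datum (w s A D R E B D' R' E' v : M) : Prop :=
  IsStr A D R E ∧ IsStr B D' R' E' ∧ NeutralExt D R E D' R' E' v ∧ Sub D w ∧ Sub D' w ∧
    Absolute D E ∧ Restr D R s

/-- `(a, b, c)` is not excluded from the level after `s`. -/
abbrev StepCond (w κ s a b c : M) : Prop :=
  (a ∊ w ∧ b ∊ w ∧ c ∊ w → tr a b c ∊ s) ∧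
  ∀ A D R E B D' R' E' v, Datum w s A D R E B D' R' E' v →
    ∀ x y z, Image D A B v κ x a ∧ Image D A B v κ y b ∧ Image D A B v κ z c → tr x y z ∊ R'

/-- The triples of elements of `w'` that are not excluded from the level after `s`. -/
noncomputable abbrev stepSet (w w' κ s : M) : M :=
  cls fun t => ∃ a b c, t = tr a b c ∧ a ∊ w' ∧ b ∊ w' ∧ c ∊ w' ∧ StepCond w κ s a b c

/-- The level after the level `s` with index `α`. -/
noncomputable def sStep (α s : M) : M := stepSet (W α) (V (addN 6 (six α))) (mark α) s

/-- The relation `S_α`. -/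
noncomputable def sLev (α : M) : M := trec sStep α

variable [hM : M ⊨ ZFminusInfPlus]

set_option synthInstance.maxSize 2000 in
instance : TmFun (sStep : M → M → M) :=
  ⟨inferInstanceAs (Tm fun e : ℕ → M =>
    stepSet (W (e 0)) (V (addN 6 (six (e 0)))) (mark (e 0)) (e 1))⟩

instance {f : (ℕ → M) → M} [Tm f] : Tm fun e => sLev (f e) :=
  inferInstanceAs (Tm fun e => trec sStep (f e))

theorem tr_mem_V {α a b c : M} (hα : Ord α) (ha : a ∊ V α) (hb : b ∊ V α) (hc : c ∊ V α) :
    tr a b c ∊ V (addN 4 α) :=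
  pr_mem_V (ord_addN hα 2) (V_mono (ord_addN hα 2) (le_addN hα 2) _ ha) (pr_mem_V hα hb hc)

-- Triples of elements of `V_β` lie in `V_{β+4}`, so separation turns the class into a set.
set_option synthInstance.maxHeartbeats 400000 in
set_option synthInstance.maxSize 2000 in
theorem mem_stepSet {w β κ s t : M} (hβ : Ord β) : t ∊ stepSet w (V β) κ s ↔
    ∃ a b c, t = tr a b c ∧ a ∊ V β ∧ b ∊ V β ∧ c ∊ V β ∧ StepCond w κ s a b c := by
  refine IsSet.mem_cls ?_
  have : Dfn fun e : ℕ → M => ∃ a b c, e 0 = tr a b c ∧ a ∊ V β ∧ b ∊ V β ∧ c ∊ V β ∧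
    StepCond w κ s a b c := inferInstance
  obtain ⟨z, hz⟩ := isSet_sep (P := fun t => ∃ a b c, t = tr a b c ∧ a ∊ V β ∧ b ∊ V β ∧
    c ∊ V β ∧ StepCond w κ s a b c) (V (addN 4 β)) (hP := this)
  refine ⟨z, fun t => (hz t).trans (and_iff_right_of_imp ?_)⟩
  rintro ⟨a, b, c, rfl, ha, hb, hc, -⟩
  exact tr_mem_V hβ ha hb hc

theorem mem_sLev_suc {α t : M} (hα : Ord α) : t ∊ sLev (suc α) ↔
    ∃ a b c, t = tr a b c ∧ a ∊ W (suc α) ∧ b ∊ W (suc α) ∧ c ∊ W (suc α) ∧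
      StepCond (W α) (mark α) (sLev α) a b c := by
  have h : sLev (suc α) = stepSet (W α) (V (addN 6 (six α))) (mark α) (sLev α) := trec_suc hα
  rw [h, mem_stepSet (ord_addN (ord_six hα) 6), ← six_suc hα]
  rfl

theorem tr_mem_sLev_suc {α a b c : M} (hα : Ord α) : tr a b c ∊ sLev (suc α) ↔
    a ∊ W (suc α) ∧ b ∊ W (suc α) ∧ c ∊ W (suc α) ∧
      StepCond (W α) (mark α) (sLev α) a b c := by
  rw [mem_sLev_suc hα]
  constructor
  · rintro ⟨a', b', c', h, h'⟩
    obtain ⟨rfl, rfl, rfl⟩ := tr_inj.1 h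
    exact h'
  · exact fun h => ⟨a, b, c, rfl, h⟩

theorem sLev_emp : sLev (emp : M) = emp := trec_emp

theorem mem_sLev_limit {α : M} (hα : Ord α) (hl : Limit α) {z : M} :
    z ∊ sLev α ↔ ∃ δ, δ ∊ α ∧ z ∊ sLev δ := mem_trec_limit hα hl

theorem Image.eq_of_mem_W {α D A B v x a : M} (hα : Ord α) (h : Image D A B v (mark α) x a)
    (ha : a ∊ W α) : x = a ∧ a ∊ D := by
  rcases h with ⟨hx, rfl⟩ | ⟨-, rfl⟩
  · exact ⟨rfl, hx⟩
  · exact (pr_mark_not_mem_W hα _ ha).elim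

/-- On triples from `V_{6α}` the map `f` can only be the identity on `A`, where the structures `A`,
`B` and the level `s` agree. The two clauses of the definition are thus compatible. -/
theorem stepCond_of_mem_W {α s a b c : M} (hα : Ord α) (ha : a ∊ W α) (hb : b ∊ W α)
    (hc : c ∊ W α) : StepCond (W α) (mark α) s a b c ↔ tr a b c ∊ s := by
  refine ⟨fun h => h.1 ⟨ha, hb, hc⟩, fun h => ⟨fun _ => h, ?_⟩⟩
  rintro A D R E B D' R' E' v ⟨-, -, hn, -, -, -, hR⟩ x y z ⟨hx, hy, hz⟩
  obtain ⟨rfl, hx⟩ := hx.eq_of_mem_W hα ha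
  obtain ⟨rfl, hy⟩ := hy.eq_of_mem_W hα hb
  obtain ⟨rfl, hz⟩ := hz.eq_of_mem_W hα hc
  exact (hn.2.2.1 _ _ _ ⟨hx, hy, hz⟩).1 ((hR _ _ _ ⟨hx, hy, hz⟩).2 h)

theorem exists_of_mem_sLev {α t : M} (hα : Ord α) (ht : t ∊ sLev α) :
    ∃ a b c, t = tr a b c ∧ a ∊ W α ∧ b ∊ W α ∧ c ∊ W α := by
  refine Ord.limitInduction (P := fun α => ∀ t, t ∊ sLev α →
    ∃ a b c, t = tr a b c ∧ a ∊ W α ∧ b ∊ W α ∧ c ∊ W α) ?_ ?_ ?_ hα t ht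
  · intro t ht
    exact (not_mem_emp (sLev_emp (M := M) ▸ ht)).elim
  · intro α hα _ t ht
    obtain ⟨a, b, c, h, ha, hb, hc, -⟩ := (mem_sLev_suc hα).1 ht
    exact ⟨a, b, c, h, ha, hb, hc⟩
  · intro α hα hl ih t ht
    obtain ⟨δ, hδ, ht⟩ := (mem_sLev_limit hα hl).1 ht
    obtain ⟨a, b, c, h, ha, hb, hc⟩ := ih δ hδ t ht
    have := W_mono hα (.inl hδ)
    exact ⟨a, b, c, h, this _ ha, this _ hb, this _ hc⟩

theorem mem_W_of_tr_mem_sLev {α a b c : M} (hα : Ord α) (h : tr a b c ∊ sLev α) :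
    a ∊ W α ∧ b ∊ W α ∧ c ∊ W α := by
  obtain ⟨a', b', c', e, h⟩ := exists_of_mem_sLev hα h
  obtain ⟨rfl, rfl, rfl⟩ := tr_inj.1 e
  exact h

/-- A successor step changes nothing on old triples. At a limit, the level witnessing membership is
compared with `γ`, and the larger of the two is below `α`. -/
theorem sLev_coherent {α γ a b c : M} (hα : Ord α) (hγ : Le γ α) (ha : a ∊ W γ) (hb : b ∊ W γ)
    (hc : c ∊ W γ) : tr a b c ∊ sLev α ↔ tr a b c ∊ sLev γ := by
  refine Ord.limitInduction (P := fun α => ∀ γ, Le γ α → ∀ a b c, a ∊ W γ → b ∊ W γ → c ∊ W γ →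
    (tr a b c ∊ sLev α ↔ tr a b c ∊ sLev γ)) ?_ ?_ ?_ hα γ hγ a b c ha hb hc
  · rintro γ (hγ | rfl)
    · exact (not_mem_emp hγ).elim
    · exact fun _ _ _ _ _ _ => Iff.rfl
  · rintro α hα ih γ (hγ | rfl) a b c ha hb hc
    · have hγ : Le γ α := mem_suc.1 hγ
      rw [← ih γ hγ a b c ha hb hc, tr_mem_sLev_suc hα]
      have h1 := W_mono hα hγ
      have h2 := W_mono hα.suc (.inl (mem_suc_self α))
      have ha := h1 _ ha
      have hb := h1 _ hb
      have hc := h1 _ hc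
      rw [stepCond_of_mem_W hα ha hb hc]
      simp [h2 _ ha, h2 _ hb, h2 _ hc]
    · rfl
  · rintro α hα hl ih γ (hγ | rfl) a b c ha hb hc
    · rw [mem_sLev_limit hα hl]
      refine ⟨?_, fun h => ⟨γ, hγ, h⟩⟩
      rintro ⟨δ, hδ, h⟩
      rcases (hα.of_mem hγ).le_or_lt (hα.of_mem hδ) with h1 | h1
      · exact (ih δ hδ γ h1 a b c ha hb hc).1 h
      · obtain ⟨ha, hb, hc⟩ := mem_W_of_tr_mem_sLev (hα.of_mem hδ) h
        exact (ih γ hγ δ (.inl h1) a b c ha hb hc).2 h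
    · rfl

/-- The union of the relations `S_α`. -/
def SetS (x y z : M) : Prop := ∃ α, Ord α ∧ tr x y z ∊ sLev α

theorem setS_iff {α a b c : M} (hα : Ord α) (ha : a ∊ W α) (hb : b ∊ W α) (hc : c ∊ W α) :
    SetS a b c ↔ tr a b c ∊ sLev α := by
  refine ⟨?_, fun h => ⟨α, hα, h⟩⟩
  rintro ⟨β, hβ, h⟩
  rcases hα.le_or_lt hβ with h1 | h1
  · exact (sLev_coherent hβ h1 ha hb hc).1 h
  · obtain ⟨ha, hb, hc⟩ := mem_W_of_tr_mem_sLev hβ h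
    exact (sLev_coherent hα (.inl h1) ha hb hc).2 h

/-- If the new element of a datum were `a` or `b`, it would stand in the membership relation to an
element of `V_{6α}` or to itself, which is impossible. So both come from `A`; absoluteness transfers
`a ∈ b` to the structures, and the defining implication in `B` gives `S`. -/
theorem stepCond_of_mem {α a b c : M} (hα : Ord α) (hab : a ∊ b)
    (h : a ∊ W α → b ∊ W α → c ∊ W α → tr a b c ∊ sLev α) :
    StepCond (W α) (mark α) (sLev α) a b c := by
  refine ⟨fun h' => h h'.1 h'.2.1 h'.2.2, ?_⟩
  rintro A D R E B D' R' E' v ⟨-, hB, hn, hD, -, hE, -⟩ x y z ⟨hx, hy, hz⟩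
  have hz' : z ∊ D' := by
    rw [hn.2.1, mem_ins]
    exact hz.imp And.left And.left
  rcases hx with ⟨hx, rfl⟩ | ⟨rfl, rfl⟩
  · rcases hy with ⟨hy, rfl⟩ | ⟨rfl, rfl⟩
    · refine hB.2.2.2.2 _ _ _ ⟨?_, ?_, hz', ?_⟩
      · rw [hn.2.1, mem_ins]
        exact .inl hx
      · rw [hn.2.1, mem_ins]
        exact .inl hy
      · exact (hn.2.2.2.1 _ _ ⟨hx, hy⟩).1 ((hE _ _ ⟨hx, hy⟩).1 hab)
    · exact (not_mem_pr_mark hα (hD _ hx) hab).elim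
  · rcases hy with ⟨hy, rfl⟩ | ⟨rfl, rfl⟩
    · exact (pr_mark_not_mem_W hα _ (trans_W hα _ (hD _ hy) _ hab)).elim
    · exact (not_mem_self _ hab).elim

theorem setS_of_mem {a b : M} (hab : a ∊ b) (c : M) : SetS a b c := by
  have key (α : M) (hα : Ord α) : ∀ a b c, a ∊ W α → b ∊ W α → c ∊ W α → a ∊ b →
      tr a b c ∊ sLev α := by
    refine Ord.limitInduction (P := fun α => ∀ a b c, a ∊ W α → b ∊ W α → c ∊ W α → a ∊ b →
      tr a b c ∊ sLev α) ?_ ?_ ?_ hα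
    · intro a b c ha
      exact (not_mem_emp (W_emp (M := M) ▸ ha)).elim
    · intro α hα ih a b c ha hb hc hab
      exact (tr_mem_sLev_suc hα).2
        ⟨ha, hb, hc, stepCond_of_mem hα hab fun ha hb hc => ih a b c ha hb hc hab⟩
    · intro α hα hl ih a b c ha hb hc hab
      -- It is enough to place `b` and `c` below the limit; `a` follows by transitivity.
      obtain ⟨δ, hδ, hb⟩ := hl.exists_mem_W hα hb
      obtain ⟨ε, hε, hc⟩ := hl.exists_mem_W hα hc
      obtain ⟨γ, hγ, hb, hc⟩ := exists_mem_W₂ (hα.of_mem hδ) (hα.of_mem hε) hb hc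
      have hγ : γ ∊ α := by rcases hγ with rfl | rfl <;> assumption
      exact (mem_sLev_limit hα hl).2
        ⟨γ, hγ, ih γ hγ a b c (trans_W (hα.of_mem hγ) _ hb _ hab) hb hc hab⟩
  obtain ⟨α, hα, h⟩ := exists_mem_W (upair b c)
  have hb := trans_W hα _ h _ (mem_upair.2 (.inl rfl))
  have hc := trans_W hα _ h _ (mem_upair.2 (.inr rfl))
  exact ⟨α, hα, key α hα a b c (trans_W hα _ hb _ hab) hb hc hab⟩

end Levels
end Tern

namespace Tern
open FirstOrder FirstOrder.Language

/-! ### Neutral extensions in a model -/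

section Extensions

set_option linter.unusedSectionVars false

variable {M : Type} [LMem.Structure M] [Nonempty M] [hM : M ⊨ ZFminusInfPlus]

theorem isSet_finset (s : Finset M) : IsSet fun w => w ∈ s := by
  classical
  induction s using Finset.induction_on with
  | empty => exact ⟨emp, fun w => by simp [not_mem_emp]⟩
  | insert a s _ ih =>
    obtain ⟨z, hz⟩ := ih
    exact ⟨ins a z, fun w => by simp only [mem_ins, hz, Finset.mem_insert, or_comm]⟩

theorem isSet_finite {P : M → Prop} (h : {w | P w}.Finite) : IsSet P := by
  obtain ⟨z, hz⟩ := isSet_finset h.toFinset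
  exact ⟨z, fun w => by simp [hz]⟩

/-- The model may contain internally finite sets that are infinite from outside. Only the converse
direction is needed: truly finite sets are finite internally. -/
theorem kFinite_of_finite {D : M} (h : {w | w ∊ D}.Finite) : KFinite D := by
  classical
  rintro f ⟨h0, hs⟩
  have key (t : Finset M) : (∀ w, w ∈ t → w ∊ D) → ∀ y, (∀ w, w ∊ y ↔ w ∈ t) → y ∊ f := by
    induction t using Finset.induction_on with
    | empty => exact fun _ y hy => h0 y (eq_emp_iff.2 fun z hz => by simpa using (hy z).1 hz)
    | insert a t _ ih =>
      intro ht y hy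
      obtain ⟨z, hz⟩ := isSet_finset t
      refine hs z a y ⟨ih (fun w hw => ht w (by simp [hw])) z hz, ht a (by simp), mext fun w => ?_⟩
      rw [hy, mem_ins, hz, Finset.mem_insert, or_comm]
  exact key h.toFinset (by simp) D (by simp)

/-- The given elements and the pattern are coded by structures `A` and `B`. At a level containing
both, `(6α+3, (A, B))` is the required element, since clause 2 gives it exactly the `S`-facts of
`B`. -/
theorem exists_setS_extension {ι : Type} [Finite ι] (a : ι → M)
    (P : Option ι → Option ι → Option ι → Prop) (ha : Function.Injective a)
    (hP : ∀ i j k, P (some i) (some j) (some k) ↔ SetS (a i) (a j) (a k))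
    (hmem : ∀ i j, a i ∊ a j → P (some i) (some j) none) :
    ∃ b, (∀ i, a i ≠ b ∧ ¬ a i ∊ b ∧ ¬ b ∊ a i) ∧
      ∀ i j k, P i j k ↔ SetS (i.elim b a) (j.elim b a) (k.elim b a) := by
  obtain ⟨D, hD⟩ := isSet_finite (P := fun w => ∃ i, w = a i)
    ((Set.finite_range a).subset fun w ⟨i, h⟩ => ⟨i, h.symm⟩)
  -- The set `D` of given elements serves as the additional element of `B`: it is available and not
  -- a member of itself.
  let u : Option ι → M := fun o => o.elim D a
  have hvD : ¬ D ∊ D := not_mem_self D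
  have hu : Function.Injective u := by
    rintro (_ | i) (_ | j) h
    · rfl
    · exact (hvD (by nth_rewrite 1 [show D = a j from h]; exact (hD _).2 ⟨j, rfl⟩)).elim
    · exact (hvD (by nth_rewrite 1 [show D = a i from h.symm]; exact (hD _).2 ⟨i, rfl⟩)).elim
    · exact congrArg some (ha h)
  have hD' (w : M) : w ∊ ins D D ↔ ∃ o, w = u o := by
    rw [mem_ins, hD, Option.exists, or_comm]
    rfl
  obtain ⟨R, hR⟩ := isSet_finite (M := M)
    (P := fun w => ∃ t : ι × ι × ι, P (some t.1) (some t.2.1) (some t.2.2) ∧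
      w = tr (a t.1) (a t.2.1) (a t.2.2))
    ((Set.finite_range fun t : ι × ι × ι => tr (a t.1) (a t.2.1) (a t.2.2)).subset
      fun w ⟨t, _, h⟩ => ⟨t, h.symm⟩)
  obtain ⟨R', hR'⟩ := isSet_finite (M := M)
    (P := fun w => ∃ t : Option ι × Option ι × Option ι, P t.1 t.2.1 t.2.2 ∧
      w = tr (u t.1) (u t.2.1) (u t.2.2))
    ((Set.finite_range fun t : Option ι × Option ι × Option ι =>
      tr (u t.1) (u t.2.1) (u t.2.2)).subset fun w ⟨t, _, h⟩ => ⟨t, h.symm⟩)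
  -- The same `E`, true membership on `D`, is used in `A` and in `B`. It makes `A` absolute and the
  -- extension neutral.
  obtain ⟨E, hE⟩ := isSet_finite (M := M)
    (P := fun w => ∃ t : ι × ι, a t.1 ∊ a t.2 ∧ w = pr (a t.1) (a t.2))
    ((Set.finite_range fun t : ι × ι => pr (a t.1) (a t.2)).subset
      fun w ⟨t, _, h⟩ => ⟨t, h.symm⟩)
  have hR₁ (i j k : ι) : tr (a i) (a j) (a k) ∊ R ↔ P (some i) (some j) (some k) := by
    rw [hR]
    refine ⟨?_, fun h => ⟨(i, j, k), h, rfl⟩⟩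
    rintro ⟨⟨i', j', k'⟩, h, e⟩
    obtain ⟨h1, h2, h3⟩ := tr_inj.1 e
    rwa [ha h1, ha h2, ha h3]
  have hR₂ (i j k : Option ι) : tr (u i) (u j) (u k) ∊ R' ↔ P i j k := by
    rw [hR']
    refine ⟨?_, fun h => ⟨(i, j, k), h, rfl⟩⟩
    rintro ⟨⟨i', j', k'⟩, h, e⟩
    obtain ⟨h1, h2, h3⟩ := tr_inj.1 e
    rwa [hu h1, hu h2, hu h3]
  have hE₁ (x y : M) : pr x y ∊ E ↔ x ∊ D ∧ y ∊ D ∧ x ∊ y := by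
    rw [hE, hD, hD]
    constructor
    · rintro ⟨⟨i, j⟩, h, e⟩
      obtain ⟨rfl, rfl⟩ := pr_inj.1 e
      exact ⟨⟨i, rfl⟩, ⟨j, rfl⟩, h⟩
    · rintro ⟨⟨i, rfl⟩, ⟨j, rfl⟩, h⟩
      exact ⟨(i, j), h, rfl⟩
  let A := tr D R E
  let B := tr (ins D D) R' E
  -- The level must contain both codes and include both domains; all four sets are bounded together.
  obtain ⟨α, hα, hW⟩ := exists_mem_W (upair (upair A B) (upair D (ins D D)))
  have hW₁ := trans_W hα _ hW _ (mem_upair.2 (.inl rfl))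
  have hW₂ := trans_W hα _ hW _ (mem_upair.2 (.inr rfl))
  have hAW : A ∊ W α := trans_W hα _ hW₁ _ (mem_upair.2 (.inl rfl))
  have hBW : B ∊ W α := trans_W hα _ hW₁ _ (mem_upair.2 (.inr rfl))
  have hDW : Sub D (W α) := trans_W hα _ (trans_W hα _ hW₂ _ (mem_upair.2 (.inl rfl)))
  have hDW' : Sub (ins D D) (W α) := trans_W hα _ (trans_W hα _ hW₂ _ (mem_upair.2 (.inr rfl)))
  have haW (i : ι) : a i ∊ W α := hDW _ ((hD _).2 ⟨i, rfl⟩)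
  have hPS (i j k : ι) :
      P (some i) (some j) (some k) ↔ tr (a i) (a j) (a k) ∊ sLev α :=
    (hP i j k).trans (setS_iff hα (haW i) (haW j) (haW k))
  have hAstr : IsStr A D R E := by
    refine ⟨rfl, kFinite_of_finite ?_, fun t ht => ?_, fun t ht => ?_, ?_⟩
    · exact (Set.finite_range a).subset fun w hw => ((hD w).1 hw).imp fun _ => Eq.symm
    · obtain ⟨⟨i, j, k⟩, -, rfl⟩ := (hR t).1 ht
      exact ⟨_, _, _, (hD _).2 ⟨i, rfl⟩, (hD _).2 ⟨j, rfl⟩, (hD _).2 ⟨k, rfl⟩, rfl⟩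
    · obtain ⟨⟨i, j⟩, -, rfl⟩ := (hE t).1 ht
      exact ⟨_, _, (hD _).2 ⟨i, rfl⟩, (hD _).2 ⟨j, rfl⟩, rfl⟩
    · rintro x y z ⟨hx, hy, hz, h⟩
      obtain ⟨i, rfl⟩ := (hD x).1 hx
      obtain ⟨j, rfl⟩ := (hD y).1 hy
      obtain ⟨k, rfl⟩ := (hD z).1 hz
      rw [hR₁, hP]
      exact setS_of_mem ((hE₁ _ _).1 h).2.2 _
  have hBstr : IsStr B (ins D D) R' E := by
    refine ⟨rfl, kFinite_of_finite ?_, fun t ht => ?_, fun t ht => ?_, ?_⟩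
    · exact (Set.finite_range u).subset fun w hw => ((hD' w).1 hw).imp fun _ => Eq.symm
    · obtain ⟨⟨i, j, k⟩, -, rfl⟩ := (hR' t).1 ht
      exact ⟨_, _, _, (hD' _).2 ⟨i, rfl⟩, (hD' _).2 ⟨j, rfl⟩, (hD' _).2 ⟨k, rfl⟩, rfl⟩
    · obtain ⟨⟨i, j⟩, -, rfl⟩ := (hE t).1 ht
      exact ⟨_, _, (hD' _).2 ⟨some i, rfl⟩, (hD' _).2 ⟨some j, rfl⟩, rfl⟩
    · rintro x y z ⟨-, -, hz, h⟩
      obtain ⟨hx, hy, h⟩ := (hE₁ _ _).1 h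
      obtain ⟨i, rfl⟩ := (hD x).1 hx
      obtain ⟨j, rfl⟩ := (hD y).1 hy
      obtain ⟨k, rfl⟩ := (hD' z).1 hz
      refine (hR₂ (some i) (some j) k).2 ?_
      cases k with
      | none => exact hmem i j h
      | some k => exact (hP i j k).2 (setS_of_mem h _)
  have hdat : Datum (W α) (sLev α) A D R E B (ins D D) R' E D := by
    refine ⟨hAstr, hBstr, ⟨hvD, rfl, ?_, fun _ _ _ => Iff.rfl, ?_⟩, hDW, hDW', ?_, ?_⟩
    · rintro x y z ⟨hx, hy, hz⟩
      obtain ⟨i, rfl⟩ := (hD x).1 hx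
      obtain ⟨j, rfl⟩ := (hD y).1 hy
      obtain ⟨k, rfl⟩ := (hD z).1 hz
      exact (hR₁ i j k).trans (hR₂ (some i) (some j) (some k)).symm
    · exact fun x _ => ⟨fun h => hvD ((hE₁ _ _).1 h).2.1, fun h => hvD ((hE₁ _ _).1 h).1⟩
    · rintro x y ⟨hx, hy⟩
      rw [hE₁]
      exact ⟨fun h => ⟨hx, hy, h⟩, fun h => h.2.2⟩
    · rintro x y z ⟨hx, hy, hz⟩
      obtain ⟨i, rfl⟩ := (hD x).1 hx
      obtain ⟨j, rfl⟩ := (hD y).1 hy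
      obtain ⟨k, rfl⟩ := (hD z).1 hz
      exact (hR₁ i j k).trans (hPS i j k)
  let b := pr (mark α) (pr A B)
  have hbW : ¬ b ∊ W α := pr_mark_not_mem_W hα _
  let f : Option ι → M := fun o => o.elim b a
  have himg (o : Option ι) : Image D A B D (mark α) (u o) (f o) := by
    cases o with
    | none => exact .inr ⟨rfl, rfl⟩
    | some i => exact .inl ⟨(hD _).2 ⟨i, rfl⟩, rfl⟩
  have hfW (o : Option ι) : f o ∊ W (suc α) := by
    cases o with
    | none => exact pr_mark_mem_W hα hAW hBW
    | some i => exact W_mono hα.suc (.inl (mem_suc_self α)) _ (haW i)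
  refine ⟨b, fun i => ⟨fun h => hbW (h ▸ haW i), not_mem_pr_mark hα (haW i), fun h => ?_⟩, ?_⟩
  · exact hbW (trans_W hα _ (haW i) _ h)
  intro i j k
  change P i j k ↔ SetS (f i) (f j) (f k)
  rw [setS_iff hα.suc (hfW i) (hfW j) (hfW k), tr_mem_sLev_suc hα]
  constructor
  · refine fun h => ⟨hfW i, hfW j, hfW k, ?_, ?_⟩
    · rintro ⟨hi, hj, hk⟩
      rcases i with _ | i
      · exact (hbW hi).elim
      rcases j with _ | j
      · exact (hbW hj).elim
      rcases k with _ | k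
      · exact (hbW hk).elim
      exact (hPS i j k).1 h
    · rintro A₁ D₁ R₁ E₁ B₁ D₁' R₁' E₁' v₁ ⟨hA₁, hB₁, hn, hD₁, -, -, hr⟩ x y z ⟨hx, hy, hz⟩
      -- Another datum might exclude the triple. With the same codes it has the same components and
      -- the same `v`; with different codes its new element is not `b`, so it speaks only about old
      -- elements, on which it agrees with the level.
      by_cases hAB : A₁ = A ∧ B₁ = B
      · obtain ⟨rfl, rfl⟩ := hAB
        obtain ⟨rfl, rfl, rfl⟩ := tr_inj.1 hA₁.1
        obtain ⟨rfl, rfl, rfl⟩ := tr_inj.1 hB₁.1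
        have hv : v₁ = D := by
          have : v₁ ∊ ins D D := hn.2.1 ▸ mem_ins.2 (.inr rfl)
          exact (mem_ins.1 this).resolve_left hn.1
        subst hv
        have key (o : Option ι) (x : M) (h : Image v₁ A B v₁ (mark α) x (f o)) : x = u o := by
          cases o with
          | none =>
            rcases h with ⟨h, h'⟩ | ⟨h, -⟩
            · have h₁ := hDW _ h
              rw [← h'] at h₁
              exact (hbW h₁).elim
            · exact h
          | some i => exact (h.eq_of_mem_W hα (haW i)).1
        rw [key i x hx, key j y hy, key k z hz, hR₂]
        exact h
      · have key (o : Option ι) (x : M) (h : Image D₁ A₁ B₁ v₁ (mark α) x (f o)) :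
            ∃ i, o = some i ∧ x = a i ∧ a i ∊ D₁ := by
          cases o with
          | none =>
            rcases h with ⟨h, h'⟩ | ⟨-, h⟩
            · have h₁ := hD₁ _ h
              rw [← h'] at h₁
              exact (hbW h₁).elim
            · obtain ⟨h1, h2⟩ := pr_inj.1 (pr_inj.1 h).2
              exact (hAB ⟨h1.symm, h2.symm⟩).elim
          | some i => exact ⟨i, rfl, h.eq_of_mem_W hα (haW i)⟩
        obtain ⟨i, rfl, rfl, hi⟩ := key i x hx
        obtain ⟨j, rfl, rfl, hj⟩ := key j y hy
        obtain ⟨k, rfl, rfl, hk⟩ := key k z hz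
        exact (hn.2.2.1 _ _ _ ⟨hi, hj, hk⟩).1 ((hr _ _ _ ⟨hi, hj, hk⟩).2 ((hPS i j k).1 h))
  · intro h
    exact (hR₂ i j k).1 (h.2.2.2.2 _ _ _ _ _ _ _ _ _ hdat _ _ _ ⟨himg i, himg j, himg k⟩)

theorem forall_setS_iff {a b : M} : (∀ c, SetS a b c) ↔ a ∊ b := by
  classical
  refine ⟨fun h => ?_, fun h => setS_of_mem h⟩
  by_contra hab
  let t : Set M := {a, b}
  let x : t := ⟨a, by simp [t]⟩
  let y : t := ⟨b, by simp [t]⟩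
  -- The pattern lets `S(i, j, new)` hold only where membership demands it, so at the new element
  -- `S(a, b, ·)` fails when `a ∉ b`. Using the set `{a, b}` as index also covers `a = b`.
  obtain ⟨c, -, hc⟩ := exists_setS_extension (Subtype.val : t → M)
    (fun i j k => match i, j, k with
      | some i, some j, some k => SetS i.1 j.1 k.1
      | some i, some j, none => i.1 ∊ j.1
      | _, _, _ => False) Subtype.val_injective (fun _ _ _ => Iff.rfl) (fun _ _ => id)
  exact hab ((hc (some x) (some y) none).2 (h c))

end Extensions
end Tern

namespace Tern
open FirstOrder FirstOrder.Language

/-! ### The defining formulas of `S` -/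

section Translation

set_option linter.unusedSectionVars false

variable {M : Type} [LMem.Structure M] [Nonempty M] [hM : M ⊨ ZFminusInfPlus]
  {d : ℕ} {e : ℕ → M}

theorem eq_ins_iff {y u x : M} : y = ins u x ↔ ∀ z, z ∊ y ↔ z ∊ x ∨ z = u :=
  ⟨fun h _ => h ▸ mem_ins, fun h => mext fun z => (h z).trans mem_ins.symm⟩

theorem eq_pow_iff {y x : M} : y = pow x ↔ ∀ z, z ∊ y ↔ Sub z x :=
  ⟨fun h _ => h ▸ mem_pow, fun h => mext fun z => (h z).trans mem_pow.symm⟩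

theorem eq_upair_iff {p x y : M} : p = upair x y ↔ ∀ z, z ∊ p ↔ z = x ∨ z = y :=
  ⟨fun h _ => h ▸ mem_upair, fun h => mext fun z => (h z).trans mem_upair.symm⟩

theorem ev_isEmpty {x : ℕ} (hx : x < d) : ev (isEmpty x) d e ↔ e x = emp := by
  simp (disch := omega) only [isEmpty, ev_all, ev_not, ev_mem, Function.update_of_ne,
    Function.update_self, eq_emp_iff]

theorem ev_isInsert {y u x : ℕ} (hy : y < d) (hu : u < d) (hx : x < d) :
    ev (isInsert y u x) d e ↔ e y = ins (e u) (e x) := by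
  simp (disch := omega) only [isInsert, ev_all, ev_iff, ev_or, ev_eq, ev_mem,
    Function.update_of_ne, Function.update_self, eq_ins_iff]

theorem ev_isSucc {y x : ℕ} (hy : y < d) (hx : x < d) :
    ev (isSucc y x) d e ↔ e y = suc (e x) := ev_isInsert hy hx hx

theorem ev_isAdd (k : ℕ) {d : ℕ} {e : ℕ → M} {y x : ℕ} (hy : y < d) (hx : x < d) :
    ev (isAdd k y x) d e ↔ e y = addN k (e x) := by
  induction k generalizing d e y with
  | zero => exact ev_eq hy hx
  | succ k ih =>
    simp (disch := omega) only [isAdd, ev_ex, ev_and, ih, ev_isSucc, Function.update_of_ne,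
      Function.update_self, exists_eq_left, addN]

theorem ev_isPower {y x : ℕ} (hy : y < d) (hx : x < d) :
    ev (isPower y x) d e ↔ e y = pow (e x) := by
  simp (disch := omega) only [isPower, ev_all, ev_iff, ev_subset, ev_mem,
    Function.update_of_ne, Function.update_self, eq_pow_iff]

theorem ev_isUPair {p x y : ℕ} (hp : p < d) (hx : x < d) (hy : y < d) :
    ev (isUPair p x y) d e ↔ e p = upair (e x) (e y) := by
  simp (disch := omega) only [isUPair, ev_all, ev_iff, ev_or, ev_eq, ev_mem,
    Function.update_of_ne, Function.update_self, eq_upair_iff]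

theorem ev_isPair {p x y : ℕ} (hp : p < d) (hx : x < d) (hy : y < d) :
    ev (isPair p x y) d e ↔ e p = pr (e x) (e y) := by
  simp (disch := omega) only [isPair, ev_ex, ev_and, ev_isUPair, Function.update_of_ne,
    Function.update_self, exists_eq_left, exists_and_left, pr]

theorem ev_isTriple {t x y z : ℕ} (ht : t < d) (hx : x < d) (hy : y < d) (hz : z < d) :
    ev (isTriple t x y z) d e ↔ e t = tr (e x) (e y) (e z) := by
  simp (disch := omega) only [isTriple, ev_ex, ev_and, ev_isPair, Function.update_of_ne,
    Function.update_self, exists_eq_left, tr]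

theorem ev_pairMem {x y r : ℕ} (hx : x < d) (hy : y < d) (hr : r < d) :
    ev (pairMem x y r) d e ↔ pr (e x) (e y) ∊ e r := by
  simp (disch := omega) only [pairMem, ev_ex, ev_and, ev_isPair, ev_mem, Function.update_of_ne,
    Function.update_self, exists_eq_left]

theorem ev_tripleMem {x y z r : ℕ} (hx : x < d) (hy : y < d) (hz : z < d) (hr : r < d) :
    ev (tripleMem x y z r) d e ↔ tr (e x) (e y) (e z) ∊ e r := by
  simp (disch := omega) only [tripleMem, ev_ex, ev_and, ev_isTriple, ev_mem,
    Function.update_of_ne, Function.update_self, exists_eq_left]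

theorem ev_isOrd {x : ℕ} (hx : x < d) : ev (isOrd x) d e ↔ Ord (e x) := by
  simp (disch := omega) only [isOrd, ev_all, ev_and, ev_imp, ev_isTrans, ev_mem,
    Function.update_of_ne, Function.update_self, Ord]

theorem ev_isLimit {x : ℕ} (hx : x < d) : ev (isLimit x) d e ↔ Limit (e x) := by
  simp (disch := omega) only [isLimit, ev_all, ev_ex, ev_and, ev_imp, ev_isSucc, ev_mem,
    Function.update_of_ne, Function.update_self, Limit]

theorem ev_isFinite {x : ℕ} (hx : x < d) : ev (isFinite x) d e ↔ KFinite (e x) := by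
  simp (disch := omega) only [isFinite, ev_all, ev_and, ev_imp, ev_isEmpty, ev_isInsert, ev_mem,
    Function.update_of_ne, Function.update_self, KFinite]

/-- The step formula need only be correct at ordinals, because the domain of a recursion function on
`α + 1` consists of ordinals. This matters for `stepS`, which itself refers to recursions along its
argument. -/
theorem ev_recursion {F : M → M → M} [TmFun F] {step : ℕ → ℕ → ℕ → Fml}
    (hstep : ∀ d (e : ℕ → M) x y z, x < d → y < d → z < d → Ord (e x) →
      (ev (step x y z) d e ↔ e z = F (e x) (e y))) {α x : ℕ} (hα : α < d) (hx : x < d)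
    (ho : Ord (e α)) : ev (recursion step α x) d e ↔ e x = trec F (e α) := by
  rw [eq_trec_iff ho]
  have key : ev (recursion step α x) d e ↔ ∃ h, ((∀ p, p ∊ h → ∃ γ y, Le γ (e α) ∧ p = pr γ y) ∧
      (∀ γ, Le γ (e α) → ∃ y, ∀ z, pr γ z ∊ h ↔ z = y) ∧
      (∀ γ y, γ = emp ∧ pr γ y ∊ h → y = emp) ∧
      (∀ γ δ y z, δ = suc γ ∧ pr γ y ∊ h ∧ pr δ z ∊ h →
        ev (step (d + 1) (d + 1 + 1 + 1) (d + 1 + 1 + 1 + 1)) (d + 1 + 1 + 1 + 1 + 1)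
          (Function.update (Function.update (Function.update (Function.update
            (Function.update e d h) (d + 1) γ) (d + 1 + 1) δ) (d + 1 + 1 + 1) y)
              (d + 1 + 1 + 1 + 1) z)) ∧
      (∀ γ y, Limit γ ∧ pr γ y ∊ h → ∀ z, z ∊ y ↔ ∃ δ w, δ ∊ γ ∧ pr δ w ∊ h ∧ z ∊ w) ∧
      pr (e α) (e x) ∊ h) := by
    simp (disch := omega) only [recursion, ev_all, ev_ex, ev_and, ev_or, ev_imp, ev_iff,
      ev_isPair, ev_pairMem, ev_isEmpty, ev_isSucc, ev_isLimit, ev_mem, ev_eq,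
      Function.update_of_ne, Function.update_self, Le]
  rw [key, IsRec]
  refine exists_congr fun h => ?_
  rw [IsRecFun]
  simp only [and_assoc]
  refine and_congr_right fun hd => and_congr_right fun _ => and_congr_right fun _ =>
    and_congr_left fun _ => ?_
  refine forall₂_congr fun γ δ => forall₂_congr fun y z => imp_congr_right fun hγ => ?_
  have hγ : Ord γ := by
    obtain ⟨γ', y', hγ', e⟩ := hd _ hγ.2.1
    exact ho.of_le ((pr_inj.1 e).1 ▸ hγ')
  rw [hstep _ _ _ _ _ (by omega) (by omega) (by omega)]
  · simp (disch := omega) only [Function.update_of_ne, Function.update_self]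
  · simpa (disch := omega) only [Function.update_of_ne, Function.update_self] using hγ

theorem ev_isV {α x : ℕ} (hα : α < d) (hx : x < d) (ho : Ord (e α)) :
    ev (isV α x) d e ↔ e x = V (e α) :=
  ev_recursion (F := fun _ y => pow y) (fun _ _ _ _ _ _ hy hz _ => ev_isPower hz hy) hα hx ho

theorem ev_isSixTimes {α x : ℕ} (hα : α < d) (hx : x < d) (ho : Ord (e α)) :
    ev (isSixTimes α x) d e ↔ e x = six (e α) :=
  ev_recursion (F := fun _ y => addN 6 y) (fun _ _ _ _ _ _ hy hz _ => ev_isAdd 6 hz hy) hα hx ho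

theorem ev_isStruct {A D R E : ℕ} (hA : A < d) (hD : D < d) (hR : R < d) (hE : E < d) :
    ev (isStruct A D R E) d e ↔ IsStr (e A) (e D) (e R) (e E) := by
  simp (disch := omega) only [isStruct, ev_all, ev_ex, ev_and, ev_imp, ev_isTriple, ev_isPair,
    ev_isFinite, ev_tripleMem, ev_pairMem, ev_mem, Function.update_of_ne, Function.update_self]

theorem ev_isNeutralExt {D R E D' R' E' v : ℕ} (hD : D < d) (hR : R < d) (hE : E < d)
    (hD' : D' < d) (hR' : R' < d) (hE' : E' < d) (hv : v < d) :
    ev (isNeutralExt D R E D' R' E' v) d e ↔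
      NeutralExt (e D) (e R) (e E) (e D') (e R') (e E') (e v) := by
  simp (disch := omega) only [isNeutralExt, ev_all, ev_and, ev_not, ev_imp, ev_iff,
    ev_isInsert, ev_tripleMem, ev_pairMem, ev_mem, Function.update_of_ne, Function.update_self]

theorem ev_isAbsolute {D E : ℕ} (hD : D < d) (hE : E < d) :
    ev (isAbsolute D E) d e ↔ Absolute (e D) (e E) := by
  simp (disch := omega) only [isAbsolute, ev_all, ev_and, ev_imp, ev_iff, ev_pairMem, ev_mem,
    Function.update_of_ne, Function.update_self]

theorem ev_isRestr {D R s : ℕ} (hD : D < d) (hR : R < d) (hs : s < d) :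
    ev (isRestr D R s) d e ↔ Restr (e D) (e R) (e s) := by
  simp (disch := omega) only [isRestr, ev_all, ev_and, ev_imp, ev_iff, ev_tripleMem, ev_mem,
    Function.update_of_ne, Function.update_self]

theorem ev_isImage {D A B v κ x y : ℕ} (hD : D < d) (hA : A < d) (hB : B < d) (hv : v < d)
    (hκ : κ < d) (hx : x < d) (hy : y < d) : ev (isImage D A B v κ x y) d e ↔
      Image (e D) (e A) (e B) (e v) (e κ) (e x) (e y) := by
  simp (disch := omega) only [isImage, ev_ex, ev_and, ev_or, ev_isPair, ev_mem, ev_eq,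
    Function.update_of_ne, Function.update_self, exists_eq_left]

theorem ev_stepS {α s s' : ℕ} (hα : α < d) (hs : s < d) (hs' : s' < d) (ho : Ord (e α)) :
    ev (stepS α s s') d e ↔ e s' = sStep (e α) (e s) := by
  have ho' := ord_addN (ord_six ho) 6
  have key : e s' = sStep (e α) (e s) ↔ ∀ t, t ∊ e s' ↔ ∃ a b c, t = tr a b c ∧
      a ∊ V (addN 6 (six (e α))) ∧ b ∊ V (addN 6 (six (e α))) ∧ c ∊ V (addN 6 (six (e α))) ∧
      StepCond (W (e α)) (mark (e α)) (e s) a b c := by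
    refine ⟨fun h t => ?_, fun h => mext fun t => ?_⟩
    · rw [h]
      exact mem_stepSet ho'
    · rw [h]
      exact (mem_stepSet ho').symm
  have h0 : ∀ w w' κ, (∀ t, t ∊ e s' ↔ ∃ a b c, t = tr a b c ∧ a ∊ w' ∧ b ∊ w' ∧ c ∊ w' ∧
      StepCond w κ (e s) a b c) ↔ ∀ t, t ∊ e s' ↔ ∃ a b c, t = tr a b c ∧ a ∊ w' ∧ b ∊ w' ∧
      c ∊ w' ∧ (a ∊ w ∧ b ∊ w ∧ c ∊ w → t ∊ e s) ∧
      ∀ A D R E B D' R' E' v, Datum w (e s) A D R E B D' R' E' v → ∀ x y z,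
        Image D A B v κ x a ∧ Image D A B v κ y b ∧ Image D A B v κ z c → tr x y z ∊ R' := by
    refine fun w w' κ => forall_congr' fun t => iff_congr Iff.rfl ?_
    refine exists_congr fun a => exists₂_congr fun b c => and_congr_right ?_
    rintro rfl
    rfl
  rw [key, h0]
  simp (disch := omega) only [stepS, ev_all, ev_ex, ev_and, ev_imp, ev_iff, ev_isAdd, ev_isTriple,
    ev_isStruct, ev_isNeutralExt, ev_isAbsolute, ev_isRestr, ev_isImage, ev_subset, ev_tripleMem,
    ev_mem, Function.update_of_ne, Function.update_self]
  constructor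
  -- The auxiliary sets are determined one after another; each identification supplies the ordinal
  -- hypothesis for the next.
  · rintro ⟨β, w, β', w', κ, h1, h2, rfl, h3, rfl, h⟩
    rw [ev_isSixTimes (by omega) (by omega) (by
      simpa (disch := omega) only [Function.update_of_ne] using ho)] at h1
    simp (disch := omega) only [Function.update_of_ne, Function.update_self] at h1
    subst h1
    rw [ev_isV (by omega) (by omega) (by
      simpa (disch := omega) only [Function.update_of_ne, Function.update_self] using ord_six ho)]
      at h2
    rw [ev_isV (by omega) (by omega) (by
      simpa (disch := omega) only [Function.update_of_ne, Function.update_self] using ho')] at h3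
    simp (disch := omega) only [Function.update_of_ne, Function.update_self] at h2 h3
    subst h2 h3
    exact h
  · intro h
    refine ⟨six (e α), W (e α), addN 6 (six (e α)), V (addN 6 (six (e α))), mark (e α),
      ?_, ?_, rfl, ?_, rfl, h⟩
    · rw [ev_isSixTimes (by omega) (by omega)] <;>
        simp (disch := omega) only [Function.update_of_ne, Function.update_self, ho]
    · rw [ev_isV (by omega) (by omega)] <;>
        simp (disch := omega) only [Function.update_of_ne, Function.update_self, ord_six ho]
      rfl
    · rw [ev_isV (by omega) (by omega)] <;>
        simp (disch := omega) only [Function.update_of_ne, Function.update_self, ho']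

theorem ev_isSLevel {α x : ℕ} (hα : α < d) (hx : x < d) (ho : Ord (e α)) :
    ev (isSLevel α x) d e ↔ e x = sLev (e α) :=
  ev_recursion (F := sStep) (fun _ _ _ _ _ hx hy hz ho => ev_stepS hx hy hz ho) hα hx ho

theorem ev_defS {x y z : ℕ} (hx : x < d) (hy : y < d) (hz : z < d) :
    ev (defS x y z) d e ↔ SetS (e x) (e y) (e z) := by
  rw [defS, ev_ex]
  refine exists_congr fun α => ?_
  rw [ev_ex]
  have (r : M) : ev (Fml.and (isOrd d) (Fml.and (isSLevel d (d + 1)) (tripleMem x y z (d + 1))))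
      (d + 1 + 1) (Function.update (Function.update e d α) (d + 1) r) ↔
      Ord α ∧ r = sLev α ∧ tr (e x) (e y) (e z) ∊ r := by
    rw [ev_and, ev_isOrd (by omega), ev_and,
      ev_tripleMem (by omega) (by omega) (by omega) (by omega)]
    simp (disch := omega) only [Function.update_of_ne, Function.update_self]
    refine and_congr_right fun ho => and_congr_left fun _ => ?_
    rw [ev_isSLevel (by omega) (by omega)] <;>
      simp (disch := omega) only [Function.update_of_ne, Function.update_self, ho]
  simp only [this, exists_and_left, exists_eq_left]

end Translation

/-! ### Neutral extensions in models of the definitional extension -/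

section Conclusion

variable {M : Type} [(LMem.sum LS).Structure M] [Nonempty M]

/-- The defining axiom identifies `S` with the set-theoretic relation, and `forall_setS_iff`
identifies the membership defined from `S` with true membership. Irreflexivity of the latter
accounts for the clause on the new element alone. -/
theorem hasNeutralExtensions_reduct (hT : M ⊨ T₁) :
    @HasNeutralExtensions M ((LHom.sumInr : LS →ᴸ LMem.sum LS).reduct M) := by
  let i₁ : LMem.Structure M := (LHom.sumInl : LMem →ᴸ LMem.sum LS).reduct M
  let i₂ : LS.Structure M := (LHom.sumInr : LS →ᴸ LMem.sum LS).reduct M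
  have hM : M ⊨ ZFminusInfPlus :=
    (LHom.onTheory_model (LHom.sumInl : LMem →ᴸ LMem.sum LS) ZFminusInfPlus).1
      (hT.mono Set.subset_union_left)
  have hS (x y z : M) : RelS x y z ↔ SetS x y z := by
    have h := hT.realize_of_mem axiomS (.inr rfl)
    rw [axiomS, Sentence.Realize, BoundedFormula.realize_alls] at h
    have h := h ![x, y, z]
    rw [BoundedFormula.realize_iff, LHom.realize_onBoundedFormula,
      BoundedFormula.realize_rel] at h
    let e : ℕ → M := fun n => if h : n < 3 then ![x, y, z] ⟨n, h⟩ else x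
    have h' := ev_defS (d := 3) (e := e) (x := 0) (y := 1) (z := 2) (by omega) (by omega) (by omega)
    have he : (fun i : Fin 3 => e i) = ![x, y, z] := by
      funext i
      simp [e]
    rw [ev, he] at h'
    exact h.trans h'
  have hmem (x y : M) : MemS x y ↔ x ∊ y := by
    rw [← forall_setS_iff]
    exact forall_congr' fun z => hS x y z
  intro ι _ a P ha hP hPmem
  simp only [hS, hmem] at hP hPmem ⊢
  obtain ⟨b, hb, h⟩ := exists_setS_extension a P ha hP hPmem
  exact ⟨b, hb, not_mem_self b, h⟩

end Conclusion
end Tern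

/-- Every consistent computably enumerable theory in the language of `S` that extends `T₀`
has a computable model. -/
theorem theorem1 (T : Tern.LS.Theory) (hce : Tern.IsCE T) (hcons : Tern.Consistent T)
    (hext : ∀ σ ∈ Tern.T₀, Tern.Proves T σ) :
    Tern.HasComputableModel T := by
  exact Tern.hasComputableModel_of_extensions hce hcons.exists_model fun M _ _ hM =>
    Tern.hasNeutralExtensions_of_proves hext
      (fun N _ _ hN => Tern.hasNeutralExtensions_reduct hN) hM
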